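/- Let $A=(a_{ij})_{i,j\in I}$ be a generalized Cartan matrix ($I$ finite) with realisation $(\mathfrak h,\Pi,\Pi^\vee)$ over $\mathbb C$, let $\mathfrak g=\mathfrak g(A)$ be its Kac--Moody algebra (the quotient of the Lie algebra $\tilde{\mathfrak g}(A)$ by its largest ideal meeting $\mathfrak h$ trivially), $W\subset\mathrm{GL}(\mathfrak h^*)$ its Weyl group with length function $\ell$, $Q$ the root lattice, $Q^+$ the $\mathbb Z_{\ge0}$-span of the simple roots, $Q^-=-Q^+$, and $m(\alpha)=\dim\mathfrak g_\alpha$ for $\alpha\in Q$. Write $\lambda>0$ (resp. $\lambda<0$) if $0\neq\lambda\in Q^+$ (resp. $Q^-$). A root is real if it is $W$-conjugate to a simple root, and imaginary otherwise. Let $Q^-_{\mathrm{im}}$ be the $\mathbb Z_{\ge 0}$-span of the negative imaginary roots, and $\chi(q)=\sum_{w\in W}q^{\ell(w)}$. Good products over a subring $R$ of $\mathbb Z((q))$ are the formal products $$u\,e^{\lambda_0}\prod_{\lambda\in Q^-\setminus\{0\}}\prod_{n\in\mathbb Z}(1-q^ne^\lambda)^{m(\lambda,n)},\qquad u\in R^\times,\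 \lambda_0\in Q,\ m(\lambda,n)\in\mathbb Z,$$ such that for each $\lambda$ the set $\{n: m(\lambda,n)\ne0\}$ is bounded below, every $\lambda$ with some $m(\lambda,n)\neq0$ is a multiple of a root, for each real root $\alpha$ only finitely many pairs $(\lambda,n)$ with $\lambda\in\mathbb Z\alpha$ have $m(\lambda,n)\ne 0$, and whose expansion in powers of the $e^{-\alpha_i}$ is a formal sum $\sum_{\lambda\in\mathfrak h^*}a_\lambda e^\lambda$ with all $a_\lambda\in R$. An element $w\in W$ acts on good products over $\mathbb Z((q))$ multiplicatively by $w(u\,e^{\lambda_0})=u\,e^{w\lambda_0}$ and $$w(1-q^ne^\lambda)=\begin{cases}1-q^ne^{w\lambda},& w\lambda<0,\\ (-q^ne^{w\lambda})(1-q^{-n}e^{-w\lambda}),& w\lambda>0.\end{cases}$$ Let $$\Delta=\prod_{\alpha>0}\left(\frac{1-qe^{-\alpha}}{1-e^{-\alpha}}\right)^{m(\alpha)},\qquad \mathcal M(q)=\sum_{w\in W}\Delta^w ,\quad \Delta^w=w(\Delta),$$ where each $\Delta^w$ is expanded as a formal sum and the sum over $w$ is taken coefficientwise in every $q^ke^\lambda$.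 Then each $\Delta^w$ is a good product over $\mathbb Z((q))$, and $\mathcal M(q)$ is a well-defined formal sum with the following properties. 1. $\mathcal M(q)=\sum_\lambda a_\lambda e^\lambda$ is (the expansion of) a $W$-invariant good product with coefficients in $\mathbb Z[[q]]$; it is also $W$-invariant as a formal sum, i.e. $a_{w\lambda}=a_\lambda$ for all $w\in W$ and $\lambda\in\mathfrak h^*$. 2. $\mathcal M(q)$ is supported on $Q^-_{\mathrm{im}}$, i.e. $a_\lambda\neq0$ implies $\lambda\in Q^-_{\mathrm{im}}$. 3. The constant term of $\mathcal M(q)$ is $a_0=\chi(q)$. -/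

import Mathlib

open Filter

noncomputable section

namespace KacMoody

/-- Generalized Cartan matrices indexed by `ι`. -/
structure GCM (ι : Type*) where
  A : Matrix ι ι ℤ
  diag : ∀ i, A i i = 2
  nonpos : ∀ i j, i ≠ j → A i j ≤ 0
  zero_symm : ∀ i j, A i j = 0 → A j i = 0

/-- A realisation `(𝔥, Π, Π^∨)` of a generalized Cartan matrix: a complex vector space of dimension
`2 n - rank A`, with linearly independent simple roots and simple coroots pairing to `A`. -/
structure Realization {ι : Type*} [Fintype ι] (C : GCM ι)
    (𝔥 : Type*) [AddCommGroup 𝔥] [Module ℂ 𝔥] where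
  root : ι → Module.Dual ℂ 𝔥
  coroot : ι → 𝔥
  finiteDimensional : FiniteDimensional ℂ 𝔥
  root_indep : LinearIndependent ℂ root
  coroot_indep : LinearIndependent ℂ coroot
  pairing : ∀ i j, root j (coroot i) = (C.A i j : ℂ)
  dim : Module.finrank ℂ 𝔥 + (C.A.map (Int.cast : ℤ → ℂ)).rank = 2 * Fintype.card ι

/-! ### The Kac--Moody algebra -/

/-- Generators of the auxiliary Lie algebra. -/
inductive Gen (ι 𝔥 : Type*)
  | e : ι → Gen ι 𝔥
  | f : ι → Gen ι 𝔥
  | h : 𝔥 → Gen ι 𝔥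

section Algebra

variable {ι : Type*} [Fintype ι] {C : GCM ι} {𝔥 : Type*} [AddCommGroup 𝔥] [Module ℂ 𝔥]
  (R : Realization C 𝔥)

variable (ι 𝔥) in
/-- The free Lie algebra on the generators `e i`, `f i` (`i : ι`) and `h x` (`x : 𝔥`). -/
abbrev FreeAlg := FreeLieAlgebra ℂ (Gen ι 𝔥)

/-- The generator `e i`. -/
def genE (i : ι) : FreeAlg ι 𝔥 := FreeLieAlgebra.of ℂ (Gen.e i)

/-- The generator `f i`. -/
def genF (i : ι) : FreeAlg ι 𝔥 := FreeLieAlgebra.of ℂ (Gen.f i)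

/-- The generator `h x`. -/
def genH (x : 𝔥) : FreeAlg ι 𝔥 := FreeLieAlgebra.of ℂ (Gen.h x)

/-- The elements set equal to zero in the auxiliary algebra: linearity of `𝔥`, and
`[h, h'] = 0`, `[eᵢ, fⱼ] = δᵢⱼ αᵢ^∨`, `[h, eᵢ] = αᵢ(h) eᵢ`, `[h, fᵢ] = -αᵢ(h) fᵢ`. -/
inductive IsRelator : FreeAlg ι 𝔥 → Prop
  | add (x y : 𝔥) : IsRelator (genH (x + y) - (genH x + genH y))
  | smul (c : ℂ) (x : 𝔥) : IsRelator (genH (c • x) - c • genH x)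
  | hh (x y : 𝔥) : IsRelator ⁅(genH x : FreeAlg ι 𝔥), (genH y : FreeAlg ι 𝔥)⁆
  | ef_same (i : ι) :
      IsRelator (⁅(genE i : FreeAlg ι 𝔥), (genF i : FreeAlg ι 𝔥)⁆ - genH (R.coroot i))
  | ef_ne (i j : ι) (hij : i ≠ j) :
      IsRelator ⁅(genE i : FreeAlg ι 𝔥), (genF j : FreeAlg ι 𝔥)⁆
  | he (x : 𝔥) (i : ι) :
      IsRelator (⁅(genH x : FreeAlg ι 𝔥), (genE i : FreeAlg ι 𝔥)⁆ - R.root i x • genE i)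
  | hf (x : 𝔥) (i : ι) :
      IsRelator (⁅(genH x : FreeAlg ι 𝔥), (genF i : FreeAlg ι 𝔥)⁆ + R.root i x • genF i)

/-- The ideal generated by the relators. -/
def relIdeal : LieIdeal ℂ (FreeAlg ι 𝔥) :=
  LieSubmodule.lieSpan ℂ (FreeAlg ι 𝔥) {x | IsRelator R x}

/-- The auxiliary Lie algebra `𝔤̃(A)`. -/
abbrev AuxAlg := FreeAlg ι 𝔥 ⧸ relIdeal R

/-- The image of `x : 𝔥` in the auxiliary Lie algebra. -/
def auxCartan (x : 𝔥) : AuxAlg R :=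
  LieSubmodule.Quotient.mk (N := relIdeal R) (genH x)

/-- The largest ideal of `𝔤̃(A)` intersecting `𝔥` trivially (the sum of all such ideals). -/
def radIdeal : LieIdeal ℂ (AuxAlg R) :=
  sSup {I : LieIdeal ℂ (AuxAlg R) | ∀ x : 𝔥, auxCartan R x ∈ I → auxCartan R x = 0}

/-- The Kac--Moody algebra `𝔤(A) = 𝔤̃(A) / τ`. -/
abbrev Alg := AuxAlg R ⧸ radIdeal R

/-- The image of `x : 𝔥` in the Kac--Moody algebra. -/
def cartan (x : 𝔥) : Alg R :=
  LieSubmodule.Quotient.mk (N := radIdeal R) (auxCartan R x)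

/-- The root space `𝔤_α = {x | [h, x] = α(h) x for all h ∈ 𝔥}`. -/
def rootSpace (α : Module.Dual ℂ 𝔥) : Submodule ℂ (Alg R) where
  carrier := {x | ∀ y : 𝔥, ⁅cartan R y, x⁆ = α y • x}
  add_mem' := by
    intro a b ha hb y
    rw [lie_add, ha y, hb y, smul_add]
  zero_mem' := by
    intro y
    rw [lie_zero, smul_zero]
  smul_mem' := by
    intro c x hx y
    rw [lie_smul, hx y, smul_comm]

/-- The multiplicity `m(α) = dim 𝔤_α`. -/
def mult (α : Module.Dual ℂ 𝔥) : ℕ := Module.finrank ℂ (rootSpace R α)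

/-! ### Roots and the Weyl group -/

/-- The root lattice `Q`. -/
def rootLattice : AddSubgroup (Module.Dual ℂ 𝔥) := AddSubgroup.closure (Set.range R.root)

/-- The positive root cone `Q⁺`. -/
def rootCone : AddSubmonoid (Module.Dual ℂ 𝔥) := AddSubmonoid.closure (Set.range R.root)

/-- `α > 0`. -/
def IsPos (α : Module.Dual ℂ 𝔥) : Prop := α ∈ rootCone R ∧ α ≠ 0

/-- `α < 0`. -/
def IsNeg (α : Module.Dual ℂ 𝔥) : Prop := IsPos R (-α)

/-- `α ∈ Φ`: a nonzero element of `Q` with nonzero root space. -/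
def IsRoot (α : Module.Dual ℂ 𝔥) : Prop := α ∈ rootLattice R ∧ α ≠ 0 ∧ rootSpace R α ≠ ⊥

lemma root_coroot_two (i : ι) : Module.Dual.eval ℂ 𝔥 (R.coroot i) (R.root i) = 2 := by
  rw [Module.Dual.eval_apply, R.pairing, C.diag]
  norm_num

/-- The simple reflection `sᵢ λ = λ - λ(αᵢ^∨) αᵢ` of `𝔥*`. -/
def simpleRefl (i : ι) : Module.Dual ℂ 𝔥 ≃ₗ[ℂ] Module.Dual ℂ 𝔥 :=
  Module.reflection (root_coroot_two R i)

/-- The Weyl group `W`. -/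
def weyl : Subgroup (Module.Dual ℂ 𝔥 ≃ₗ[ℂ] Module.Dual ℂ 𝔥) :=
  Subgroup.closure (Set.range (simpleRefl R))

/-- The length `ℓ(w)`: the least length of a word in the simple reflections representing `w`. -/
def length (w : weyl R) : ℕ :=
  sInf {k | ∃ l : List ι, l.length = k ∧ (l.map (simpleRefl R)).prod = w.1}

/-- The Poincaré series `χ(q) = ∑_{w ∈ W} q^{ℓ(w)}`; there are finitely many `w` of each length. -/
def poincare : PowerSeries ℤ := PowerSeries.mk fun k => (Nat.card {w : weyl R // length R w = k} : ℤ)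

/-- Real roots: the roots that are `W`-conjugate to a simple root. -/
def IsRealRoot (α : Module.Dual ℂ 𝔥) : Prop :=
  IsRoot R α ∧ ∃ w : weyl R, ∃ i : ι, w.1 α = R.root i

/-- Imaginary roots: the roots that are not real. -/
def IsImRoot (α : Module.Dual ℂ 𝔥) : Prop := IsRoot R α ∧ ¬ IsRealRoot R α

/-- The negative imaginary cone `Q⁻_im`, generated (over `ℤ≥0`) by the negative imaginary roots. -/
def negImCone : AddSubmonoid (Module.Dual ℂ 𝔥) :=
  AddSubmonoid.closure {α | IsImRoot R α ∧ IsNeg R α}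

end Algebra

/-! ### Formal sums and good products -/

/-- The Laurent series `q ^ n`, as a unit of `ℤ((q))`. -/
def qPow (n : ℤ) : (LaurentSeries ℤ)ˣ where
  val := HahnSeries.single n 1
  inv := HahnSeries.single (-n) 1
  val_inv := by rw [HahnSeries.single_mul_single, add_neg_cancel, mul_one]; rfl
  inv_val := by rw [HahnSeries.single_mul_single, neg_add_cancel, mul_one]; rfl

/-- `ℤ[[q]]` as a subring of `ℤ((q))`. -/
def powerSeriesSubring : Subring (LaurentSeries ℤ) := (HahnSeries.ofPowerSeries ℤ ℤ).range

section Products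

variable {ι : Type*} [Fintype ι] {C : GCM ι} {𝔥 : Type*} [AddCommGroup 𝔥] [Module ℂ 𝔥]
  (R : Realization C 𝔥)

variable (𝔥) in
/-- Formal sums `∑_{λ ∈ 𝔥*} a_λ e^λ` with `a_λ ∈ ℤ((q))`. -/
abbrev FormalSum := Module.Dual ℂ 𝔥 → LaurentSeries ℤ

variable (𝔥) in
/-- The data of a formal product `u e^{λ₀} ∏_{λ < 0} ∏_{n ∈ ℤ} (1 - q^n e^λ)^{m(λ, n)}`. -/
structure ProductData where
  u : (LaurentSeries ℤ)ˣ
  shift : Module.Dual ℂ 𝔥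
  m : Module.Dual ℂ 𝔥 → ℤ → ℤ

/-- The data of a good product (with `u` a unit of `ℤ((q))`). -/
structure IsGood (D : ProductData 𝔥) : Prop where
  shift_mem : D.shift ∈ rootLattice R
  neg_of_ne : ∀ μ n, D.m μ n ≠ 0 → IsNeg R μ
  bddBelow : ∀ μ, BddBelow {n | D.m μ n ≠ 0}
  multiple : ∀ μ n, D.m μ n ≠ 0 → ∃ α, IsRoot R α ∧ ∃ k : ℤ, μ = k • α
  finite_real : ∀ α, IsRealRoot R α →
    {p : Module.Dual ℂ 𝔥 × ℤ | D.m p.1 p.2 ≠ 0 ∧ ∃ k : ℤ, p.1 = k • α}.Finite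

/-- The weight `-∑ dᵢ αᵢ`. -/
def negWt (d : ι →₀ ℕ) : Module.Dual ℂ 𝔥 := -∑ i, d i • R.root i

/-- `1 - q^n e^μ` for `μ = -∑ dᵢ αᵢ`, as a power series in the variables `e^{-αᵢ}`. -/
def factor (d : ι →₀ ℕ) (n : ℤ) : MvPowerSeries ι (LaurentSeries ℤ) :=
  1 - MvPowerSeries.monomial d (qPow n : LaurentSeries ℤ)

/-- `(1 - q^n e^μ)^m` for `m ∈ ℤ` and `μ = -∑ dᵢ αᵢ ≠ 0`, negative powers being expanded
as powers of the inverse in the ring of power series in the `e^{-αᵢ}`. -/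
def factorPow (d : ι →₀ ℕ) (n m : ℤ) : MvPowerSeries ι (LaurentSeries ℤ) :=
  factor d n ^ m.toNat * MvPowerSeries.invOfUnit (factor d n) 1 ^ (-m).toNat

/-- The finite partial products of `∏_{μ ∈ Q⁻ ∖ {0}} ∏_{n ∈ ℤ} (1 - q^n e^μ)^{m(μ, n)}`. -/
def partialProd (D : ProductData 𝔥) (S : Finset ({d : ι →₀ ℕ // d ≠ 0} × ℤ)) :
    MvPowerSeries ι (LaurentSeries ℤ) :=
  ∏ p ∈ S, factorPow p.1.1 p.2 (D.m (negWt R p.1.1) p.2)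

/-- The formal sum `f` is the expansion of the formal product `D`: the partial products converge,
each integer coefficient being eventually constant, to a series `F` with `f = u e^{λ₀} F`. -/
def IsExpansion (D : ProductData 𝔥) (f : FormalSum 𝔥) : Prop :=
  ∃ F : MvPowerSeries ι (LaurentSeries ℤ),
    (∀ (d : ι →₀ ℕ) (k : ℤ), ∀ᶠ S in atTop,
      (MvPowerSeries.coeff d (partialProd R D S)).coeff k = (MvPowerSeries.coeff d F).coeff k) ∧
    (∀ d : ι →₀ ℕ, f (D.shift + negWt R d) = D.u * MvPowerSeries.coeff d F) ∧
    ∀ μ, (∀ d : ι →₀ ℕ, μ ≠ D.shift + negWt R d) → f μ = 0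

open Classical in
/-- The action of `w` on formal products: multiplicative, with `u e^{λ₀} ↦ u e^{w λ₀}`, and
`1 - q^n e^λ ↦ 1 - q^n e^{wλ}` if `wλ < 0`,
`1 - q^n e^λ ↦ (-q^n e^{wλ}) (1 - q^{-n} e^{-wλ})` if `wλ > 0`. -/
def act (w : Module.Dual ℂ 𝔥 ≃ₗ[ℂ] Module.Dual ℂ 𝔥) (D : ProductData 𝔥) : ProductData 𝔥 where
  u := D.u * ∏ᶠ p : Module.Dual ℂ 𝔥 × ℤ, if IsPos R (w p.1) then (-qPow p.2) ^ D.m p.1 p.2 else 1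
  shift := w D.shift +
    ∑ᶠ p : Module.Dual ℂ 𝔥 × ℤ, if IsPos R (w p.1) then D.m p.1 p.2 • w p.1 else 0
  m := fun μ n =>
    if IsNeg R μ then
      if IsNeg R (w.symm μ) then D.m (w.symm μ) n
      else if IsPos R (w.symm μ) then D.m (-w.symm μ) (-n)
      else 0
    else 0

/-- The set `𝒢^W(S)` of `W`-invariant good products with coefficients in the subring `S` of
`ℤ((q))`, as formal sums: expansions `f`, with coefficients in `S`, of a good product whose
leading coefficient `u` is a unit of `S`, such that every `w ∈ W` takes this good product to one
which again expands to `f`. -/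
def invariantGoodProducts (S : Subring (LaurentSeries ℤ)) : Set (FormalSum 𝔥) :=
  {f | ∃ D : ProductData 𝔥, IsGood R D ∧
    (D.u : LaurentSeries ℤ) ∈ S ∧ ((D.u⁻¹ : (LaurentSeries ℤ)ˣ) : LaurentSeries ℤ) ∈ S ∧
    IsExpansion R D f ∧ (∀ μ, f μ ∈ S) ∧
    ∀ w : weyl R, IsGood R (act R w.1 D) ∧ IsExpansion R (act R w.1 D) f}

/-! ### The correction sum -/

open Classical in
/-- `Δ = ∏_{α > 0} ((1 - q e^{-α}) / (1 - e^{-α}))^{m(α)}`. -/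
def Delta : ProductData 𝔥 where
  u := 1
  shift := 0
  m := fun μ n =>
    if IsNeg R μ then
      if n = 1 then (mult R (-μ) : ℤ) else if n = 0 then -(mult R (-μ) : ℤ) else 0
    else 0

/-- `M` is the formal sum `∑_{w ∈ W} Δ^w`: every `Δ^w` is a good product which expands to a formal
sum, and for each `μ` and `k` the integer coefficients of `q^k e^μ` in the `Δ^w` (for the discrete
topology on `ℤ`) sum to that in `M`. -/
def IsCorrectionSum (M : FormalSum 𝔥) : Prop :=
  ∃ E : weyl R → FormalSum 𝔥,
    (∀ w, IsGood R (act R w.1 (Delta R)) ∧ IsExpansion R (act R w.1 (Delta R)) (E w)) ∧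
    ∀ (μ : Module.Dual ℂ 𝔥) (k : ℤ), HasSum (fun w => (E w μ).coeff k) ((M μ).coeff k)

end Products

end KacMoody

end

/-! The argument rests on explicit control of the series of `Δ^w`, followed by a passage from
invariance of coefficients to invariance of product exponents.

The roots whose sign changes under `w` are real of multiplicity one, and there are `ℓ(w)` positive
ones. Each replaces a factor `(1 - q e^{-α}) / (1 - e^{-α})` by `q (1 - q⁻¹ e^{-β}) / (1 - e^{-β})`
with `β = -wα`, the two monomial weights cancelling. So `Δ^w` is `q^{ℓ(w)}` times a product with
constant term `1` (`act_Delta_u`). A factor with `q⁻¹` costs at least one unit of height, so the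
coefficient at height `h` has order at least `ℓ(w) - h`; it also has order at least `0`, since there
are only `ℓ(w)` such factors (`deltaCoeff_bound`). Hence the sum over `w` is locally finite with
coefficients in `ℤ[[q]]`, and its constant term is `∑ q^{ℓ(w)}`.

For invariance, pair `w` with `sᵢ w`. Apart from the factor at `αᵢ`, the exponents of `Δ^w` and
`Δ^{sᵢ w}` are exchanged by `sᵢ`. Clearing the denominator `1 - e^{-αᵢ}` turns the sum of the two
series into a first-order difference equation along each `αᵢ`-string with antisymmetric right-hand
side, and this forces symmetry (`symm_of_sub_antisymm`, `coeff_add_symm`). Thus twice the correction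
sum, and so the sum itself, is invariant (`corrCoeff_isReflInvariant`).

An invariant series supported on `Q⁻` is supported on weights whose whole orbit lies in `Q⁻`, called
stable below. A stable weight is conjugate to an antidominant one. An antidominant weight splits
along the components of its support, and each piece is a multiple of a root with stable orbit, hence
of an imaginary root (`exists_multiple`, `neg_wt_mem_negImCone`). This is the support statement.

For the product statement, divide by the Poincaré series. A series with constant term `1` has a
unique product expansion, whose exponents are found by recursion (`expands_exponents`,
`Expands.exponent_eq`). By uniqueness the exponents inherit invariance and stable support, so `W`
permutes the factors without any sign change and fixes the product. It remains to see that they sit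
on multiples of roots, that is, that they vanish on disconnected supports. For `d₁`, `d₂` with
orthogonal supports, factor `W` as a parabolic subgroup times its minimal coset representatives.
Roots have connected support, so each coefficient of `Δ^{uv}` at `d₁ + d₂` splits into one of `Δ^u`
and one of `Δ^v` (`deltaCoeff_mul`). The normalized coefficients are then multiplicative and the
exponent at `d₁ + d₂` is zero (`corrExp_eq_zero_of_not_supportConnected`).

The Lie-theoretic input is developed from the definition: `W`-invariance of multiplicities by
exponentiating `ad eᵢ` and `ad fᵢ`, injectivity of `𝔥` by Verma modules, length as the number of
inversions, and root strings through `sl₂`-theory. -/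

noncomputable section

namespace KacMoody

/-! ### Lie algebras with Chevalley generators -/

/-! ### Weight decomposition of a Lie algebra with Chevalley generators. -/

section Chevalley

variable {ι : Type*} [Fintype ι] {C : GCM ι} {𝔥 : Type*} [AddCommGroup 𝔥] [Module ℂ 𝔥]
  {R : Realization C 𝔥}

/-- Generators of a Lie algebra satisfying the defining relations of the auxiliary algebra. -/
structure ChevalleySystem (R : Realization C 𝔥) (L : Type*) [LieRing L] [LieAlgebra ℂ L] where
  e : ι → L
  f : ι → L
  h : 𝔥 →ₗ[ℂ] L
  lie_h_h : ∀ x y, ⁅h x, h y⁆ = 0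
  lie_e_f : ∀ i, ⁅e i, f i⁆ = h (R.coroot i)
  lie_e_f_ne : ∀ i j, i ≠ j → ⁅e i, f j⁆ = 0
  lie_h_e : ∀ x i, ⁅h x, e i⁆ = R.root i x • e i
  lie_h_f : ∀ x i, ⁅h x, f i⁆ = -(R.root i x • f i)
  generates : ∀ K : LieSubalgebra ℂ L, (∀ i, e i ∈ K) → (∀ i, f i ∈ K) → (∀ x, h x ∈ K) → K = ⊤

namespace ChevalleySystem

variable {L : Type*} [LieRing L] [LieAlgebra ℂ L] (S : ChevalleySystem R L)

/-- The Chevalley involution, as a change of generators. -/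
def swap : ChevalleySystem R L where
  e := S.f
  f := S.e
  h := -S.h
  lie_h_h x y := by simp [S.lie_h_h]
  lie_e_f i := by rw [← lie_skew, S.lie_e_f]; rfl
  lie_e_f_ne i j hij := by rw [← lie_skew, S.lie_e_f_ne j i hij.symm, neg_zero]
  lie_h_e x i := by simp [S.lie_h_f]
  lie_h_f x i := by simp [S.lie_h_e]
  generates K he hf hh := S.generates K hf he fun x => by simpa using hh x

/-- The weight space of weight `α`. -/
def weightSpace (α : Module.Dual ℂ 𝔥) : Submodule ℂ L where
  carrier := {x | ∀ y : 𝔥, ⁅S.h y, x⁆ = α y • x}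
  add_mem' := by
    intro a b ha hb y
    rw [lie_add, ha y, hb y, smul_add]
  zero_mem' := by
    intro y
    rw [lie_zero, smul_zero]
  smul_mem' := by
    intro c x hx y
    rw [lie_smul, hx y, smul_comm]

lemma mem_weightSpace {α : Module.Dual ℂ 𝔥} {x : L} :
    x ∈ S.weightSpace α ↔ ∀ y : 𝔥, ⁅S.h y, x⁆ = α y • x := Iff.rfl

lemma swap_weightSpace (α : Module.Dual ℂ 𝔥) : S.swap.weightSpace α = S.weightSpace (-α) := by
  ext x
  simp only [mem_weightSpace, swap, LinearMap.neg_apply, neg_lie, neg_smul]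
  exact forall_congr' fun y => neg_eq_iff_eq_neg

lemma lie_mem_weightSpace {α β : Module.Dual ℂ 𝔥} {x y : L} (hx : x ∈ S.weightSpace α)
    (hy : y ∈ S.weightSpace β) : ⁅x, y⁆ ∈ S.weightSpace (α + β) := by
  intro z
  rw [leibniz_lie, hx z, hy z, smul_lie, lie_smul, LinearMap.add_apply, add_smul]

lemma e_mem (i : ι) : S.e i ∈ S.weightSpace (R.root i) := fun y => S.lie_h_e y i

lemma f_mem (i : ι) : S.f i ∈ S.weightSpace (-R.root i) := fun y => by
  rw [S.lie_h_f, LinearMap.neg_apply, neg_smul]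

lemma h_mem (x : 𝔥) : S.h x ∈ S.weightSpace 0 := fun y => by
  rw [S.lie_h_h, LinearMap.zero_apply, zero_smul]

/-- The iterated bracket `[e_{l₁}, [e_{l₂}, ⋯ [e_{lₖ}, e i]]]`. -/
def eWord (l : List ι) (i : ι) : L := l.foldr (fun j x => ⁅S.e j, x⁆) (S.e i)

variable (R) in
/-- The weight of an iterated bracket. -/
def wordWeight (l : List ι) (i : ι) : Module.Dual ℂ 𝔥 := (l.map R.root).sum + R.root i

lemma eWord_cons (j : ι) (l : List ι) (i : ι) : S.eWord (j :: l) i = ⁅S.e j, S.eWord l i⁆ := rfl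

lemma eWord_mem (l : List ι) (i : ι) : S.eWord l i ∈ S.weightSpace (wordWeight R l i) := by
  induction l with
  | nil => simpa [wordWeight, eWord] using S.e_mem i
  | cons j l ih =>
    have := S.lie_mem_weightSpace (S.e_mem j) ih
    rwa [wordWeight, List.map_cons, List.sum_cons, add_assoc]

/-- Iterated brackets of the `e i`, iterated brackets of the `f i`, and elements of `𝔥`. -/
inductive IsHomogeneous : Module.Dual ℂ 𝔥 → L → Prop
  | e (l i) : IsHomogeneous (wordWeight R l i) (S.eWord l i)
  | f (l i) : IsHomogeneous (-wordWeight R l i) (S.swap.eWord l i)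
  | h (x) : IsHomogeneous 0 (S.h x)

lemma IsHomogeneous.mem {α : Module.Dual ℂ 𝔥} {x : L} (hx : S.IsHomogeneous α x) :
    x ∈ S.weightSpace α := by
  cases hx with
  | e l i => exact S.eWord_mem l i
  | f l i => rw [← swap_weightSpace]; exact S.swap.eWord_mem l i
  | h x => exact S.h_mem x

lemma lie_e_mem_span (k : ι) {x : L}
    (hx : x ∈ Submodule.span ℂ (Set.range (Function.uncurry S.eWord))) :
    ⁅S.e k, x⁆ ∈ Submodule.span ℂ (Set.range (Function.uncurry S.eWord)) := by
  induction hx using Submodule.span_induction with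
  | mem x hx =>
    obtain ⟨⟨l, i⟩, rfl⟩ := hx
    exact Submodule.subset_span ⟨(k :: l, i), rfl⟩
  | zero => rw [lie_zero]; exact zero_mem _
  | add x y _ _ hx hy => rw [lie_add]; exact add_mem hx hy
  | smul c x _ hx => rw [lie_smul]; exact Submodule.smul_mem _ c hx

/-- Moving `f j` past a letter `e k` produces an element of `𝔥`, which only rescales the rest of the
word; on reaching the last letter an element of `𝔥` may remain. -/
lemma lie_f_eWord (j : ι) (l : List ι) (i : ι) :
    ⁅S.f j, S.eWord l i⁆ ∈
      Submodule.span ℂ (Set.range (Function.uncurry S.eWord)) ⊔ LinearMap.range S.h := by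
  classical
  have hef : ∀ k, ⁅S.f j, S.e k⁆ ∈ LinearMap.range S.h := fun k => by
    rw [← lie_skew]
    by_cases hjk : k = j
    · subst hjk
      rw [S.lie_e_f]
      exact neg_mem ⟨_, rfl⟩
    · rw [S.lie_e_f_ne k j hjk, neg_zero]
      exact zero_mem _
  induction l with
  | nil => exact Submodule.mem_sup_right (hef i)
  | cons k l ih =>
    rw [eWord_cons, leibniz_lie]
    apply add_mem
    · obtain ⟨y, hy⟩ := hef k
      rw [← hy, S.eWord_mem l i y]
      exact Submodule.mem_sup_left (Submodule.smul_mem _ _ (Submodule.subset_span ⟨(l, i), rfl⟩))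
    · obtain ⟨a, ha, b, ⟨y, rfl⟩, hab⟩ := Submodule.mem_sup.1 ih
      rw [← hab, lie_add]
      apply Submodule.mem_sup_left
      apply add_mem
      · exact S.lie_e_mem_span k ha
      · rw [← lie_skew, S.lie_h_e]
        exact neg_mem (Submodule.smul_mem _ _ (Submodule.subset_span ⟨([], k), rfl⟩))

/-- The span of the homogeneous elements. -/
lemma lie_mem_of_generators {P : Submodule ℂ L}
    (he : ∀ i, ∀ x ∈ P, ⁅S.e i, x⁆ ∈ P) (hf : ∀ i, ∀ x ∈ P, ⁅S.f i, x⁆ ∈ P)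
    (hh : ∀ y, ∀ x ∈ P, ⁅S.h y, x⁆ ∈ P) (z : L) {x : L} (hx : x ∈ P) : ⁅z, x⁆ ∈ P := by
  let K : LieSubalgebra ℂ L :=
    { carrier := {z | ∀ x ∈ P, ⁅z, x⁆ ∈ P}
      add_mem' := fun {a b} ha hb x hx => by rw [add_lie]; exact add_mem (ha x hx) (hb x hx)
      zero_mem' := fun x _ => by rw [zero_lie]; exact zero_mem _
      smul_mem' := fun c a ha x hx => by rw [smul_lie]; exact P.smul_mem c (ha x hx)
      lie_mem' := fun {a b} ha hb x hx => by
        rw [lie_lie]; exact sub_mem (ha _ (hb x hx)) (hb _ (ha x hx)) }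
  have : K = ⊤ := S.generates K (fun i => he i) (fun i => hf i) fun y => hh y
  have hz : z ∈ K := this ▸ LieSubalgebra.mem_top z
  exact hz x hx

/-- The span is stable under bracketing with each generator, hence with everything; it is therefore
a subalgebra, and it contains the generators. -/
lemma span_isHomogeneous : Submodule.span ℂ {x | ∃ α, S.IsHomogeneous α x} = ⊤ := by
  set P := Submodule.span ℂ {x | ∃ α, S.IsHomogeneous α x} with hP
  have key : ∀ z : L, (∀ α x, S.IsHomogeneous α x → ⁅z, x⁆ ∈ P) → ∀ x ∈ P, ⁅z, x⁆ ∈ P := by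
    intro z hz x hx
    induction hx using Submodule.span_induction with
    | mem x hx => obtain ⟨α, hα⟩ := hx; exact hz α x hα
    | zero => rw [lie_zero]; exact zero_mem _
    | add x y _ _ hx hy => rw [lie_add]; exact add_mem hx hy
    | smul c x _ hx => rw [lie_smul]; exact P.smul_mem c hx
  have hE : ∀ l i, S.eWord l i ∈ P := fun l i => Submodule.subset_span ⟨_, .e l i⟩
  have hF : ∀ l i, S.swap.eWord l i ∈ P := fun l i => Submodule.subset_span ⟨_, .f l i⟩
  have hH : ∀ x, S.h x ∈ P := fun x => Submodule.subset_span ⟨_, .h x⟩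
  have hh : ∀ y, ∀ x ∈ P, ⁅S.h y, x⁆ ∈ P := fun y => key _ fun α x hx => by
    rw [hx.mem S y]
    exact P.smul_mem _ (Submodule.subset_span ⟨_, hx⟩)
  have he : ∀ i, ∀ x ∈ P, ⁅S.e i, x⁆ ∈ P := fun j => key _ fun α x hx => by
    cases hx with
    | e l i => exact hE (j :: l) i
    | f l i =>
      refine (sup_le ?_ ?_ : _ ≤ P) (S.swap.lie_f_eWord j l i)
      · rw [Submodule.span_le]
        rintro _ ⟨⟨l, i⟩, rfl⟩
        exact hF l i
      · rintro _ ⟨y, rfl⟩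
        exact neg_mem (hH y)
    | h y =>
      rw [← lie_skew, S.lie_h_e]
      exact neg_mem (P.smul_mem _ (hE [] j))
  have hf : ∀ i, ∀ x ∈ P, ⁅S.f i, x⁆ ∈ P := fun j => key _ fun α x hx => by
    cases hx with
    | f l i => exact hF (j :: l) i
    | e l i =>
      refine (sup_le ?_ ?_ : _ ≤ P) (S.lie_f_eWord j l i)
      · rw [Submodule.span_le]
        rintro _ ⟨⟨l, i⟩, rfl⟩
        exact hE l i
      · rintro _ ⟨y, rfl⟩
        exact hH y
    | h y =>
      rw [← lie_skew, S.lie_h_f, neg_neg]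
      exact P.smul_mem _ (hF [] j)
  let K : LieSubalgebra ℂ L :=
    { P with lie_mem' := fun {a b} _ hb => S.lie_mem_of_generators he hf hh a hb }
  have hK : K = ⊤ := S.generates K (fun i => hE [] i) (fun i => hF [] i) hH
  rw [eq_top_iff]
  intro x _
  have hx : x ∈ K := hK ▸ LieSubalgebra.mem_top x
  exact hx

/-- The span of the homogeneous elements of weight `α`. -/
def component (α : Module.Dual ℂ 𝔥) : Submodule ℂ L := Submodule.span ℂ {x | S.IsHomogeneous α x}

lemma component_le (α : Module.Dual ℂ 𝔥) : S.component α ≤ S.weightSpace α :=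
  Submodule.span_le.2 fun _ hx => hx.mem S

lemma exists_decomposition (x : L) : ∃ (s : Finset (Module.Dual ℂ 𝔥)) (v : Module.Dual ℂ 𝔥 → L),
    (∀ α, v α ∈ S.component α) ∧ x = ∑ α ∈ s, v α := by
  classical
  have hx : x ∈ Submodule.span ℂ {x | ∃ α, S.IsHomogeneous α x} := by
    rw [S.span_isHomogeneous]; trivial
  have h2 : {x | ∃ α, S.IsHomogeneous α x} = ⋃ α, {x | S.IsHomogeneous α x} := by ext; simp
  rw [h2, Submodule.span_iUnion, Submodule.mem_iSup_iff_exists_finsupp] at hx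
  obtain ⟨f, hf, rfl⟩ := hx
  exact ⟨f.support, f, hf, rfl⟩

/-- Separation of eigenvalues one weight at a time: if `y` separates `β` from `γ`, the operator `ad
y - γ y` kills the `γ`-summand and rescales the `β`-summand by a nonzero scalar. With `P = ⊥` this
is independence of weight spaces; with `P` an ideal it says that ideals are graded. -/
lemma mem_of_add_sum_mem {P : Submodule ℂ L} (hP : ∀ y, ∀ x ∈ P, ⁅S.h y, x⁆ ∈ P)
    {β : Module.Dual ℂ 𝔥} {s : Finset (Module.Dual ℂ 𝔥)} :
    ∀ {x : L} {v : Module.Dual ℂ 𝔥 → L}, β ∉ s → x ∈ S.weightSpace β →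
      (∀ α, v α ∈ S.weightSpace α) → x + ∑ α ∈ s, v α ∈ P → x ∈ P := by
  classical
  induction s using Finset.induction_on with
  | empty => intro x v _ _ _ h; simpa using h
  | insert γ s hγ ih =>
    intro x v hβ hx hv h
    rw [Finset.mem_insert, not_or] at hβ
    obtain ⟨y, hy⟩ : ∃ y, β y ≠ γ y := by
      by_contra! h'
      exact hβ.1 (LinearMap.ext h')
    have h1 : ((β y - γ y) • x) + ∑ α ∈ s, (α y - γ y) • v α ∈ P := by
      have h3 := sub_mem (hP y _ h) (P.smul_mem (γ y) h)
      convert h3 using 1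
      rw [Finset.sum_insert hγ, lie_add, lie_add, lie_sum, hx y, hv γ y, smul_add, smul_add,
        Finset.smul_sum, Finset.sum_congr rfl fun α _ => hv α y]
      simp only [sub_smul, Finset.sum_sub_distrib]
      abel
    have h2 := ih hβ.2 ((S.weightSpace β).smul_mem _ hx)
      (fun α => (S.weightSpace α).smul_mem (α y - γ y) (hv α)) h1
    exact (P.smul_mem_iff (sub_ne_zero.2 hy)).1 h2

/-- Decomposing a weight vector into spans of words and comparing weights leaves only the term of
its own weight. All later information on weight spaces is obtained by inspecting words. -/
lemma component_eq (α : Module.Dual ℂ 𝔥) : S.component α = S.weightSpace α := by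
  classical
  refine le_antisymm (S.component_le α) fun x hx => ?_
  obtain ⟨s, v, hv, hs⟩ := S.exists_decomposition x
  set c : L := if α ∈ s then v α else 0 with hc
  have hcm : c ∈ S.component α := by
    rw [hc]; split_ifs
    exacts [hv α, zero_mem _]
  have h1 : (c - x) + ∑ β ∈ s.erase α, v β ∈ (⊥ : Submodule ℂ L) := by
    rw [Submodule.mem_bot, hc]
    split_ifs with h
    · rw [sub_add_eq_add_sub, Finset.add_sum_erase s v h, hs, sub_self]
    · rw [Finset.erase_eq_of_notMem h, hs]; abel
  have h2 := S.mem_of_add_sum_mem (P := ⊥) (fun y x hx => by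
    rw [Submodule.mem_bot] at hx ⊢; rw [hx, lie_zero]) (Finset.notMem_erase α s)
    (sub_mem (S.component_le α hcm) hx) (fun β => S.component_le β (hv β)) h1
  rw [Submodule.mem_bot, sub_eq_zero] at h2
  exact h2 ▸ hcm

/-- The sum of the weight spaces of nonzero weight. -/
def offCartan : Submodule ℂ L := ⨆ α : {α : Module.Dual ℂ 𝔥 // α ≠ 0}, S.weightSpace α

lemma weightSpace_le_offCartan {α : Module.Dual ℂ 𝔥} (hα : α ≠ 0) :
    S.weightSpace α ≤ S.offCartan :=
  le_iSup (fun α : {α : Module.Dual ℂ 𝔥 // α ≠ 0} => S.weightSpace α) ⟨α, hα⟩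

/-- `offCartan` serves as a linear certificate that an ideal meets `𝔥` trivially. Unlike the
condition itself, containment in `offCartan` visibly passes to sums of ideals. -/
lemma h_mem_offCartan {x : 𝔥} (hx : S.h x ∈ S.offCartan) : S.h x = 0 := by
  classical
  obtain ⟨f, hf, hs⟩ := (Submodule.mem_iSup_iff_exists_finsupp _ _).1 hx
  let v : Module.Dual ℂ 𝔥 → L := fun α => if h : α ≠ 0 then f ⟨α, h⟩ else 0
  have hv : ∀ α, v α ∈ S.weightSpace α := fun α => by
    by_cases h : α ≠ 0
    · simpa [v, h] using hf ⟨α, h⟩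
    · rw [show v α = 0 from dif_neg h]
      exact zero_mem _
  have h1 : -S.h x + ∑ α ∈ f.support.map (Function.Embedding.subtype _), v α ∈
      (⊥ : Submodule ℂ L) := by
    rw [Submodule.mem_bot, Finset.sum_map, ← hs, Finsupp.sum, neg_add_eq_zero]
    refine Finset.sum_congr rfl fun α _ => ?_
    have := α.2
    simp [v, this]
  have h2 := S.mem_of_add_sum_mem (P := ⊥) (β := 0) (fun y x hx => by
    rw [Submodule.mem_bot] at hx ⊢; rw [hx, lie_zero]) (by simp)
    (neg_mem (S.h_mem x)) hv h1
  simpa using h2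

/-- The weight `∑ dᵢ αᵢ`. -/
def _root_.KacMoody.wt (R : Realization C 𝔥) (d : ι →₀ ℕ) : Module.Dual ℂ 𝔥 := ∑ i, d i • R.root i

lemma _root_.KacMoody.sum_root_injective (R : Realization C 𝔥) {c d : ι → ℂ}
    (h : ∑ i, c i • R.root i = ∑ i, d i • R.root i) : c = d := by
  funext i
  have h1 : ∑ i, (c i - d i) • R.root i = 0 := by
    simp only [sub_smul, Finset.sum_sub_distrib, h, sub_self]
  exact sub_eq_zero.1 (Fintype.linearIndependent_iff.1 R.root_indep _ h1 i)

lemma _root_.KacMoody.sum_zsmul_root_injective (R : Realization C 𝔥) {c d : ι → ℤ}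
    (h : ∑ i, c i • R.root i = ∑ i, d i • R.root i) : c = d := by
  have := sum_root_injective R (c := fun i => (c i : ℂ)) (d := fun i => (d i : ℂ))
    (by simpa only [Int.cast_smul_eq_zsmul] using h)
  funext i
  exact_mod_cast congrFun this i

lemma _root_.KacMoody.wt_add (d d' : ι →₀ ℕ) : wt R (d + d') = wt R d + wt R d' := by
  simp [wt, add_smul, Finset.sum_add_distrib]

@[simp] lemma _root_.KacMoody.wt_zero : wt R (0 : ι →₀ ℕ) = 0 := by simp [wt]

@[simp] lemma _root_.KacMoody.wt_single (i : ι) (n : ℕ) :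
    wt R (Finsupp.single i n) = n • R.root i := by
  classical
  rw [wt, Finset.sum_eq_single i]
  · simp
  · intro j _ hj
    simp [Finsupp.single_eq_of_ne hj]
  · simp

lemma _root_.KacMoody.wt_nsmul (n : ℕ) (d : ι →₀ ℕ) : wt R (n • d) = n • wt R d := by
  simp [wt, mul_smul, Finset.smul_sum]

lemma _root_.KacMoody.wt_eq_zsmul (d : ι →₀ ℕ) : wt R d = ∑ i, (d i : ℤ) • R.root i := by
  simp [wt]

lemma _root_.KacMoody.wt_injective : Function.Injective (wt R) := by
  intro d d' h
  rw [wt_eq_zsmul, wt_eq_zsmul] at h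
  ext i
  exact_mod_cast congrFun (sum_zsmul_root_injective R h) i

lemma _root_.KacMoody.wt_add_wt_eq_zero {d d' : ι →₀ ℕ} (h : wt R d + wt R d' = 0) : d = 0 := by
  rw [← wt_add, ← wt_zero (R := R)] at h
  exact (add_eq_zero.1 (wt_injective h)).1

/-- The multiset of letters of an iterated bracket. -/
def wordContent (l : List ι) (i : ι) : ι →₀ ℕ :=
  (l.map fun j => Finsupp.single j 1).sum + Finsupp.single i 1

lemma wordContent_cons (j : ι) (l : List ι) (i : ι) :
    wordContent (j :: l) i = Finsupp.single j 1 + wordContent l i := by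
  simp [wordContent, add_assoc]

lemma wordWeight_eq (l : List ι) (i : ι) : wordWeight R l i = wt R (wordContent l i) := by
  induction l with
  | nil => simp [wordWeight, wordContent]
  | cons j l ih =>
    rw [wordContent_cons, wt_add, ← ih]
    simp [wordWeight, add_assoc]

lemma wordContent_ne_zero (l : List ι) (i : ι) : wordContent l i ≠ 0 := by
  intro h
  have := DFunLike.congr_fun (add_eq_zero.1 h).2 i
  simp at this

lemma exists_isHomogeneous_ne_zero {α : Module.Dual ℂ 𝔥} (h : S.weightSpace α ≠ ⊥) :
    ∃ x, S.IsHomogeneous α x ∧ x ≠ 0 := by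
  by_contra! h'
  apply h
  rw [← component_eq, component, Submodule.span_eq_bot]
  exact h'

lemma weightSpace_ne_bot_cases {α : Module.Dual ℂ 𝔥} (h : S.weightSpace α ≠ ⊥) :
    α = 0 ∨ (∃ l i, α = wt R (wordContent l i) ∧ S.eWord l i ≠ 0) ∨
      ∃ l i, α = -wt R (wordContent l i) ∧ S.swap.eWord l i ≠ 0 := by
  obtain ⟨x, hx, h0⟩ := S.exists_isHomogeneous_ne_zero h
  cases hx with
  | e l i => exact .inr (.inl ⟨l, i, wordWeight_eq l i, h0⟩)
  | f l i => exact .inr (.inr ⟨l, i, by rw [wordWeight_eq], h0⟩)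
  | h x => exact .inl rfl

lemma exists_eWord_of_weightSpace_ne_bot {d : ι →₀ ℕ} (hd : d ≠ 0)
    (h : S.weightSpace (wt R d) ≠ ⊥) : ∃ l i, wordContent l i = d ∧ S.eWord l i ≠ 0 := by
  rcases S.weightSpace_ne_bot_cases h with h | ⟨l, i, h, h0⟩ | ⟨l, i, h, h0⟩
  · exact absurd (wt_injective (h.trans wt_zero.symm)) hd
  · exact ⟨l, i, (wt_injective h).symm, h0⟩
  · exact absurd (wt_add_wt_eq_zero (add_eq_zero_iff_eq_neg.2 h)) hd

lemma weightSpace_zero : S.weightSpace 0 = LinearMap.range S.h := by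
  refine le_antisymm ?_ (by rintro _ ⟨x, rfl⟩; exact S.h_mem x)
  rw [← component_eq, component, Submodule.span_le]
  intro x hx
  generalize hα : (0 : Module.Dual ℂ 𝔥) = α at hx
  cases hx with
  | e l i =>
    rw [wordWeight_eq, ← wt_zero (R := R)] at hα
    exact absurd (wt_injective hα).symm (wordContent_ne_zero l i)
  | f l i =>
    rw [wordWeight_eq, eq_comm, neg_eq_zero, ← wt_zero (R := R)] at hα
    exact absurd (wt_injective hα) (wordContent_ne_zero l i)
  | h x => exact ⟨x, rfl⟩

lemma wordContent_apply_pos {l : List ι} {i j : ι} (h : j ∈ i :: l) : 0 < wordContent l i j := by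
  induction l with
  | nil =>
    rw [List.mem_singleton] at h
    simp [wordContent, h]
  | cons k l ih =>
    rw [wordContent_cons, Finsupp.add_apply]
    by_cases hk : j = k
    · subst hk; simp
    · have := ih (by simp_all)
      omega

lemma eWord_eq_zero_of_const {l : List ι} {i : ι} (h : ∀ j ∈ l, j = i) (hl : l ≠ []) :
    S.eWord l i = 0 := by
  induction l with
  | nil => exact absurd rfl hl
  | cons j l ih =>
    obtain rfl : j = i := h j (by simp)
    rw [eWord_cons]
    by_cases hl' : l = []
    · subst hl'
      exact lie_self _
    · rw [ih (fun k hk => h k (by simp [hk])) hl', lie_zero]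

lemma wordContent_eq_single {l : List ι} {i j : ι} {n : ℕ}
    (h : wordContent l i = Finsupp.single j n) : i = j ∧ ∀ k ∈ l, k = i := by
  classical
  have key : ∀ k ∈ i :: l, k = j := fun k hk => by
    have := wordContent_apply_pos hk
    rw [h, Finsupp.single_apply] at this
    by_contra hne
    rw [if_neg (Ne.symm hne)] at this
    exact lt_irrefl _ this
  have hi := key i (by simp)
  exact ⟨hi, fun k hk => (key k (by simp [hk])).trans hi.symm⟩

lemma wordContent_const (l : List ι) (i : ι) (h : ∀ k ∈ l, k = i) :
    wordContent l i = Finsupp.single i (l.length + 1) := by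
  induction l with
  | nil => simp [wordContent]
  | cons j l ih =>
    rw [wordContent_cons, ih fun k hk => h k (by simp [hk]), h j (by simp), ← Finsupp.single_add,
      List.length_cons, add_comm 1]

lemma weightSpace_root (i : ι) : S.weightSpace (R.root i) = Submodule.span ℂ {S.e i} := by
  refine le_antisymm ?_ (by simpa using S.e_mem i)
  rw [← component_eq, component, Submodule.span_le]
  intro x hx
  have hi : R.root i = wt R (Finsupp.single i 1) := by simp
  generalize hα : R.root i = α at hx
  rw [hi] at hα
  cases hx with
  | e l j =>
    rw [wordWeight_eq] at hα
    have h1 := (wt_injective hα).symm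
    obtain ⟨rfl, hl⟩ := wordContent_eq_single h1
    rw [wordContent_const l j hl] at h1
    have h2 := Finsupp.single_injective _ h1
    obtain rfl : l = [] := List.length_eq_zero_iff.1 (by omega)
    exact Submodule.mem_span_singleton_self _
  | f l j =>
    rw [wordWeight_eq] at hα
    have := wt_add_wt_eq_zero (add_eq_zero_iff_eq_neg.2 hα)
    simp at this
  | h x =>
    have := wt_injective (hα.trans wt_zero.symm)
    simp at this

/-- The only words available are powers of a single letter, and these vanish because the innermost
bracket is `⁅e i, e i⁆`. -/
lemma weightSpace_nsmul_root {n : ℕ} (hn : 2 ≤ n) (i : ι) :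
    S.weightSpace (n • R.root i) = ⊥ := by
  by_contra h
  rw [← wt_single] at h
  obtain ⟨l, j, hl, h0⟩ := S.exists_eWord_of_weightSpace_ne_bot
    (by rw [Ne, Finsupp.single_eq_zero]; omega) h
  obtain ⟨rfl, hl'⟩ := wordContent_eq_single hl
  rw [wordContent_const l j hl'] at hl
  have h2 := Finsupp.single_injective _ hl
  exact h0 (S.eWord_eq_zero_of_const hl' (by rintro rfl; simp at h2; omega))

end ChevalleySystem

end Chevalley

end KacMoody

end

/-! ### Integrability and lifts of simple reflections to the Lie algebra. -/

noncomputable section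

namespace KacMoody

section Integrable

variable {ι : Type*} [Fintype ι] {C : GCM ι} {𝔥 : Type*} [AddCommGroup 𝔥] [Module ℂ 𝔥]
  {R : Realization C 𝔥}

namespace ChevalleySystem

variable {L : Type*} [LieRing L] [LieAlgebra ℂ L] (S : ChevalleySystem R L)

lemma ideal_le_offCartan {I : LieIdeal ℂ L} (hI : ∀ x, S.h x ∈ I → S.h x = 0) :
    I.toSubmodule ≤ S.offCartan := by
  classical
  intro x hx
  obtain ⟨s, v, hv, rfl⟩ := S.exists_decomposition x
  have h0 : (if (0 : Module.Dual ℂ 𝔥) ∈ s then v 0 else 0) = 0 := by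
    split_ifs with h
    · rw [← Finset.add_sum_erase s v h] at hx
      have h1 := S.mem_of_add_sum_mem (P := I.toSubmodule) (fun y x hx => lie_mem_right ℂ L I _ _ hx)
        (Finset.notMem_erase 0 s) (S.component_le 0 (hv 0)) (fun α => S.component_le α (hv α)) hx
      obtain ⟨y, hy⟩ : v 0 ∈ LinearMap.range S.h := S.weightSpace_zero ▸ S.component_le 0 (hv 0)
      rw [← hy] at h1 ⊢
      exact hI y h1
    · rfl
  refine sum_mem fun α hα => ?_
  by_cases h : α = 0
  · subst h
    rw [if_pos hα] at h0
    rw [h0]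
    exact zero_mem _
  · exact S.weightSpace_le_offCartan h (S.component_le α (hv α))

/-- Every nonzero ideal meets `𝔥` nontrivially. -/
def IsReduced : Prop := ∀ I : LieIdeal ℂ L, (∀ x, S.h x ∈ I → S.h x = 0) → I = ⊥

variable {S}

lemma IsReduced.swap (hS : S.IsReduced) : S.swap.IsReduced := fun I hI =>
  hS I fun x hx => by
    have := hI x (by simpa [ChevalleySystem.swap] using hx)
    simpa [ChevalleySystem.swap] using this

/-- The ideal generated by a vector killed by all `e k` is spanned by the `f`-words applied to it.
These have strictly negative weights, so the ideal misses `𝔥` and must be zero. -/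
lemma IsReduced.eq_zero_of_lie_e_eq_zero (hS : S.IsReduced) {d : ι →₀ ℕ} (hd : d ≠ 0) {x : L}
    (hx : x ∈ S.weightSpace (-wt R d)) (he : ∀ k, ⁅S.e k, x⁆ = 0) : x = 0 := by
  set F : List ι → L := fun l => l.foldr (fun j y => ⁅S.f j, y⁆) x with hF
  have hFmem : ∀ l, ∃ d', d' ≠ 0 ∧ F l ∈ S.weightSpace (-wt R d') := by
    intro l
    induction l with
    | nil => exact ⟨d, hd, hx⟩
    | cons j l ih =>
      obtain ⟨d', hd', h⟩ := ih
      refine ⟨Finsupp.single j 1 + d', fun h => hd' (add_eq_zero.1 h).2, ?_⟩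
      have := S.lie_mem_weightSpace (S.f_mem j) h
      rwa [wt_add, neg_add, wt_single, one_smul]
  set P := Submodule.span ℂ (Set.range F) with hP
  have key : ∀ z : L, (∀ l, ⁅z, F l⁆ ∈ P) → ∀ x ∈ P, ⁅z, x⁆ ∈ P := by
    intro z hz x hx
    induction hx using Submodule.span_induction with
    | mem x hx => obtain ⟨l, rfl⟩ := hx; exact hz l
    | zero => rw [lie_zero]; exact zero_mem _
    | add x y _ _ hx hy => rw [lie_add]; exact add_mem hx hy
    | smul c x _ hx => rw [lie_smul]; exact P.smul_mem c hx
  have hFP : ∀ l, F l ∈ P := fun l => Submodule.subset_span ⟨l, rfl⟩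
  have hf : ∀ i, ∀ x ∈ P, ⁅S.f i, x⁆ ∈ P := fun i => key _ fun l => hFP (i :: l)
  have hh : ∀ y, ∀ x ∈ P, ⁅S.h y, x⁆ ∈ P := fun y => key _ fun l => by
    obtain ⟨d', -, h⟩ := hFmem l
    rw [h y]
    exact P.smul_mem _ (hFP l)
  have he' : ∀ i, ∀ x ∈ P, ⁅S.e i, x⁆ ∈ P := fun i => key _ fun l => by
    induction l with
    | nil => rw [show F [] = x from rfl, he]; exact zero_mem _
    | cons j l ih =>
      rw [show F (j :: l) = ⁅S.f j, F l⁆ from rfl, leibniz_lie]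
      refine add_mem ?_ (hf j _ ih)
      by_cases hij : i = j
      · subst hij
        rw [S.lie_e_f]
        exact hh _ _ (hFP l)
      · rw [S.lie_e_f_ne i j hij, zero_lie]
        exact zero_mem _
  let I : LieIdeal ℂ L :=
    { P with lie_mem := fun {z x} hx => S.lie_mem_of_generators he' hf hh z hx }
  have hI : I = ⊥ := hS I fun y hy => S.h_mem_offCartan <| by
    refine (Submodule.span_le.2 ?_ : P ≤ S.offCartan) hy
    rintro _ ⟨l, rfl⟩
    obtain ⟨d', hd', h⟩ := hFmem l
    exact S.weightSpace_le_offCartan (by simpa using fun h => hd' (wt_injective (h.trans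
      wt_zero.symm))) h
  have : x ∈ I := hFP []
  rw [hI] at this
  simpa using this

variable (S) in
lemma isSl2Triple (hinj : Function.Injective S.h) (i : ι) :
    IsSl2Triple (S.h (R.coroot i)) (S.e i) (S.f i) where
  h_ne_zero := by
    rw [Ne, map_eq_zero_iff _ hinj]
    exact R.coroot_indep.ne_zero i
  lie_e_f := S.lie_e_f i
  lie_h_e_nsmul := by
    rw [S.lie_h_e, R.pairing, C.diag, two_smul]
    norm_num [two_smul]
  lie_h_f_nsmul := by
    rw [S.lie_h_f, R.pairing, C.diag, two_smul]
    norm_num [two_smul]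

open LieAlgebra in
-- The Serre relation follows from `eq_zero_of_lie_e_eq_zero`. The operator `ad (e i)` kills the
-- vector by the `sl₂` formula, whose scalar vanishes exactly at power `n + 1`; the other `e k`
-- commute with `f i`, so they need only be applied to `f j`.
lemma IsReduced.serre (hS : S.IsReduced) (hinj : Function.Injective S.h) {i j : ι} (hij : i ≠ j) :
    ((ad ℂ L (S.f i)) ^ ((-C.A i j).toNat + 1)) (S.f j) = 0 := by
  set n := (-C.A i j).toNat with hn
  have hnz : (n : ℤ) = -C.A i j := Int.toNat_of_nonneg (by have := C.nonpos i j hij; omega)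
  have hw : ∀ m : ℕ, ((ad ℂ L (S.f i)) ^ m) (S.f j) ∈
      S.weightSpace (-wt R (m • Finsupp.single i 1 + Finsupp.single j 1)) := by
    intro m
    induction m with
    | zero => simpa using S.f_mem j
    | succ m ih =>
      rw [pow_succ', Module.End.mul_apply, ad_apply]
      have := S.lie_mem_weightSpace (S.f_mem i) ih
      convert this using 2
      simp only [wt_add, wt_nsmul, wt_single, one_smul, add_smul]
      abel
  refine hS.eq_zero_of_lie_e_eq_zero (fun h => ?_) (hw (n + 1)) fun k => ?_
  · have := DFunLike.congr_fun (add_eq_zero.1 h).2 j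
    simp at this
  by_cases hki : k = i
  · subst hki
    by_cases hf0 : S.f j = 0
    · simp [hf0]
    have hP : IsSl2Triple.HasPrimitiveVectorWith (S.isSl2Triple hinj k) (S.f j)
        (-(C.A k j : ℂ)) := ⟨hf0, by rw [S.lie_h_f, R.pairing, neg_smul], S.lie_e_f_ne k j hij⟩
    have h1 := hP.lie_e_pow_succ_toEnd_f n
    have h2 : (n : ℂ) = -(C.A k j : ℂ) := by exact_mod_cast congrArg (Int.cast : ℤ → ℂ) hnz
    rw [h2, sub_self, mul_zero, zero_smul] at h1
    exact h1
  · have hcomm : ∀ m : ℕ, ⁅S.e k, ((ad ℂ L (S.f i)) ^ m) (S.f j)⁆ =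
        ((ad ℂ L (S.f i)) ^ m) ⁅S.e k, S.f j⁆ := by
      intro m
      induction m with
      | zero => rfl
      | succ m ih =>
        rw [pow_succ', Module.End.mul_apply, Module.End.mul_apply, ad_apply, ad_apply, leibniz_lie,
          S.lie_e_f_ne k i hki, zero_lie, zero_add, ih]
    rw [hcomm]
    by_cases hkj : k = j
    · subst hkj
      rw [S.lie_e_f, pow_succ, Module.End.mul_apply, ad_apply, ← lie_skew, S.lie_h_f, neg_neg,
        R.pairing]
      -- What is left is a multiple of `(ad f i)ⁿ (f i)`. If the Cartan entry is zero, then `n = 0`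
      -- but the multiple vanishes by `zero_symm`; otherwise `n ≥ 1` and `⁅f i, f i⁆ = 0` applies.
      by_cases ha : C.A i k = 0
      · rw [C.zero_symm i k ha]
        simp
      · obtain ⟨m, hm⟩ : ∃ m, n = m + 1 := ⟨n - 1, by omega⟩
        rw [hm, pow_succ, Module.End.mul_apply, map_smul, ad_apply, lie_self, smul_zero, map_zero]
    · rw [S.lie_e_f_ne k j hkj, map_zero]

open LieAlgebra in
-- The vectors killed by some power of `ad (f i)` form a subalgebra, the Engel subalgebra, so only
-- generators need checking. The Serre relation handles `f j`; the remaining cases are direct.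
lemma IsReduced.ad_f_locallyNilpotent (hS : S.IsReduced) (hinj : Function.Injective S.h) (i : ι)
    (x : L) : ∃ n : ℕ, ((ad ℂ L (S.f i)) ^ n) x = 0 := by
  have hf : ⁅S.f i, S.h (R.coroot i)⁆ = (2 : ℂ) • S.f i := by
    rw [← lie_skew, S.lie_h_f, neg_neg, R.pairing, C.diag]
    norm_num
  have : LieSubalgebra.engel ℂ (S.f i) = ⊤ := by
    refine S.generates _ (fun j => ?_) (fun j => ?_) fun y => ?_
    · rw [LieSubalgebra.mem_engel_iff]
      by_cases hji : j = i
      · subst hji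
        refine ⟨3, ?_⟩
        have h1 : ⁅S.f j, S.e j⁆ = -S.h (R.coroot j) := by rw [← lie_skew, S.lie_e_f]
        simp [pow_succ, h1, hf]
      · refine ⟨1, ?_⟩
        rw [pow_one, ad_apply, ← lie_skew, S.lie_e_f_ne j i hji, neg_zero]
    · rw [LieSubalgebra.mem_engel_iff]
      by_cases hji : i = j
      · subst hji
        exact ⟨1, by simp⟩
      · exact ⟨_, hS.serre hinj hji⟩
    · rw [LieSubalgebra.mem_engel_iff]
      refine ⟨2, ?_⟩
      have h1 : ⁅S.f i, S.h y⁆ = R.root i y • S.f i := by rw [← lie_skew, S.lie_h_f, neg_neg]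
      simp [pow_two, h1]
  rw [← LieSubalgebra.mem_engel_iff, this]
  exact LieSubalgebra.mem_top x

open LieAlgebra in
lemma IsReduced.ad_e_locallyNilpotent (hS : S.IsReduced) (hinj : Function.Injective S.h) (i : ι)
    (x : L) : ∃ n : ℕ, ((ad ℂ L (S.e i)) ^ n) x = 0 :=
  hS.swap.ad_f_locallyNilpotent (fun _ _ hxy => hinj (neg_injective hxy)) i x

end ChevalleySystem

/-! ### Exponentials of locally nilpotent inner derivations -/

section Exp

open LieAlgebra Finset

variable {L : Type*} [LieRing L] [LieAlgebra ℂ L]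

/-- The exponential of an endomorphism at a vector, as a finite sum. -/
lemma exp_sum_eq {D : Module.End ℂ L} {x : L} {m n : ℕ} (hm : (D ^ m) x = 0) (hn : m ≤ n) :
    ∑ k ∈ range n, (k.factorial : ℂ)⁻¹ • (D ^ k) x =
      ∑ k ∈ range m, (k.factorial : ℂ)⁻¹ • (D ^ k) x := by
  symm
  refine sum_subset (range_mono hn) fun k _ hk => ?_
  rw [Module.End.pow_map_zero_of_le (by simpa using hk) hm, smul_zero]

open Classical in
/-- The exponential of `ad a`, for `ad a` locally nilpotent. -/
def expAdFun (a : L) (h : ∀ x, ∃ n : ℕ, ((ad ℂ L a) ^ n) x = 0) (x : L) : L :=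
  ∑ k ∈ range (Nat.find (h x)), (k.factorial : ℂ)⁻¹ • ((ad ℂ L a) ^ k) x

lemma expAdFun_eq {a : L} (h : ∀ x, ∃ n : ℕ, ((ad ℂ L a) ^ n) x = 0) {x : L} {n : ℕ}
    (hn : ((ad ℂ L a) ^ n) x = 0) :
    expAdFun a h x = ∑ k ∈ range n, (k.factorial : ℂ)⁻¹ • ((ad ℂ L a) ^ k) x := by
  classical
  exact (exp_sum_eq (Nat.find_spec (h x)) (Nat.find_min' _ hn)).symm

/-- The automorphism `exp (ad a)`, for `ad a` locally nilpotent. -/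
def expAd (a : L) (h : ∀ x, ∃ n : ℕ, ((ad ℂ L a) ^ n) x = 0) : L →ₗ⁅ℂ⁆ L where
  toFun := expAdFun a h
  map_add' x y := by
    obtain ⟨m, hm⟩ := h x
    obtain ⟨n, hn⟩ := h y
    have hm' := Module.End.pow_map_zero_of_le (le_max_left m n) hm
    have hn' := Module.End.pow_map_zero_of_le (le_max_right m n) hn
    rw [expAdFun_eq h hm', expAdFun_eq h hn', expAdFun_eq h (n := max m n)
      (by rw [map_add, hm', hn', add_zero]), ← sum_add_distrib]
    simp only [map_add, smul_add]
  map_smul' c x := by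
    obtain ⟨m, hm⟩ := h x
    rw [expAdFun_eq h hm, expAdFun_eq h (n := m) (by rw [map_smul, hm, smul_zero]), smul_sum]
    refine sum_congr rfl fun k _ => ?_
    rw [map_smul, smul_comm, RingHom.id_apply]
  map_lie' {x y} := by
    classical
    obtain ⟨m, hm⟩ := h x
    obtain ⟨n, hn⟩ := h y
    have hmn : ((ad ℂ L a) ^ (m + n)) ⁅x, y⁆ = 0 := by
      rw [ad_pow_lie]
      refine sum_eq_zero fun p hp => ?_
      rw [HasAntidiagonal.mem_antidiagonal] at hp
      obtain h' | h' : m ≤ p.1 ∨ n ≤ p.2 := by omega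
      all_goals simp [Module.End.pow_map_zero_of_le h', hm, hn]
    rw [expAdFun_eq h hm, expAdFun_eq h hn, expAdFun_eq h hmn, sum_lie_sum, ← sum_product',
      ← sum_fiberwise_of_maps_to (s := range m ×ˢ range n) (t := range (m + n))
        (g := fun p => p.1 + p.2) (by
          intro p hp
          simp only [mem_product, mem_range] at hp ⊢
          omega)]
    refine sum_congr rfl fun k _ => ?_
    rw [ad_pow_lie, smul_sum]
    symm
    have hsub : {p ∈ range m ×ˢ range n | p.1 + p.2 = k} ⊆ antidiagonal k := fun p hp =>
      HasAntidiagonal.mem_antidiagonal.2 (mem_filter.1 hp).2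
    -- Only index pairs in the rectangle `m × n` contribute, so the Leibniz sum over the
    -- antidiagonal may be cut down to it.
    rw [← sum_subset hsub]
    · refine sum_congr rfl fun p hp => ?_
      rw [← (mem_filter.1 hp).2, smul_lie, lie_smul, smul_smul, ← Nat.cast_smul_eq_nsmul ℂ,
        smul_smul, Nat.choose_symm_add, Nat.add_choose, Nat.cast_div (Nat.factorial_mul_factorial_dvd_factorial_add _ _)
          (Nat.cast_ne_zero.2 (mul_ne_zero (Nat.factorial_ne_zero _) (Nat.factorial_ne_zero _)))]
      congr 1
      have := Nat.cast_ne_zero (R := ℂ).2 (Nat.factorial_ne_zero (p.1 + p.2))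
      push_cast
      field_simp
    · intro p hp hp'
      rw [HasAntidiagonal.mem_antidiagonal] at hp
      simp only [mem_filter, mem_product, mem_range, hp, and_true, not_and_or, not_lt] at hp'
      obtain h' | h' := hp'
      all_goals simp [Module.End.pow_map_zero_of_le h', hm, hn]

lemma expAd_apply {a : L} (h : ∀ x, ∃ n : ℕ, ((ad ℂ L a) ^ n) x = 0) {x : L} {n : ℕ}
    (hn : ((ad ℂ L a) ^ n) x = 0) :
    expAd a h x = ∑ k ∈ range n, (k.factorial : ℂ)⁻¹ • ((ad ℂ L a) ^ k) x := expAdFun_eq h hn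

end Exp

/-! ### Lifting the Weyl group -/

namespace ChevalleySystem

open LieAlgebra

variable {L : Type*} [LieRing L] [LieAlgebra ℂ L] (S : ChevalleySystem R L)

/-- `θ` is an endomorphism of the Lie algebra that acts on `𝔥` as the contragredient of `w`. -/
def Lifts (w : Module.Dual ℂ 𝔥 ≃ₗ[ℂ] Module.Dual ℂ 𝔥) (θ : L →ₗ⁅ℂ⁆ L) : Prop :=
  ∃ g : 𝔥 ≃ₗ[ℂ] 𝔥, (∀ μ x, w μ (g x) = μ x) ∧ ∀ x, θ (S.h x) = S.h (g x)

variable {S}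

lemma Lifts.one : S.Lifts 1 LieHom.id := ⟨LinearEquiv.refl ℂ 𝔥, fun _ _ => rfl, fun _ => rfl⟩

lemma Lifts.mul {w w' : Module.Dual ℂ 𝔥 ≃ₗ[ℂ] Module.Dual ℂ 𝔥} {θ θ' : L →ₗ⁅ℂ⁆ L}
    (h : S.Lifts w θ) (h' : S.Lifts w' θ') : S.Lifts (w * w') (θ.comp θ') := by
  obtain ⟨g, hg, hg'⟩ := h
  obtain ⟨k, hk, hk'⟩ := h'
  refine ⟨k.trans g, fun μ x => ?_, fun x => ?_⟩
  · rw [LinearEquiv.mul_apply, LinearEquiv.trans_apply, hg, hk]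
  · rw [LieHom.comp_apply, hk', hg', LinearEquiv.trans_apply]

lemma Lifts.map_mem {w : Module.Dual ℂ 𝔥 ≃ₗ[ℂ] Module.Dual ℂ 𝔥} {θ : L →ₗ⁅ℂ⁆ L}
    (h : S.Lifts w θ) {α : Module.Dual ℂ 𝔥} {x : L} (hx : x ∈ S.weightSpace α) :
    θ x ∈ S.weightSpace (w α) := by
  obtain ⟨g, hg, hg'⟩ := h
  intro y
  obtain ⟨y, rfl⟩ := g.surjective y
  rw [← hg', ← LieHom.map_lie, hx y, map_smul, hg]

/-- The kernel is an ideal that meets `𝔥` trivially, because `θ` acts on `𝔥` through an invertible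
map. -/
lemma Lifts.injective (hS : S.IsReduced) (hinj : Function.Injective S.h)
    {w : Module.Dual ℂ 𝔥 ≃ₗ[ℂ] Module.Dual ℂ 𝔥} {θ : L →ₗ⁅ℂ⁆ L}
    (h : S.Lifts w θ) : Function.Injective θ := by
  obtain ⟨g, hg, hg'⟩ := h
  rw [← LieHom.ker_eq_bot]
  refine hS _ fun x hx => ?_
  rw [LieHom.mem_ker, hg', map_eq_zero_iff _ hinj, LinearEquiv.map_eq_zero_iff] at hx
  rw [hx, map_zero]

/-- Applied to `w` and to `w⁻¹`, this gives equality without proving any lift surjective. Stating it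
for cardinal ranks avoids proving finite-dimensionality. -/
lemma rank_weightSpace_le (hS : S.IsReduced) (hinj : Function.Injective S.h)
    {w : Module.Dual ℂ 𝔥 ≃ₗ[ℂ] Module.Dual ℂ 𝔥} {θ : L →ₗ⁅ℂ⁆ L}
    (h : S.Lifts w θ) (α : Module.Dual ℂ 𝔥) :
    Module.rank ℂ (S.weightSpace α) ≤ Module.rank ℂ (S.weightSpace (w α)) :=
  LinearMap.rank_le_of_injective ((θ : L →ₗ[ℂ] L).restrict fun _ hx => h.map_mem hx)
    fun _ _ hxy => Subtype.ext (h.injective hS hinj (congrArg Subtype.val hxy))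

/-- The classical choice `exp (ad e) exp (-ad f) exp (ad e)` works. Its action on `𝔥` follows from
the three-term computations inside the `sl₂`-triple. -/
lemma IsReduced.exists_lifts_simpleRefl (hS : S.IsReduced) (hinj : Function.Injective S.h) (i : ι) :
    ∃ θ, S.Lifts (simpleRefl R i) θ := by
  have he := hS.ad_e_locallyNilpotent hinj i
  have hf := hS.ad_f_locallyNilpotent hinj i
  have hf' : ∀ x, ∃ n : ℕ, ((ad ℂ L (-S.f i)) ^ n) x = 0 := fun x => by
    obtain ⟨n, hn⟩ := hf x
    refine ⟨n, ?_⟩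
    rw [map_neg, neg_pow, Module.End.mul_apply, hn, map_zero]
  have hii : R.root i (R.coroot i) = 2 := by rw [R.pairing, C.diag]; norm_num
  set E := expAd (S.e i) he
  set F := expAd (-S.f i) hf'
  have eh : ∀ x, ⁅S.e i, S.h x⁆ = -(R.root i x • S.e i) := fun x => by rw [← lie_skew, S.lie_h_e]
  have fh : ∀ x, ⁅S.f i, S.h x⁆ = R.root i x • S.f i := fun x => by
    rw [← lie_skew, S.lie_h_f, neg_neg]
  have fe : ⁅S.f i, S.e i⁆ = -S.h (R.coroot i) := by rw [← lie_skew, S.lie_e_f]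
  have hEh : ∀ x, E (S.h x) = S.h x - R.root i x • S.e i := fun x => by
    rw [show E (S.h x) = _ from expAd_apply he (n := 2) (by simp [pow_two, eh])]
    simp [Finset.sum_range_succ, eh, sub_eq_add_neg]
  have hEe : E (S.e i) = S.e i := by
    rw [show E (S.e i) = _ from expAd_apply he (n := 1) (by simp)]
    simp
  have hFh : ∀ x, F (S.h x) = S.h x - R.root i x • S.f i := fun x => by
    rw [show F (S.h x) = _ from expAd_apply hf' (n := 2) (by simp [pow_two, fh])]
    simp [Finset.sum_range_succ, fh, sub_eq_add_neg]
  have hFe : F (S.e i) = S.e i + S.h (R.coroot i) - S.f i := by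
    rw [show F (S.e i) = _ from expAd_apply hf' (n := 3) (by simp [pow_succ, fh, fe])]
    simp [Finset.sum_range_succ, fh, fe, pow_succ, hii, smul_smul, sub_eq_add_neg]
  have hEf : E (S.f i) = S.f i + S.h (R.coroot i) - S.e i := by
    rw [show E (S.f i) = _ from expAd_apply he (n := 3) (by simp [pow_succ, eh, S.lie_e_f])]
    simp [Finset.sum_range_succ, eh, S.lie_e_f, pow_succ, hii, smul_smul, sub_eq_add_neg]
  have hrefl : ∀ x, x - R.root i x • R.coroot i =
      Module.reflection (R := ℂ) (f := R.root i) (x := R.coroot i) hii x := fun x => by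
    rw [Module.reflection_apply]
  refine ⟨E.comp (F.comp E), Module.reflection (f := R.root i) (x := R.coroot i) hii,
    fun μ x => ?_, fun x => ?_⟩
  · simp only [simpleRefl, Module.reflection_apply, LinearMap.sub_apply, LinearMap.smul_apply,
      map_sub, map_smul, Module.Dual.eval_apply, hii, smul_eq_mul]
    ring
  · simp only [LieHom.comp_apply, hEh, map_sub, map_smul, hFh, hFe,
      map_add, hEe, hEf, ← hrefl, hii]
    module

end ChevalleySystem

end Integrable

end KacMoody

end

/-! ### The Kac--Moody algebra: reducedness and embedding of the Cartan subalgebra. -/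

noncomputable section

namespace KacMoody

section KacMoodyAlgebra

variable {ι : Type*} [Fintype ι] {C : GCM ι} {𝔥 : Type*} [AddCommGroup 𝔥] [Module ℂ 𝔥]
  (R : Realization C 𝔥)

/-! ### The auxiliary algebra and the Kac--Moody algebra -/

/-- The quotient of a Lie algebra by an ideal, as a homomorphism of Lie algebras. -/
def quotientHom {L : Type*} [LieRing L] [LieAlgebra ℂ L] (I : LieIdeal ℂ L) : L →ₗ⁅ℂ⁆ L ⧸ I where
  toLinearMap := I.toSubmodule.mkQ
  map_lie' := rfl

lemma quotientHom_surjective {L : Type*} [LieRing L] [LieAlgebra ℂ L] (I : LieIdeal ℂ L) :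
    Function.Surjective (quotientHom I) := I.toSubmodule.mkQ_surjective

lemma quotientHom_eq_zero {L : Type*} [LieRing L] [LieAlgebra ℂ L] {I : LieIdeal ℂ L} {x : L} :
    quotientHom I x = 0 ↔ x ∈ I := Submodule.Quotient.mk_eq_zero I.toSubmodule

lemma aux_eq_zero {x : FreeAlg ι 𝔥} (hx : IsRelator R x) : quotientHom (relIdeal R) x = 0 :=
  quotientHom_eq_zero.2 (LieSubmodule.subset_lieSpan hx)

lemma freeAlg_generates (K : LieSubalgebra ℂ (FreeAlg ι 𝔥)) (h : ∀ g, FreeLieAlgebra.of ℂ g ∈ K) :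
    K = ⊤ := by
  let φ : FreeAlg ι 𝔥 →ₗ⁅ℂ⁆ K := FreeLieAlgebra.lift ℂ fun g => ⟨FreeLieAlgebra.of ℂ g, h g⟩
  have hφ : K.incl.comp φ = LieHom.id := FreeLieAlgebra.hom_ext (by intro g; simp [φ])
  rw [eq_top_iff]
  intro x _
  have hx := LieHom.congr_fun hφ x
  rw [LieHom.comp_apply, LieHom.id_apply] at hx
  rw [← hx]
  exact (φ x).2

/-- The generators of the auxiliary algebra. -/
def auxSystem : ChevalleySystem R (AuxAlg R) where
  e i := quotientHom (relIdeal R) (genE i)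
  f i := quotientHom (relIdeal R) (genF i)
  h :=
    { toFun := fun x => quotientHom (relIdeal R) (genH x)
      map_add' := fun x y => by
        rw [← sub_eq_zero, ← map_add, ← map_sub]
        exact aux_eq_zero R (.add x y)
      map_smul' := fun c x => by
        rw [← sub_eq_zero, RingHom.id_apply, ← map_smul, ← map_sub]
        exact aux_eq_zero R (.smul c x) }
  lie_h_h x y := by
    refine Eq.trans (LieHom.map_lie (quotientHom (relIdeal R)) (genH x) (genH y)).symm ?_
    exact aux_eq_zero R (.hh x y)
  lie_e_f i := by
    refine Eq.trans (LieHom.map_lie (quotientHom (relIdeal R)) (genE i) (genF i)).symm (sub_eq_zero.1 ?_)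
    refine Eq.trans (map_sub _ _ _).symm ?_
    exact aux_eq_zero R (.ef_same i)
  lie_e_f_ne i j hij := by
    refine Eq.trans (LieHom.map_lie (quotientHom (relIdeal R)) (genE i) (genF j)).symm ?_
    exact aux_eq_zero R (.ef_ne i j hij)
  lie_h_e x i := by
    refine Eq.trans (LieHom.map_lie (quotientHom (relIdeal R)) (genH x) (genE i)).symm (sub_eq_zero.1 ?_)
    rw [← map_smul, ← map_sub]
    exact aux_eq_zero R (.he x i)
  lie_h_f x i := by
    refine Eq.trans (LieHom.map_lie (quotientHom (relIdeal R)) (genH x) (genF i)).symm (eq_neg_iff_add_eq_zero.2 ?_)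
    rw [← map_smul, ← map_add]
    exact aux_eq_zero R (.hf x i)
  generates K he hf hh := by
    have := freeAlg_generates (K.comap (quotientHom (relIdeal R)))
      (by rintro (i | i | x); exacts [he i, hf i, hh x])
    rw [eq_top_iff]
    intro x _
    obtain ⟨x, rfl⟩ := quotientHom_surjective _ x
    have hx : x ∈ K.comap (quotientHom (relIdeal R)) := this ▸ LieSubalgebra.mem_top x
    exact hx

/-- The generators of the Kac--Moody algebra. -/
def algSystem : ChevalleySystem R (Alg R) where
  e i := quotientHom (radIdeal R) ((auxSystem R).e i)
  f i := quotientHom (radIdeal R) ((auxSystem R).f i)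
  h := (quotientHom (radIdeal R) : AuxAlg R →ₗ[ℂ] Alg R) ∘ₗ (auxSystem R).h
  lie_h_h x y := by
    refine Eq.trans (LieHom.map_lie (quotientHom (radIdeal R)) ((auxSystem R).h x) ((auxSystem R).h y)).symm ?_
    rw [(auxSystem R).lie_h_h, map_zero]
  lie_e_f i := by
    refine Eq.trans (LieHom.map_lie (quotientHom (radIdeal R)) ((auxSystem R).e i) ((auxSystem R).f i)).symm ?_
    rw [(auxSystem R).lie_e_f]
    rfl
  lie_e_f_ne i j hij := by
    refine Eq.trans (LieHom.map_lie (quotientHom (radIdeal R)) ((auxSystem R).e i) ((auxSystem R).f j)).symm ?_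
    rw [(auxSystem R).lie_e_f_ne i j hij, map_zero]
  lie_h_e x i := by
    refine Eq.trans (LieHom.map_lie (quotientHom (radIdeal R)) ((auxSystem R).h x) ((auxSystem R).e i)).symm ?_
    rw [(auxSystem R).lie_h_e, map_smul]
  lie_h_f x i := by
    refine Eq.trans (LieHom.map_lie (quotientHom (radIdeal R)) ((auxSystem R).h x) ((auxSystem R).f i)).symm ?_
    rw [(auxSystem R).lie_h_f, map_neg, map_smul]
  generates K he hf hh := by
    have := (auxSystem R).generates (K.comap (quotientHom (radIdeal R))) he hf hh
    rw [eq_top_iff]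
    intro x _
    obtain ⟨x, rfl⟩ := quotientHom_surjective _ x
    have hx : x ∈ K.comap (quotientHom (radIdeal R)) := this ▸ LieSubalgebra.mem_top x
    exact hx

lemma algSystem_weightSpace (α : Module.Dual ℂ 𝔥) :
    (algSystem R).weightSpace α = rootSpace R α := rfl

/-- Every ideal in the supremum lies in `offCartan`, hence so does their sum: the radical itself
meets `𝔥` trivially. -/
lemma auxCartan_eq_zero_of_mem_radIdeal {x : 𝔥} (hx : auxCartan R x ∈ radIdeal R) :
    auxCartan R x = 0 := by
  refine (auxSystem R).h_mem_offCartan (?_ : (auxSystem R).h x ∈ (auxSystem R).offCartan)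
  have h1 : (radIdeal R).toSubmodule ≤ (auxSystem R).offCartan := by
    rw [radIdeal, LieSubmodule.sSup_toSubmodule_eq_iSup]
    exact iSup₂_le fun I hI => (auxSystem R).ideal_le_offCartan hI
  exact h1 hx

/-- The preimage of such an ideal in the auxiliary algebra still meets `𝔥` trivially, so it is
contained in the radical. -/
lemma algSystem_isReduced : (algSystem R).IsReduced := by
  intro I hI
  have h1 : I.comap (quotientHom (radIdeal R)) ≤ radIdeal R := by
    refine le_sSup fun x hx => ?_
    have h2 : cartan R x ∈ I := LieIdeal.mem_comap.1 hx
    exact auxCartan_eq_zero_of_mem_radIdeal R (quotientHom_eq_zero.1 (hI x h2))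
  rw [eq_bot_iff]
  intro x hx
  obtain ⟨x, rfl⟩ := quotientHom_surjective _ x
  rw [LieSubmodule.mem_bot]
  exact quotientHom_eq_zero.2 (h1 (LieIdeal.mem_comap.2 hx))

/-! ### A Verma module -/

attribute [local instance] LieRing.ofAssociativeRing

/-- The weight of a word in a Verma module. -/
def vermaWeight (μ : Module.Dual ℂ 𝔥) (l : List ι) : Module.Dual ℂ 𝔥 := μ - (l.map R.root).sum

open Classical in
/-- The action of `e i` on words. -/
def vermaEWord (μ : Module.Dual ℂ 𝔥) (i : ι) : List ι → (List ι →₀ ℂ)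
  | [] => 0
  | j :: l => Finsupp.mapDomain (List.cons j) (vermaEWord μ i l) +
      if i = j then Finsupp.single l (vermaWeight R μ l (R.coroot i)) else 0

/-- The action of the generators on a Verma module with basis the words in the `f i`. -/
def vermaGen (μ : Module.Dual ℂ 𝔥) : Gen ι 𝔥 → Module.End ℂ (List ι →₀ ℂ)
  | .e i => Finsupp.lift _ ℂ _ (vermaEWord R μ i)
  | .f i => Finsupp.lmapDomain ℂ ℂ (List.cons i)
  | .h x => Finsupp.lift _ ℂ _ fun l => Finsupp.single l (vermaWeight R μ l x)

/-- The representation of the free Lie algebra on a Verma module. -/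
def vermaHom (μ : Module.Dual ℂ 𝔥) : FreeAlg ι 𝔥 →ₗ⁅ℂ⁆ Module.End ℂ (List ι →₀ ℂ) :=
  FreeLieAlgebra.lift ℂ (vermaGen R μ)

lemma vermaGen_e_single (μ : Module.Dual ℂ 𝔥) (i : ι) (l : List ι) (c : ℂ) :
    vermaGen R μ (.e i) (Finsupp.single l c) = c • vermaEWord R μ i l := by
  simp [vermaGen]

lemma vermaGen_f_single (μ : Module.Dual ℂ 𝔥) (i : ι) (l : List ι) (c : ℂ) :
    vermaGen R μ (.f i) (Finsupp.single l c) = Finsupp.single (i :: l) c := by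
  simp [vermaGen]

lemma vermaGen_h_single (μ : Module.Dual ℂ 𝔥) (x : 𝔥) (l : List ι) (c : ℂ) :
    vermaGen R μ (.h x) (Finsupp.single l c) = Finsupp.single l (c * vermaWeight R μ l x) := by
  simp [vermaGen]

lemma vermaWeight_cons (μ : Module.Dual ℂ 𝔥) (i : ι) (l : List ι) (x : 𝔥) :
    vermaWeight R μ (i :: l) x = vermaWeight R μ l x - R.root i x := by
  simp only [vermaWeight, List.map_cons, List.sum_cons, LinearMap.sub_apply, LinearMap.add_apply]
  ring

lemma vermaGen_h_f (μ : Module.Dual ℂ 𝔥) (x : 𝔥) (i : ι) (v : List ι →₀ ℂ) :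
    vermaGen R μ (.h x) (vermaGen R μ (.f i) v) =
      vermaGen R μ (.f i) (vermaGen R μ (.h x) v) - R.root i x • vermaGen R μ (.f i) v := by
  induction v using Finsupp.induction_linear with
  | zero => simp
  | add v w hv hw => simp only [map_add, hv, hw, smul_add]; abel
  | single l c =>
    simp only [vermaGen_f_single, vermaGen_h_single, vermaWeight_cons, Finsupp.smul_single,
      ← Finsupp.single_sub, smul_eq_mul]
    congr 1
    ring

lemma vermaGen_e_f (μ : Module.Dual ℂ 𝔥) (i j : ι) (v : List ι →₀ ℂ) [Decidable (i = j)] :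
    vermaGen R μ (.e i) (vermaGen R μ (.f j) v) =
      vermaGen R μ (.f j) (vermaGen R μ (.e i) v) +
        if i = j then vermaGen R μ (.h (R.coroot i)) v else 0 := by
  induction v using Finsupp.induction_linear with
  | zero => simp
  | add v w hv hw =>
    simp only [map_add, hv, hw]
    split_ifs <;> abel
  | single l c =>
    rw [vermaGen_f_single, vermaGen_e_single, vermaGen_e_single, vermaEWord, smul_add, map_smul]
    congr 1
    split_ifs with h
    · rw [vermaGen_h_single, Finsupp.smul_single, smul_eq_mul]
    · rw [smul_zero]

/-- The action of `e i` is defined recursively by commuting it past the leading `f j`, so this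
relation is proved by induction on words from the other two. -/
lemma vermaGen_h_e (μ : Module.Dual ℂ 𝔥) (x : 𝔥) (i : ι) (v : List ι →₀ ℂ) :
    vermaGen R μ (.h x) (vermaGen R μ (.e i) v) =
      vermaGen R μ (.e i) (vermaGen R μ (.h x) v) + R.root i x • vermaGen R μ (.e i) v := by
  classical
  induction v using Finsupp.induction_linear with
  | zero => simp
  | add v w hv hw => simp only [map_add, hv, hw, smul_add]; abel
  | single l c =>
    induction l generalizing c with
    | nil => rw [vermaGen_h_single]; simp only [vermaGen_e_single, vermaEWord, smul_zero, map_zero, add_zero]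
    | cons j l ih =>
      rw [← vermaGen_f_single R μ, vermaGen_h_f, vermaGen_e_f, map_add, map_sub, map_smul, vermaGen_e_f,
        vermaGen_e_f, vermaGen_h_f, ih]
      simp only [map_add, map_smul]
      split_ifs with h
      · subst h
        simp only [vermaGen_h_single]
        have : vermaWeight R μ l (R.coroot i) * vermaWeight R μ l x =
          vermaWeight R μ l x * vermaWeight R μ l (R.coroot i) := mul_comm _ _
        simp only [mul_assoc, this, smul_add, Finsupp.smul_single]
        abel
      · simp only [map_zero, add_zero]
        abel

/-- The auxiliary algebra imposes no relations among the `f i`, which is why the module can have all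
words as a basis. -/
lemma vermaHom_relator (μ : Module.Dual ℂ 𝔥) {x : FreeAlg ι 𝔥} (hx : IsRelator R x) :
    vermaHom R μ x = 0 := by
  classical
  have hof : ∀ g, vermaHom R μ (FreeLieAlgebra.of ℂ g) = vermaGen R μ g := fun g =>
    FreeLieAlgebra.lift_of_apply _ g
  cases hx with
  | add x y =>
    simp only [genH, map_add, map_sub, hof]
    ext l : 2
    simp [vermaGen_h_single]
  | smul c x =>
    simp only [genH, map_smul, map_sub, hof]
    ext l : 2
    simp [vermaGen_h_single]
  | hh x y =>
    simp only [genH, LieHom.map_lie, hof, Ring.lie_def]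
    ext l : 2
    simp [vermaGen_h_single, mul_comm]
  | ef_same i =>
    simp only [genH, genE, genF, LieHom.map_lie, map_sub, hof, Ring.lie_def]
    refine LinearMap.ext fun v => ?_
    simp [vermaGen_e_f]
  | ef_ne i j hij =>
    simp only [genE, genF, LieHom.map_lie, hof, Ring.lie_def]
    refine LinearMap.ext fun v => ?_
    simp [vermaGen_e_f, hij]
  | he x i =>
    simp only [genH, genE, LieHom.map_lie, map_sub, map_smul, hof, Ring.lie_def]
    refine LinearMap.ext fun v => ?_
    simp [vermaGen_h_e]
  | hf x i =>
    simp only [genH, genF, LieHom.map_lie, map_add, map_smul, hof, Ring.lie_def]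
    refine LinearMap.ext fun v => ?_
    simp [vermaGen_h_f]

/-- On the empty word of the Verma module of highest weight `μ`, `h x` acts by `μ x`; varying `μ`
detects `x`. -/
lemma auxCartan_injective {x : 𝔥} (hx : auxCartan R x = 0) : x = 0 := by
  rw [← Module.forall_dual_apply_eq_zero_iff ℂ x]
  intro μ
  have h1 : genH x ∈ relIdeal R := (LieSubmodule.Quotient.mk_eq_zero').1 hx
  have h2 : relIdeal R ≤ (vermaHom R μ).ker :=
    LieSubmodule.lieSpan_le.2 fun y hy => LieHom.mem_ker.2 (vermaHom_relator R μ hy)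
  have h3 : vermaHom R μ (genH x) = 0 := LieHom.mem_ker.1 (h2 h1)
  have h4 : vermaHom R μ (genH x) = vermaGen R μ (.h x) := FreeLieAlgebra.lift_of_apply _ _
  have h5 := DFunLike.congr_fun (h4.symm.trans h3) (Finsupp.single [] 1)
  rw [vermaGen_h_single] at h5
  simpa [vermaWeight] using h5

lemma algSystem_h_injective : Function.Injective (algSystem R).h := by
  rw [injective_iff_map_eq_zero]
  intro x hx
  exact auxCartan_injective R
    (auxCartan_eq_zero_of_mem_radIdeal R (quotientHom_eq_zero.1 hx))

end KacMoodyAlgebra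

end KacMoody

end

/-! ### Roots, the Weyl group, inversions and root strings. -/

noncomputable section

namespace KacMoody

section Roots

variable {ι : Type*} [Fintype ι] {C : GCM ι} {𝔥 : Type*} [AddCommGroup 𝔥] [Module ℂ 𝔥]
  {R : Realization C 𝔥}

/-! ### Positivity -/

lemma negWt_eq (d : ι →₀ ℕ) : negWt R d = -wt R d := rfl

lemma negWt_injective : Function.Injective (negWt R) :=
  fun _ _ h => wt_injective (neg_injective h)

@[simp] lemma negWt_zero : negWt R (0 : ι →₀ ℕ) = 0 := by rw [negWt_eq, wt_zero, neg_zero]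

lemma wt_ne_zero {d : ι →₀ ℕ} : wt R d ≠ 0 ↔ d ≠ 0 := by
  rw [Ne, Ne, ← wt_zero (R := R), wt_injective.eq_iff]

lemma mem_rootCone_iff {α : Module.Dual ℂ 𝔥} : α ∈ rootCone R ↔ ∃ d, α = wt R d := by
  constructor
  · intro h
    induction h using AddSubmonoid.closure_induction with
    | mem x hx => obtain ⟨i, rfl⟩ := hx; exact ⟨Finsupp.single i 1, by simp⟩
    | zero => exact ⟨0, by simp⟩
    | add x y _ _ hx hy =>
      obtain ⟨d, rfl⟩ := hx
      obtain ⟨d', rfl⟩ := hy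
      exact ⟨d + d', (wt_add d d').symm⟩
  · rintro ⟨d, rfl⟩
    exact sum_mem fun i _ => nsmul_mem (AddSubmonoid.subset_closure (Set.mem_range_self i)) _

lemma isPos_iff {α : Module.Dual ℂ 𝔥} : IsPos R α ↔ ∃ d, d ≠ 0 ∧ α = wt R d := by
  constructor
  · rintro ⟨h, h0⟩
    obtain ⟨d, rfl⟩ := mem_rootCone_iff.1 h
    exact ⟨d, wt_ne_zero.1 h0, rfl⟩
  · rintro ⟨d, hd, rfl⟩
    exact ⟨mem_rootCone_iff.2 ⟨d, rfl⟩, wt_ne_zero.2 hd⟩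

lemma isPos_wt {d : ι →₀ ℕ} : IsPos R (wt R d) ↔ d ≠ 0 :=
  ⟨fun h => wt_ne_zero.1 h.2, fun h => isPos_iff.2 ⟨d, h, rfl⟩⟩

lemma isNeg_neg {α : Module.Dual ℂ 𝔥} : IsNeg R (-α) ↔ IsPos R α := by rw [IsNeg, neg_neg]

lemma isPos_neg {α : Module.Dual ℂ 𝔥} : IsPos R (-α) ↔ IsNeg R α := Iff.rfl

lemma isNeg_iff {α : Module.Dual ℂ 𝔥} : IsNeg R α ↔ ∃ d, d ≠ 0 ∧ α = negWt R d := by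
  rw [IsNeg, isPos_iff]
  simp only [neg_eq_iff_eq_neg, negWt_eq]

lemma IsPos.not_isNeg {α : Module.Dual ℂ 𝔥} (h : IsPos R α) : ¬ IsNeg R α := by
  rintro h'
  obtain ⟨d, hd, rfl⟩ := isPos_iff.1 h
  obtain ⟨d', -, h⟩ := isPos_iff.1 h'
  exact hd (wt_add_wt_eq_zero (by rw [← h, add_neg_cancel]))

lemma isPos_root (i : ι) : IsPos R (R.root i) := by
  rw [← one_nsmul (R.root i), ← wt_single, isPos_wt]
  simp

lemma rootCone_le_rootLattice {α : Module.Dual ℂ 𝔥} (h : α ∈ rootCone R) : α ∈ rootLattice R := by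
  obtain ⟨d, rfl⟩ := mem_rootCone_iff.1 h
  exact sum_mem fun i _ => nsmul_mem (AddSubgroup.subset_closure (Set.mem_range_self i)) _

lemma mem_rootLattice_iff {α : Module.Dual ℂ 𝔥} :
    α ∈ rootLattice R ↔ ∃ c : ι → ℤ, α = ∑ i, c i • R.root i := by
  classical
  constructor
  · intro h
    induction h using AddSubgroup.closure_induction with
    | mem x hx => obtain ⟨i, rfl⟩ := hx; exact ⟨Pi.single i 1, by simp [Pi.single_apply]⟩
    | zero => exact ⟨0, by simp⟩
    | add x y _ _ hx hy =>
      obtain ⟨c, rfl⟩ := hx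
      obtain ⟨c', rfl⟩ := hy
      exact ⟨c + c', by simp [add_smul, Finset.sum_add_distrib]⟩
    | neg x _ hx =>
      obtain ⟨c, rfl⟩ := hx
      exact ⟨-c, by simp⟩
  · rintro ⟨c, rfl⟩
    exact sum_mem fun i _ => zsmul_mem (AddSubgroup.subset_closure (Set.mem_range_self i)) _

/-! ### The Weyl group and the root multiplicities -/

lemma simpleRefl_apply (i : ι) (μ : Module.Dual ℂ 𝔥) :
    simpleRefl R i μ = μ - μ (R.coroot i) • R.root i := by
  rw [simpleRefl, Module.reflection_apply, Module.Dual.eval_apply]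

lemma simpleRefl_simpleRefl (i : ι) (μ : Module.Dual ℂ 𝔥) :
    simpleRefl R i (simpleRefl R i μ) = μ := Module.involutive_reflection (root_coroot_two R i) μ

lemma simpleRefl_mul_self (i : ι) : simpleRefl R i * simpleRefl R i = 1 :=
  LinearEquiv.ext (simpleRefl_simpleRefl i)

lemma simpleRefl_inv (i : ι) : (simpleRefl R i)⁻¹ = simpleRefl R i :=
  inv_eq_of_mul_eq_one_left (simpleRefl_mul_self i)

lemma root_coroot_self (i : ι) : R.root i (R.coroot i) = 2 := root_coroot_two R i

lemma simpleRefl_root (i : ι) : simpleRefl R i (R.root i) = -R.root i := by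
  rw [simpleRefl_apply, root_coroot_self, two_smul]
  abel

variable (R) in
/-- The element of the Weyl group represented by a word. -/
def wordProd (l : List ι) : Module.Dual ℂ 𝔥 ≃ₗ[ℂ] Module.Dual ℂ 𝔥 := (l.map (simpleRefl R)).prod

@[simp] lemma wordProd_nil : wordProd R [] = 1 := rfl

lemma wordProd_cons (i : ι) (l : List ι) : wordProd R (i :: l) = simpleRefl R i * wordProd R l := by
  simp [wordProd]

lemma wordProd_append (l l' : List ι) : wordProd R (l ++ l') = wordProd R l * wordProd R l' := by
  simp [wordProd]

lemma simpleRefl_mem (i : ι) : simpleRefl R i ∈ weyl R := Subgroup.subset_closure (Set.mem_range_self i)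

lemma wordProd_mem (l : List ι) : wordProd R l ∈ weyl R := by
  induction l with
  | nil => exact one_mem _
  | cons i l ih => rw [wordProd_cons]; exact mul_mem (simpleRefl_mem i) ih

lemma exists_wordProd_eq {w : Module.Dual ℂ 𝔥 ≃ₗ[ℂ] Module.Dual ℂ 𝔥} (hw : w ∈ weyl R) :
    ∃ l, wordProd R l = w := by
  induction hw using Subgroup.closure_induction'' with
  | mem x hx => obtain ⟨i, rfl⟩ := hx; exact ⟨[i], by simp [wordProd]⟩
  | inv_mem x hx => obtain ⟨i, rfl⟩ := hx; exact ⟨[i], by simp [wordProd, simpleRefl_inv]⟩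
  | one => exact ⟨[], rfl⟩
  | mul x y _ _ hx hy =>
    obtain ⟨l, rfl⟩ := hx
    obtain ⟨l', rfl⟩ := hy
    exact ⟨l ++ l', wordProd_append l l'⟩

lemma exists_lifts {w : Module.Dual ℂ 𝔥 ≃ₗ[ℂ] Module.Dual ℂ 𝔥} (hw : w ∈ weyl R) :
    ∃ θ, (algSystem R).Lifts w θ := by
  obtain ⟨l, rfl⟩ := exists_wordProd_eq hw
  induction l with
  | nil => exact ⟨_, ChevalleySystem.Lifts.one⟩
  | cons i l ih =>
    obtain ⟨θ, hθ⟩ := ih (wordProd_mem l)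
    obtain ⟨θ', hθ'⟩ := (algSystem_isReduced R).exists_lifts_simpleRefl (algSystem_h_injective R) i
    exact ⟨_, wordProd_cons (R := R) i l ▸ hθ'.mul hθ⟩

lemma rank_rootSpace_weyl {w : Module.Dual ℂ 𝔥 ≃ₗ[ℂ] Module.Dual ℂ 𝔥} (hw : w ∈ weyl R)
    (α : Module.Dual ℂ 𝔥) :
    Module.rank ℂ (rootSpace R (w α)) = Module.rank ℂ (rootSpace R α) := by
  have key : ∀ w ∈ weyl R, ∀ α,
      Module.rank ℂ (rootSpace R α) ≤ Module.rank ℂ (rootSpace R (w α)) := fun w hw α => by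
    obtain ⟨θ, hθ⟩ := exists_lifts hw
    exact ChevalleySystem.rank_weightSpace_le (algSystem_isReduced R) (algSystem_h_injective R) hθ α
  refine le_antisymm ?_ (key w hw α)
  have := key w⁻¹ (inv_mem hw) (w α)
  rwa [show w⁻¹ (w α) = α from w.symm_apply_apply α] at this

lemma mult_weyl {w : Module.Dual ℂ 𝔥 ≃ₗ[ℂ] Module.Dual ℂ 𝔥} (hw : w ∈ weyl R)
    (α : Module.Dual ℂ 𝔥) : mult R (w α) = mult R α := by
  rw [mult, mult, Module.finrank, Module.finrank, rank_rootSpace_weyl hw]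

lemma coroot_apply_sum (i : ι) (c : ι → ℤ) :
    (∑ j, c j • R.root j) (R.coroot i) = ((∑ j, C.A i j * c j : ℤ) : ℂ) := by
  rw [LinearMap.sum_apply]
  push_cast
  refine Finset.sum_congr rfl fun j _ => ?_
  rw [LinearMap.smul_apply, R.pairing, zsmul_eq_mul, mul_comm]

lemma simpleRefl_mem_rootLattice {α : Module.Dual ℂ 𝔥} (i : ι) (h : α ∈ rootLattice R) :
    simpleRefl R i α ∈ rootLattice R := by
  obtain ⟨c, rfl⟩ := mem_rootLattice_iff.1 h
  rw [simpleRefl_apply, coroot_apply_sum, Int.cast_smul_eq_zsmul]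
  exact sub_mem h (zsmul_mem (AddSubgroup.subset_closure (Set.mem_range_self i)) _)

lemma weyl_mem_rootLattice {w : Module.Dual ℂ 𝔥 ≃ₗ[ℂ] Module.Dual ℂ 𝔥} (hw : w ∈ weyl R)
    {α : Module.Dual ℂ 𝔥} (h : α ∈ rootLattice R) : w α ∈ rootLattice R := by
  obtain ⟨l, rfl⟩ := exists_wordProd_eq hw
  induction l with
  | nil => exact h
  | cons i l ih =>
    rw [wordProd_cons, LinearEquiv.mul_apply]
    exact simpleRefl_mem_rootLattice i (ih (wordProd_mem l))

lemma weyl_inv_apply_apply (w : Module.Dual ℂ 𝔥 ≃ₗ[ℂ] Module.Dual ℂ 𝔥) (α : Module.Dual ℂ 𝔥) :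
    w⁻¹ (w α) = α := w.symm_apply_apply α

lemma IsRoot.weyl {w : Module.Dual ℂ 𝔥 ≃ₗ[ℂ] Module.Dual ℂ 𝔥} (hw : w ∈ KacMoody.weyl R)
    {α : Module.Dual ℂ 𝔥} (h : IsRoot R α) : IsRoot R (w α) := by
  refine ⟨weyl_mem_rootLattice hw h.1, by simpa using h.2.1, fun h0 => h.2.2 ?_⟩
  rw [← Submodule.rank_eq_zero] at h0 ⊢
  rwa [rank_rootSpace_weyl hw] at h0

lemma IsRealRoot.weyl {w : Module.Dual ℂ 𝔥 ≃ₗ[ℂ] Module.Dual ℂ 𝔥} (hw : w ∈ KacMoody.weyl R)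
    {α : Module.Dual ℂ 𝔥} (h : IsRealRoot R α) : IsRealRoot R (w α) := by
  obtain ⟨h, w', i, hi⟩ := h
  refine ⟨h.weyl hw, w' * ⟨w, hw⟩⁻¹, i, ?_⟩
  rw [← hi]
  exact congrArg w'.1 (weyl_inv_apply_apply w α)

lemma IsImRoot.weyl {w : Module.Dual ℂ 𝔥 ≃ₗ[ℂ] Module.Dual ℂ 𝔥} (hw : w ∈ KacMoody.weyl R)
    {α : Module.Dual ℂ 𝔥} (h : IsImRoot R α) : IsImRoot R (w α) := by
  refine ⟨h.1.weyl hw, fun h' => h.2 ?_⟩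
  have := h'.weyl (inv_mem hw)
  rwa [weyl_inv_apply_apply] at this

lemma isRoot_of_mult_ne_zero {α : Module.Dual ℂ 𝔥} (hα : IsPos R α) (h : mult R α ≠ 0) :
    IsRoot R α := by
  refine ⟨rootCone_le_rootLattice hα.1, hα.2, fun h0 => h ?_⟩
  rw [mult, h0, finrank_bot]

lemma IsRoot.isPos_or_isNeg {α : Module.Dual ℂ 𝔥} (h : IsRoot R α) : IsPos R α ∨ IsNeg R α := by
  rcases (algSystem R).weightSpace_ne_bot_cases h.2.2 with h' | ⟨l, i, rfl, -⟩ | ⟨l, i, rfl, -⟩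
  · exact absurd h' h.2.1
  · exact .inl (isPos_wt.2 (ChevalleySystem.wordContent_ne_zero l i))
  · exact .inr (isNeg_neg.2 (isPos_wt.2 (ChevalleySystem.wordContent_ne_zero l i)))

lemma algSystem_e_ne_zero (i : ι) : (algSystem R).e i ≠ 0 :=
  ((algSystem R).isSl2Triple (algSystem_h_injective R) i).e_ne_zero

lemma mult_root (i : ι) : mult R (R.root i) = 1 := by
  rw [mult, ← algSystem_weightSpace, ChevalleySystem.weightSpace_root]
  exact finrank_span_singleton (algSystem_e_ne_zero i)

lemma isRoot_root (i : ι) : IsRoot R (R.root i) :=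
  isRoot_of_mult_ne_zero (isPos_root i) (by rw [mult_root]; exact one_ne_zero)

lemma IsRealRoot.mult_eq_one {α : Module.Dual ℂ 𝔥} (h : IsRealRoot R α) : mult R α = 1 := by
  obtain ⟨-, w, i, hi⟩ := h
  rw [← mult_weyl w.2, hi, mult_root]

lemma eq_one_of_isRoot_nsmul {n : ℕ} {i : ι} (h : IsRoot R (n • R.root i)) : n = 1 := by
  by_contra hn
  obtain rfl | h2 : n = 0 ∨ 2 ≤ n := by omega
  · exact h.2.1 (zero_smul _ _)
  · exact h.2.2 ((algSystem R).weightSpace_nsmul_root h2 i)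

/-- Negative multiples are reduced to positive ones by the reflection `sᵢ`. -/
lemma isUnit_of_isRoot_zsmul {n : ℤ} {i : ι} (h : IsRoot R (n • R.root i)) : n = 1 ∨ n = -1 := by
  obtain ⟨m, rfl | rfl⟩ := n.eq_nat_or_neg
  · rw [natCast_zsmul] at h
    left
    exact_mod_cast eq_one_of_isRoot_nsmul h
  · have := h.weyl (simpleRefl_mem i)
    rw [map_zsmul, simpleRefl_root, neg_smul, smul_neg, neg_neg, natCast_zsmul] at this
    rw [eq_one_of_isRoot_nsmul this]
    simp

lemma IsRealRoot.isUnit_of_isRoot_zsmul {α : Module.Dual ℂ 𝔥} (hα : IsRealRoot R α) {n : ℤ}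
    (h : IsRoot R (n • α)) : n = 1 ∨ n = -1 := by
  obtain ⟨-, w, i, hi⟩ := hα
  have := h.weyl w.2
  rw [map_zsmul, hi] at this
  exact KacMoody.isUnit_of_isRoot_zsmul this

/-- A simple reflection permutes the positive roots other than the simple root. -/
lemma IsRoot.isPos_simpleRefl {α : Module.Dual ℂ 𝔥} (h : IsRoot R α) (hpos : IsPos R α) {i : ι}
    (hi : α ≠ R.root i) : IsPos R (simpleRefl R i α) := by
  classical
  obtain h' | h' := (h.weyl (simpleRefl_mem i)).isPos_or_isNeg
  · exact h'
  exfalso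
  obtain ⟨d, hd, rfl⟩ := isPos_iff.1 hpos
  obtain ⟨d', -, hd'⟩ := isNeg_iff.1 h'
  -- The reflection changes only the coefficient of `αᵢ`. If the image were negative, all other
  -- coefficients would be both nonnegative and nonpositive.
  have key : ∀ j, j ≠ i → d j = 0 := by
    intro j hj
    rw [wt_eq_zsmul, simpleRefl_apply, coroot_apply_sum, Int.cast_smul_eq_zsmul, negWt_eq,
      wt_eq_zsmul, ← Finset.sum_neg_distrib] at hd'
    set N := ∑ j, C.A i j * (d j : ℤ)
    have h2 : N • R.root i = ∑ j, (if j = i then N else 0) • R.root j := by simp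
    rw [h2, ← Finset.sum_sub_distrib] at hd'
    simp only [← sub_smul, ← neg_smul] at hd'
    have := congrFun (sum_zsmul_root_injective R hd') j
    simp only [hj, if_false] at this
    omega
  have hds : d = Finsupp.single i (d i) := by
    ext j
    by_cases hj : j = i
    · subst hj; simp
    · rw [key j hj, Finsupp.single_eq_of_ne hj]
  rw [hds, wt_single] at h hi
  rw [eq_one_of_isRoot_nsmul h, one_smul] at hi
  exact hi rfl

/-- Along a word for `w` the sign changes at some letter `i`, and a simple reflection changes the
sign of a positive root only if that root is `αᵢ`. Thus imaginary roots keep their sign under `W`.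
-/
lemma IsRoot.isRealRoot_of_isNeg {α : Module.Dual ℂ 𝔥} (h : IsRoot R α) (hpos : IsPos R α)
    {w : Module.Dual ℂ 𝔥 ≃ₗ[ℂ] Module.Dual ℂ 𝔥} (hw : w ∈ KacMoody.weyl R)
    (hneg : IsNeg R (w α)) : IsRealRoot R α := by
  obtain ⟨l, rfl⟩ := exists_wordProd_eq hw
  induction l with
  | nil => exact absurd hneg hpos.not_isNeg
  | cons i l ih =>
    rcases (h.weyl (wordProd_mem l)).isPos_or_isNeg with h' | h'
    · rw [wordProd_cons, LinearEquiv.mul_apply] at hneg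
      by_cases hi : wordProd R l α = R.root i
      · exact ⟨h, ⟨_, wordProd_mem l⟩, i, hi⟩
      · exact absurd hneg ((h.weyl (wordProd_mem l)).isPos_simpleRefl h' hi).not_isNeg
    · exact ih (wordProd_mem l) h'

/-- The coroot is determined by the root. -/
lemma mul_simpleRefl_eq {w : Module.Dual ℂ 𝔥 ≃ₗ[ℂ] Module.Dual ℂ 𝔥} (hw : w ∈ KacMoody.weyl R)
    {i j : ι} (h : w (R.root i) = R.root j) : w * simpleRefl R i = simpleRefl R j * w := by
  obtain ⟨θ, hθ⟩ := exists_lifts hw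
  obtain ⟨g, hg, hg'⟩ := id hθ
  set S := algSystem R
  have he : θ (S.e i) ∈ S.weightSpace (R.root j) := h ▸ hθ.map_mem (S.e_mem i)
  have hf : θ (S.f i) ∈ S.swap.weightSpace (R.root j) := by
    rw [S.swap_weightSpace, ← h, ← map_neg]
    exact hθ.map_mem (S.f_mem i)
  rw [ChevalleySystem.weightSpace_root] at he hf
  obtain ⟨a, ha⟩ := Submodule.mem_span_singleton.1 he
  obtain ⟨b, hb⟩ := Submodule.mem_span_singleton.1 hf
  have hb' : b • S.f j = θ (S.f i) := hb
  -- A lift sends `e i` and `f i` to multiples of `e j` and `f j`, since these weight spaces are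
  -- lines; bracketing locates the image of the coroot. Pairing with the root then gives `a * b =
  -- 1`.
  have h1 : S.h (g (R.coroot i)) = S.h ((a * b) • R.coroot j) := by
    rw [← hg', ← S.lie_e_f, LieHom.map_lie, ← ha, ← hb', smul_lie, lie_smul, S.lie_e_f, smul_smul,
      map_smul]
  have h2 := algSystem_h_injective R h1
  have h3 : a * b = 1 := by
    have h4 := hg (R.root i) (R.coroot i)
    rw [h, h2, map_smul, root_coroot_self, root_coroot_self, smul_eq_mul] at h4
    exact mul_right_cancel₀ two_ne_zero (h4.trans (one_mul _).symm)
  rw [h3, one_smul] at h2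
  refine LinearEquiv.ext fun μ => ?_
  rw [LinearEquiv.mul_apply, LinearEquiv.mul_apply, simpleRefl_apply, simpleRefl_apply, map_sub,
    map_smul, h, ← h2, hg]

/-! ### Length and inversions -/

variable (R) in
/-- The positive roots made negative by `w`. -/
def inversions (w : Module.Dual ℂ 𝔥 ≃ₗ[ℂ] Module.Dual ℂ 𝔥) : Set (Module.Dual ℂ 𝔥) :=
  {α | IsRoot R α ∧ IsPos R α ∧ IsNeg R (w α)}

lemma inversions_one : inversions R 1 = ∅ := by
  ext α
  simp only [inversions, Set.mem_ofPred_eq, Set.mem_empty_iff_false, iff_false, not_and]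
  exact fun _ h => h.not_isNeg

lemma inversions_mul_simpleRefl {w : Module.Dual ℂ 𝔥 ≃ₗ[ℂ] Module.Dual ℂ 𝔥} {i : ι}
    (h : IsPos R (w (R.root i))) :
    inversions R (w * simpleRefl R i) = insert (R.root i) (simpleRefl R i '' inversions R w) := by
  ext α
  simp only [Set.mem_insert_iff, Set.mem_image]
  constructor
  · rintro ⟨h1, h2, h3⟩
    by_cases hα : α = R.root i
    · exact .inl hα
    · exact .inr ⟨_, ⟨h1.weyl (simpleRefl_mem i), h1.isPos_simpleRefl h2 hα, h3⟩,
        simpleRefl_simpleRefl i α⟩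
  · rintro (rfl | ⟨β, ⟨h1, h2, h3⟩, rfl⟩)
    · refine ⟨isRoot_root i, isPos_root i, ?_⟩
      rwa [LinearEquiv.mul_apply, simpleRefl_root, map_neg, isNeg_neg]
    · refine ⟨h1.weyl (simpleRefl_mem i), h1.isPos_simpleRefl h2 ?_, ?_⟩
      · rintro rfl
        exact h.not_isNeg h3
      · rwa [LinearEquiv.mul_apply, simpleRefl_simpleRefl]

lemma root_notMem_image_inversions {w : Module.Dual ℂ 𝔥 ≃ₗ[ℂ] Module.Dual ℂ 𝔥} {i : ι} :
    R.root i ∉ simpleRefl R i '' inversions R w := by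
  rintro ⟨β, ⟨h1, h2, h3⟩, h4⟩
  have : β = -R.root i := by rw [← simpleRefl_simpleRefl i β, h4, simpleRefl_root]
  rw [this] at h2
  exact (isPos_root i).not_isNeg h2

lemma inversions_finite {w : Module.Dual ℂ 𝔥 ≃ₗ[ℂ] Module.Dual ℂ 𝔥} (hw : w ∈ weyl R) :
    (inversions R w).Finite := by
  have key : ∀ l : List ι, (inversions R (wordProd R l.reverse)).Finite := by
    intro l
    induction l with
    | nil => rw [List.reverse_nil, wordProd_nil, inversions_one]; exact Set.finite_empty
    | cons i l ih =>
      set v := wordProd R l.reverse with hv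
      have hvw : v ∈ weyl R := wordProd_mem _
      have e : wordProd R (i :: l).reverse = v * simpleRefl R i := by
        rw [List.reverse_cons, wordProd_append]; simp [wordProd, hv]
      rw [e]
      rcases ((isRoot_root i).weyl hvw).isPos_or_isNeg with h | h
      · rw [inversions_mul_simpleRefl h]
        exact (ih.image _).insert _
      -- Here the set shrinks: the formula is used for `v * sᵢ`, and finiteness is inherited from `v
      -- = (v * sᵢ) * sᵢ`.
      · have h2 : IsPos R ((v * simpleRefl R i) (R.root i)) := by
          rwa [LinearEquiv.mul_apply, simpleRefl_root, map_neg, isPos_neg]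
        have h3 := inversions_mul_simpleRefl h2
        rw [mul_assoc, simpleRefl_mul_self, mul_one] at h3
        rw [h3] at ih
        exact Set.Finite.of_finite_image (ih.subset (Set.subset_insert _ _))
          (simpleRefl R i).injective.injOn
  obtain ⟨l, rfl⟩ := exists_wordProd_eq hw
  have := key l.reverse
  rwa [List.reverse_reverse] at this

lemma ncard_inversions_mul_simpleRefl {w : Module.Dual ℂ 𝔥 ≃ₗ[ℂ] Module.Dual ℂ 𝔥} (hw : w ∈ weyl R)
    {i : ι} (h : IsPos R (w (R.root i))) :
    (inversions R (w * simpleRefl R i)).ncard = (inversions R w).ncard + 1 := by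
  rw [inversions_mul_simpleRefl h, Set.ncard_insert_of_notMem root_notMem_image_inversions
    ((inversions_finite hw).image _), Set.ncard_image_of_injective _ (simpleRefl R i).injective]

/-- The exchange condition. -/
lemma exists_wordProd_eq_mul_simpleRefl {l : List ι} {i : ι}
    (h : IsNeg R (wordProd R l (R.root i))) :
    ∃ l' : List ι, l'.length + 1 = l.length ∧ wordProd R l' = wordProd R l * simpleRefl R i := by
  induction l with
  | nil => exact absurd h (isPos_root (R := R) i).not_isNeg
  | cons j l ih =>
    rcases ((isRoot_root (R := R) i).weyl (wordProd_mem l)).isPos_or_isNeg with h' | h'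
    · rw [wordProd_cons, LinearEquiv.mul_apply] at h
      have hj : wordProd R l (R.root i) = R.root j := by
        by_contra hj
        exact (((isRoot_root i).weyl (wordProd_mem l)).isPos_simpleRefl h' hj).not_isNeg h
      refine ⟨l, by simp, ?_⟩
      rw [wordProd_cons, mul_assoc, mul_simpleRefl_eq (wordProd_mem l) hj, ← mul_assoc,
        simpleRefl_mul_self, one_mul]
    · obtain ⟨l', h1, h2⟩ := ih h'
      exact ⟨j :: l', by simp [h1], by rw [wordProd_cons, h2, wordProd_cons, mul_assoc]⟩

lemma exists_reduced_word (w : weyl R) : ∃ l : List ι, l.length = length R w ∧ wordProd R l = w.1 := by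
  obtain ⟨l, hl⟩ := exists_wordProd_eq w.2
  exact Nat.sInf_mem (s := {k | ∃ l : List ι, l.length = k ∧ (l.map (simpleRefl R)).prod = w.1})
    ⟨l.length, l, rfl, hl⟩

lemma length_le {w : weyl R} {l : List ι} (h : wordProd R l = w.1) : length R w ≤ l.length :=
  Nat.sInf_le ⟨l, rfl, h⟩

/-- Strip the last letter of a reduced word. Were `v αᵢ` negative, the exchange condition would
produce a shorter word for `w`. -/
lemma exists_reduced_decomposition {w : weyl R} (hw : w ≠ 1) : ∃ (v : weyl R) (i : ι),
    w.1 = v.1 * simpleRefl R i ∧ length R w = length R v + 1 ∧ IsPos R (v.1 (R.root i)) := by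
  obtain ⟨l, hl, hlw⟩ := exists_reduced_word w
  obtain rfl | ⟨l', i, rfl⟩ := l.eq_nil_or_concat
  · exact absurd (Subtype.ext hlw.symm) hw
  have hprod : wordProd R (l'.concat i) = wordProd R l' * simpleRefl R i := by
    rw [List.concat_eq_append, wordProd_append]; simp [wordProd]
  rw [hprod] at hlw
  rw [List.length_concat] at hl
  refine ⟨⟨_, wordProd_mem l'⟩, i, hlw.symm, ?_, ?_⟩
  · refine le_antisymm ?_ ?_
    · obtain ⟨l'', h1, h2⟩ := exists_reduced_word (⟨_, wordProd_mem l'⟩ : weyl R)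
      rw [← h1, ← List.length_concat (a := i)]
      refine length_le ?_
      rw [List.concat_eq_append, wordProd_append, h2, ← hlw]
      simp [wordProd]
    · rw [← hl, Nat.add_le_add_iff_right]
      exact length_le rfl
  · rcases ((isRoot_root (R := R) i).weyl (wordProd_mem l')).isPos_or_isNeg with h | h
    · exact h
    · obtain ⟨l'', h1, h2⟩ := exists_wordProd_eq_mul_simpleRefl h
      have := length_le (w := w) (h2.trans hlw)
      omega

lemma length_eq_ncard_inversions (w : weyl R) : length R w = (inversions R w.1).ncard := by
  induction hn : length R w generalizing w with
  | zero =>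
    obtain ⟨l, h1, h2⟩ := exists_reduced_word w
    rw [hn, List.length_eq_zero_iff] at h1
    rw [← h2, h1, wordProd_nil, inversions_one, Set.ncard_empty]
  | succ n ih =>
    have hw : w ≠ 1 := by
      rintro rfl
      have := length_le (w := (1 : weyl R)) (l := []) rfl
      simp at this
      omega
    obtain ⟨v, i, h1, h2, h3⟩ := exists_reduced_decomposition hw
    rw [h1, ncard_inversions_mul_simpleRefl v.2 h3, ← ih v (by omega)]

lemma eq_one_of_isPos {w : weyl R} (h : ∀ i, IsPos R (w.1 (R.root i))) : w = 1 := by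
  by_contra hw
  obtain ⟨v, i, h1, -, h3⟩ := exists_reduced_decomposition hw
  have := h i
  rw [h1, LinearEquiv.mul_apply, simpleRefl_root, map_neg] at this
  exact h3.not_isNeg this

lemma finite_length_eq (n : ℕ) : {w : weyl R | length R w = n}.Finite := by
  refine Set.Finite.subset ((List.finite_length_eq ι n).image
    fun l => (⟨wordProd R l, wordProd_mem l⟩ : weyl R)) fun w hw => ?_
  obtain ⟨l, h1, h2⟩ := exists_reduced_word w
  exact ⟨l, h1.trans hw, Subtype.ext h2⟩

lemma finite_length_le (n : ℕ) : {w : weyl R | length R w ≤ n}.Finite := by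
  refine ((Set.finite_Iic n).biUnion fun k _ => finite_length_eq (R := R) k).subset fun w hw => ?_
  simp only [Set.mem_iUnion]
  exact ⟨length R w, hw, rfl⟩

/-! ### Root strings and supports of roots -/

/-- Otherwise a nonzero vector of weight `β` would be primitive for the `i`-th `sl₂`. Local
nilpotency of `f i` forces the weight of a primitive vector to be a nonnegative integer,
contradicting `n < 0`. -/
lemma ChevalleySystem.IsReduced.weightSpace_add_root_ne_bot {L : Type*} [LieRing L]
    [LieAlgebra ℂ L] {S : ChevalleySystem R L} (hS : S.IsReduced) (hinj : Function.Injective S.h)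
    {β : Module.Dual ℂ 𝔥} (h : S.weightSpace β ≠ ⊥) {i : ι} {n : ℤ}
    (hn : β (R.coroot i) = n) (hneg : n < 0) : S.weightSpace (β + R.root i) ≠ ⊥ := by
  intro h0
  obtain ⟨x, hx, hx0⟩ := (Submodule.ne_bot_iff _).1 h
  have hex : ⁅S.e i, x⁆ = 0 := by
    have h1 : ⁅S.e i, x⁆ ∈ S.weightSpace (β + R.root i) := by
      rw [add_comm]
      exact S.lie_mem_weightSpace (S.e_mem i) hx
    rwa [h0, Submodule.mem_bot] at h1
  have hP : IsSl2Triple.HasPrimitiveVectorWith (S.isSl2Triple hinj i) x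
      (n : ℂ) := ⟨hx0, by rw [← hn]; exact hx _, hex⟩
  obtain ⟨k, hk⟩ := hS.ad_f_locallyNilpotent hinj i x
  obtain ⟨m, hm1, hm2⟩ := Nat.exists_not_and_succ_of_not_zero_of_exists
    (p := fun k => ((LieAlgebra.ad ℂ L (S.f i)) ^ k) x = 0) (by simpa using hx0) ⟨k, hk⟩
  have h1 := hP.lie_e_pow_succ_toEnd_f m
  have h2 : ((LieModule.toEnd ℂ L L (S.f i)) ^ (m + 1)) x = 0 := hm2
  rw [h2, lie_zero, eq_comm, smul_eq_zero, mul_eq_zero, sub_eq_zero] at h1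
  rcases h1.resolve_right hm1 with h1 | h1
  · exact Nat.cast_add_one_ne_zero m h1
  · have : n = m := by exact_mod_cast h1
    omega

lemma rootSpace_add_root_ne_bot {β : Module.Dual ℂ 𝔥} (h : rootSpace R β ≠ ⊥) {i : ι} {n : ℤ}
    (hn : β (R.coroot i) = n) (hneg : n < 0) : rootSpace R (β + R.root i) ≠ ⊥ :=
  (algSystem_isReduced R).weightSpace_add_root_ne_bot (algSystem_h_injective R) h hn hneg

lemma algSystem_swap_h_injective : Function.Injective (algSystem R).swap.h :=
  fun _ _ hxy => algSystem_h_injective R (neg_injective hxy)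

lemma rootSpace_neg_add_root_ne_bot {β : Module.Dual ℂ 𝔥} (h : rootSpace R (-β) ≠ ⊥) {i : ι} {n : ℤ}
    (hn : β (R.coroot i) = n) (hneg : n < 0) : rootSpace R (-(β + R.root i)) ≠ ⊥ := by
  rw [← algSystem_weightSpace, ← ChevalleySystem.swap_weightSpace] at h ⊢
  exact (algSystem_isReduced R).swap.weightSpace_add_root_ne_bot algSystem_swap_h_injective h hn hneg

lemma lie_e_e_eq_zero {i j : ι} (hij : i ≠ j) (h : C.A i j = 0) :
    ⁅(algSystem R).e i, (algSystem R).e j⁆ = 0 := by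
  have := (algSystem_isReduced R).swap.serre algSystem_swap_h_injective hij
  rw [h] at this
  rwa [neg_zero, Int.toNat_zero, zero_add, pow_one, LieAlgebra.ad_apply] at this

/-- The support of a root is connected. -/
lemma IsRoot.support_connected {d : ι →₀ ℕ} (h : IsRoot R (wt R d)) {J : Set ι}
    (hJ : ∀ i ∈ J, ∀ j ∉ J, d i ≠ 0 → d j ≠ 0 → C.A i j = 0) :
    (∀ i, d i ≠ 0 → i ∈ J) ∨ ∀ i, d i ≠ 0 → i ∉ J := by
  classical
  set S := algSystem R
  obtain ⟨l, i, rfl, h0⟩ := S.exists_eWord_of_weightSpace_ne_bot (wt_ne_zero.1 h.2.1) h.2.2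
  have hmem : ∀ {l : List ι} {i j : ι}, ChevalleySystem.wordContent l i j ≠ 0 → j ∈ i :: l := by
    intro l i j
    induction l with
    | nil =>
      intro h
      by_contra hj
      rw [List.mem_singleton] at hj
      simp [ChevalleySystem.wordContent, hj] at h
    | cons k l ih =>
      rw [ChevalleySystem.wordContent_cons, Finsupp.add_apply]
      intro h
      by_cases hk : j = k
      · simp [hk]
      · rw [Finsupp.single_eq_of_ne hk, zero_add] at h
        have := ih h
        simp only [List.mem_cons] at this ⊢
        tauto
  have hcomm : ∀ (k : ι) (l : List ι) (i : ι), (∀ j ∈ i :: l, ⁅S.e k, S.e j⁆ = 0) →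
      ⁅S.e k, S.eWord l i⁆ = 0 := by
    intro k l i
    induction l with
    | nil => intro h; exact h i (by simp)
    | cons j l ih =>
      intro h
      rw [ChevalleySystem.eWord_cons, leibniz_lie, h j (by simp), zero_lie, ih, lie_zero, add_zero]
      intro j' hj'
      simp only [List.mem_cons] at hj'
      exact h j' (by simp only [List.mem_cons]; tauto)
  -- Induction on the word: the nonvanishing inner word has its letters on one side of the cut, and
  -- a new letter from the other side would commute with all of them and kill the bracket.
  have key : ∀ l : List ι, (∀ a ∈ J, ∀ b ∉ J, a ∈ i :: l → b ∈ i :: l → C.A a b = 0) →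
      S.eWord l i ≠ 0 → (∀ j ∈ i :: l, j ∈ J) ∨ ∀ j ∈ i :: l, j ∉ J := by
    intro l
    induction l with
    | nil => intro _ _; by_cases hi : i ∈ J <;> simp [hi]
    | cons k l ih =>
      intro hl h0
      rw [ChevalleySystem.eWord_cons] at h0
      have hsub : ∀ a ∈ i :: l, a ∈ i :: k :: l := fun a ha => by
        simp only [List.mem_cons] at ha ⊢; tauto
      have hk : k ∈ i :: k :: l := by simp
      rcases ih (fun a ha b hb h1 h2 => hl a ha b hb (hsub a h1) (hsub b h2))
        (fun h => h0 (by rw [h, lie_zero])) with h | h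
      · left
        have hkJ : k ∈ J := by
          by_contra hkJ
          refine h0 (hcomm k l i fun j hj => ?_)
          exact lie_e_e_eq_zero (fun e => hkJ (e ▸ h j hj))
            (C.zero_symm _ _ (hl j (h j hj) k hkJ (hsub j hj) hk))
        simp only [List.mem_cons] at h ⊢
        rintro j (rfl | rfl | hj)
        exacts [h _ (.inl rfl), hkJ, h _ (.inr hj)]
      · right
        have hkJ : k ∉ J := by
          intro hkJ
          refine h0 (hcomm k l i fun j hj => ?_)
          exact lie_e_e_eq_zero (fun e => h j hj (e ▸ hkJ)) (hl k hkJ j (h j hj) hk (hsub j hj))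
        simp only [List.mem_cons] at h ⊢
        rintro j (rfl | rfl | hj)
        exacts [h _ (.inl rfl), hkJ, h _ (.inr hj)]
  rcases key l (fun a ha b hb h1 h2 => hJ a ha b hb
    (ChevalleySystem.wordContent_apply_pos h1).ne' (ChevalleySystem.wordContent_apply_pos h2).ne') h0
    with h | h
  · exact .inl fun j hj => h j (hmem hj)
  · exact .inr fun j hj => h j (hmem hj)

end Roots

end KacMoody

end

/-! ### Stable and antidominant weights, and the imaginary cone. -/

noncomputable section

namespace KacMoody

section ImaginaryCone

variable {ι : Type*} [Fintype ι] {C : GCM ι} {𝔥 : Type*} [AddCommGroup 𝔥] [Module ℂ 𝔥]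
  {R : Realization C 𝔥}

/-! ### The antidominant chamber -/

/-- The integer `⟨∑ dⱼ αⱼ, αᵢ^∨⟩`. -/
def GCM.pair (C : GCM ι) (i : ι) (d : ι →₀ ℕ) : ℤ := ∑ j, C.A i j * d j

lemma wt_coroot (i : ι) (d : ι →₀ ℕ) : wt R d (R.coroot i) = C.pair i d := by
  rw [wt_eq_zsmul, coroot_apply_sum]; rfl

lemma simpleRefl_wt (i : ι) (d : ι →₀ ℕ) :
    simpleRefl R i (wt R d) = wt R d - C.pair i d • R.root i := by
  rw [simpleRefl_apply, wt_coroot, Int.cast_smul_eq_zsmul]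

lemma GCM.pair_add (i : ι) (d d' : ι →₀ ℕ) : C.pair i (d + d') = C.pair i d + C.pair i d' := by
  simp [GCM.pair, mul_add, Finset.sum_add_distrib]

lemma GCM.pair_nsmul (i : ι) (n : ℕ) (d : ι →₀ ℕ) : C.pair i (n • d) = n * C.pair i d := by
  simp only [GCM.pair, Finset.mul_sum]
  refine Finset.sum_congr rfl fun j _ => ?_
  rw [Finsupp.smul_apply, smul_eq_mul, Nat.cast_mul]
  ring

lemma GCM.pair_nonpos_of_apply_eq_zero {i : ι} {d : ι →₀ ℕ} (h : d i = 0) : C.pair i d ≤ 0 := by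
  refine Finset.sum_nonpos fun j _ => ?_
  by_cases hj : i = j
  · subst hj; simp [h]
  · exact mul_nonpos_of_nonpos_of_nonneg (C.nonpos i j hj) (Int.natCast_nonneg _)

variable (C) in
/-- `⟨∑ dⱼ αⱼ, αᵢ^∨⟩ ≤ 0` for all `i`. -/
def IsAntidominant (d : ι →₀ ℕ) : Prop := ∀ i, C.pair i d ≤ 0

variable (C) in
/-- The support of `d` is a connected subset of the Dynkin diagram. -/
def SupportConnected (d : ι →₀ ℕ) : Prop :=
  ∀ U : Set ι, (∃ i ∈ U, d i ≠ 0) → (∀ i ∈ U, ∀ j ∉ U, d i ≠ 0 → d j ≠ 0 → C.A i j = 0) →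
    ∀ i, d i ≠ 0 → i ∈ U

/-- A vector in the antidominant chamber with connected support is proportional to an element of
any set that contains the simple roots and is closed under adding `αᵢ` to elements pairing
negatively with `αᵢ^∨`. -/
lemma exists_proportional {P : (ι →₀ ℕ) → Prop} (hP0 : ∀ d, P d → d ≠ 0)
    (hP1 : ∀ i, P (Finsupp.single i 1))
    (hP2 : ∀ d i, P d → C.pair i d < 0 → P (d + Finsupp.single i 1))
    {d : ι →₀ ℕ} (hd : d ≠ 0) (ha : IsAntidominant C d) (hc : SupportConnected C d) :
    ∃ m, P m ∧ m ≤ d ∧ ∃ p q : ℕ, q ≠ 0 ∧ q • d = p • m := by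
  classical
  obtain ⟨i₁, hi₁⟩ := Finsupp.ne_iff.1 hd
  have hne : ({m ∈ Finset.Iic d | P m}).Nonempty := by
    refine ⟨Finsupp.single i₁ 1, Finset.mem_filter.2 ⟨Finset.mem_Iic.2 ?_, hP1 i₁⟩⟩
    rw [Finsupp.single_le_iff]
    exact Nat.one_le_iff_ne_zero.2 hi₁
  obtain ⟨m, hm, hmax⟩ := Finset.exists_max_image _ Finsupp.degree hne
  rw [Finset.mem_filter, Finset.mem_Iic] at hm
  refine ⟨m, hm.2, hm.1, ?_⟩
  -- Since `m` has maximal degree among elements of `P` below `d`, it cannot be increased in a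
  -- direction where there is still room.
  have h1 : ∀ i, m i < d i → 0 ≤ C.pair i m := by
    intro i hi
    by_contra! hneg
    have hle : m + Finsupp.single i 1 ≤ d := by
      intro j
      rw [Finsupp.add_apply, Finsupp.single_apply]
      split_ifs with h
      · subst h; exact hi
      · exact hm.1 j
    have := hmax _ (Finset.mem_filter.2 ⟨Finset.mem_Iic.2 hle, hP2 m i hm.2 hneg⟩)
    rw [map_add, Finsupp.degree_single] at this
    omega
  -- A missing vertex `j` of the support of `d` has `C.pair j m ≤ 0` because `m j = 0`, and `≥ 0` by
  -- maximality. It is thus orthogonal to the support of `m`, contradicting connectedness.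
  have h2 : ∀ i, d i ≠ 0 → m i ≠ 0 := by
    obtain ⟨i₂, hi₂⟩ := Finsupp.ne_iff.1 (hP0 m hm.2)
    refine hc {i | m i ≠ 0} ⟨i₂, hi₂, fun h => hi₂ ?_⟩ ?_
    · have := hm.1 i₂
      simp only [h, Finsupp.coe_zero, Pi.zero_apply] at this ⊢
      omega
    · intro i hi j hj _ hdj
      have hj : m j = 0 := not_not.1 hj
      have h3 := le_antisymm (GCM.pair_nonpos_of_apply_eq_zero hj) (h1 j (by omega))
      rw [GCM.pair, Finset.sum_eq_zero_iff_of_nonpos] at h3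
      · have h4 := h3 i (Finset.mem_univ i)
        rw [mul_eq_zero] at h4
        exact C.zero_symm _ _ (h4.resolve_right (by exact_mod_cast hi))
      · intro l _
        by_cases hl : j = l
        · subst hl; simp [hj]
        · exact mul_nonpos_of_nonpos_of_nonneg (C.nonpos j l hl) (Int.natCast_nonneg _)
  obtain ⟨i₀, hi₀, hr⟩ := Finset.exists_max_image d.support (fun i => (d i : ℚ) / m i)
    ⟨i₁, Finsupp.mem_support_iff.2 hi₁⟩
  rw [Finsupp.mem_support_iff] at hi₀
  have hm₀ := h2 i₀ hi₀
  have hr' : ∀ i, (d i : ℤ) * m i₀ ≤ d i₀ * m i := by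
    intro i
    by_cases hi : d i = 0
    · rw [hi, Nat.cast_zero, zero_mul]; positivity
    · have h3 := hr i (Finsupp.mem_support_iff.2 hi)
      have hmi := h2 i hi
      rw [div_le_div_iff₀ (by positivity) (by positivity)] at h3
      exact_mod_cast h3
  -- If the largest ratio `d i / m i` is at most one, then `d = m`. Otherwise `m i < d i` wherever
  -- that ratio is attained, so `h1` is available there.
  by_cases hlt : d i₀ ≤ m i₀
  · refine ⟨1, 1, one_ne_zero, ?_⟩
    rw [one_smul, one_smul]
    refine le_antisymm (fun i => ?_) hm.1
    have h3 := hr' i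
    have h4 : (d i : ℤ) * m i₀ ≤ m i₀ * m i := h3.trans (by gcongr)
    have h5 : (0 : ℤ) < m i₀ := by positivity
    rw [mul_comm] at h4
    exact_mod_cast le_of_mul_le_mul_left h4 h5
  refine ⟨d i₀, m i₀, hm₀, ?_⟩
  -- The vector `d i₀ • m - m i₀ • d` is nonnegative. At a vertex `i` where it vanishes, its pairing
  -- with `αᵢ^∨` is a sum of nonpositive terms, but it is nonnegative by `h1` and antidominance. So
  -- it vanishes at every neighbour, and connectedness spreads the equality over the whole support.
  have key : ∀ i, d i ≠ 0 → i ∈ {i | (d i : ℤ) * m i₀ = d i₀ * m i} := by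
    refine hc _ ⟨i₀, by simp, hi₀⟩ fun i hi j hj hdi hdj => ?_
    have hi : (d i : ℤ) * m i₀ = d i₀ * m i := hi
    have hj : (d j : ℤ) * m i₀ < d i₀ * m j := lt_of_le_of_ne (hr' j) hj
    have h3 : m i < d i := by
      have h5 : (0 : ℤ) < m i₀ := by positivity
      have h6 : (0 : ℤ) < m i := by have := h2 i hdi; positivity
      have h7 : (m i : ℤ) * m i₀ < d i * m i₀ := by
        rw [hi, mul_comm]
        have : (m i₀ : ℤ) < d i₀ := by exact_mod_cast not_le.1 hlt
        gcongr
      exact_mod_cast lt_of_mul_lt_mul_right h7 h5.le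
    have h4 : ∑ l, C.A i l * ((d i₀ : ℤ) * m l - d l * m i₀) =
        d i₀ * C.pair i m - m i₀ * C.pair i d := by
      simp only [GCM.pair, Finset.mul_sum, ← Finset.sum_sub_distrib]
      exact Finset.sum_congr rfl fun l _ => by ring
    have h5 : 0 ≤ (d i₀ : ℤ) * C.pair i m - m i₀ * C.pair i d := by
      have := mul_nonneg (Int.natCast_nonneg (d i₀)) (h1 i h3)
      have := mul_nonneg (Int.natCast_nonneg (m i₀)) (neg_nonneg.2 (ha i))
      linarith
    have h6 : ∀ l ∈ Finset.univ, C.A i l * ((d i₀ : ℤ) * m l - d l * m i₀) ≤ 0 := by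
      intro l _
      by_cases hl : i = l
      · subst hl; rw [hi, sub_self, mul_zero]
      · exact mul_nonpos_of_nonpos_of_nonneg (C.nonpos i l hl) (sub_nonneg.2 (hr' l))
    have h7 := (Finset.sum_eq_zero_iff_of_nonpos h6).1
      (le_antisymm (Finset.sum_nonpos h6) (h4 ▸ h5)) j (Finset.mem_univ j)
    rw [mul_eq_zero] at h7
    exact h7.resolve_right (by omega)
  ext i
  rw [Finsupp.smul_apply, Finsupp.smul_apply, smul_eq_mul, smul_eq_mul]
  by_cases hi : d i = 0
  · have := hm.1 i
    rw [hi] at this ⊢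
    rw [Nat.le_zero.1 this, mul_zero, mul_zero]
  · have := key i hi
    rw [mul_comm]
    exact_mod_cast this

/-- Write the proportionality in lowest terms as `q' d = p' m`, so `p'` divides `d`. If `p' = 1`,
then `m ≤ d` forces `d = m`; otherwise `d / p'` satisfies the same hypotheses in smaller degree. -/
lemma exists_multiple {P : (ι →₀ ℕ) → Prop} (hP0 : ∀ d, P d → d ≠ 0)
    (hP1 : ∀ i, P (Finsupp.single i 1))
    (hP2 : ∀ d i, P d → C.pair i d < 0 → P (d + Finsupp.single i 1))
    {d : ι →₀ ℕ} (hd : d ≠ 0) (ha : IsAntidominant C d) (hc : SupportConnected C d) :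
    ∃ (n : ℕ) (m : ι →₀ ℕ), P m ∧ d = n • m := by
  induction hN : Finsupp.degree d using Nat.strong_induction_on generalizing d with
  | _ N ih =>
  obtain ⟨m, hm, hmd, p, q, hq, hpq⟩ := exists_proportional hP0 hP1 hP2 hd ha hc
  have hp : p ≠ 0 := by
    rintro rfl
    rw [zero_smul, smul_eq_zero] at hpq
    exact hpq.elim hq hd
  obtain ⟨g, hg, hcop⟩ : ∃ g, g = p.gcd q ∧ (p / g).Coprime (q / g) :=
    ⟨_, rfl, Nat.coprime_div_gcd_div_gcd (Nat.gcd_pos_of_pos_left _ (Nat.pos_of_ne_zero hp))⟩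
  have hgpos : 0 < g := hg ▸ Nat.gcd_pos_of_pos_left _ (Nat.pos_of_ne_zero hp)
  obtain ⟨p', hp'⟩ : g ∣ p := hg ▸ Nat.gcd_dvd_left p q
  obtain ⟨q', hq'⟩ : g ∣ q := hg ▸ Nat.gcd_dvd_right p q
  rw [hp', hq', Nat.mul_div_cancel_left _ hgpos, Nat.mul_div_cancel_left _ hgpos] at hcop
  have heq : ∀ i, q' * d i = p' * m i := by
    intro i
    have := DFunLike.congr_fun hpq i
    rw [Finsupp.smul_apply, Finsupp.smul_apply, smul_eq_mul, smul_eq_mul, hp', hq', mul_assoc,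
      mul_assoc] at this
    exact Nat.eq_of_mul_eq_mul_left hgpos this
  have hp'0 : p' ≠ 0 := by rintro rfl; simp [hp] at hp'
  have hq'0 : q' ≠ 0 := by rintro rfl; simp [hq] at hq'
  have hdvd : ∀ i, p' ∣ d i := fun i => hcop.dvd_of_dvd_mul_left ⟨m i, heq i⟩
  by_cases h1 : p' = 1
  · refine ⟨1, m, hm, ?_⟩
    rw [one_smul]
    refine le_antisymm (fun i => ?_) hmd
    have := heq i
    rw [h1, one_mul] at this
    rw [← this]
    exact Nat.le_mul_of_pos_left _ (Nat.pos_of_ne_zero hq'0)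
  set γ : ι →₀ ℕ := d.mapRange (· / p') (Nat.zero_div _) with hγ
  have hdγ : d = p' • γ := by
    ext i
    rw [Finsupp.smul_apply, hγ, Finsupp.mapRange_apply, smul_eq_mul, Nat.mul_div_cancel' (hdvd i)]
  have hγ0 : γ ≠ 0 := by
    intro h
    rw [h, smul_zero] at hdγ
    exact hd hdγ
  have hsupp : ∀ i, γ i ≠ 0 ↔ d i ≠ 0 := fun i => by
    rw [hdγ, Finsupp.smul_apply, smul_eq_mul, mul_ne_zero_iff, and_iff_right hp'0]
  have hdeg : Finsupp.degree γ < N := by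
    rw [← hN, hdγ, map_nsmul, smul_eq_mul]
    have h2 : 0 < Finsupp.degree γ := Nat.pos_of_ne_zero (by rwa [Ne, Finsupp.degree_eq_zero_iff])
    have h3 : 2 ≤ p' := by omega
    nlinarith
  obtain ⟨n, m', hm', hn⟩ := ih _ hdeg hγ0 (fun i => by
    have := ha i
    rw [hdγ, GCM.pair_nsmul] at this
    exact nonpos_of_mul_nonpos_right this (by positivity)) (fun U hU hU' i hi => by
    simp only [hsupp] at hU hU' hi
    exact hc U hU hU' i hi) rfl
  exact ⟨p' * n, m', hm', by rw [hdγ, hn, mul_smul]⟩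

variable (R) in
/-- Both `∑ dᵢ αᵢ` and its negative are roots. -/
def IsTwoSidedRoot (d : ι →₀ ℕ) : Prop := IsRoot R (wt R d) ∧ IsRoot R (-wt R d)

/-- Root strings extend separately for positive and for negative weight spaces. Carrying both along
supplies the negative root needed for `negImCone` directly. -/
lemma exists_multiple_isTwoSidedRoot {d : ι →₀ ℕ} (hd : d ≠ 0) (ha : IsAntidominant C d)
    (hc : SupportConnected C d) : ∃ (n : ℕ) (m : ι →₀ ℕ), IsTwoSidedRoot R m ∧ d = n • m := by
  refine exists_multiple (fun d h => wt_ne_zero.1 h.1.2.1) (fun i => ?_) (fun d i h hneg => ?_)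
    hd ha hc
  · rw [IsTwoSidedRoot, wt_single, one_smul]
    refine ⟨isRoot_root i, ?_⟩
    rw [← simpleRefl_root]
    exact (isRoot_root i).weyl (simpleRefl_mem i)
  · have h1 : IsPos R (wt R (d + Finsupp.single i 1)) := by
      rw [isPos_wt]
      intro h
      simpa using (add_eq_zero.1 h).2
    have h2 : wt R (d + Finsupp.single i 1) = wt R d + R.root i := by
      rw [wt_add, wt_single, one_smul]
    refine ⟨⟨rootCone_le_rootLattice h1.1, h1.2, ?_⟩,
      ⟨neg_mem (rootCone_le_rootLattice h1.1), neg_ne_zero.2 h1.2, ?_⟩⟩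
    · rw [h2]
      exact rootSpace_add_root_ne_bot h.1.2.2 (wt_coroot i d) hneg
    · rw [h2]
      exact rootSpace_neg_add_root_ne_bot h.2.2.2 (wt_coroot i d) hneg

/-! ### Weights whose orbit is positive -/

variable (R) in
/-- All `W`-conjugates of `∑ dᵢ αᵢ` lie in `Q⁺`. -/
def IsStable (d : ι →₀ ℕ) : Prop := ∀ w ∈ weyl R, w (wt R d) ∈ rootCone R

/-- Writing `w = v sᵢ` with `v αᵢ > 0`, passing from `v` to `w` adds a nonnegative multiple of `v
αᵢ`. Hence every conjugate dominates the antidominant weight, which is the form that the induction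
needs. -/
lemma IsAntidominant.isStable {d : ι →₀ ℕ} (ha : IsAntidominant C d) : IsStable R d := by
  suffices key : ∀ (n : ℕ) (w : weyl R), length R w = n → ∃ e, w.1 (wt R d) = wt R (d + e) by
    intro w hw
    obtain ⟨e, he⟩ := key _ ⟨w, hw⟩ rfl
    exact mem_rootCone_iff.2 ⟨_, he⟩
  intro n
  induction n with
  | zero =>
    intro w hw
    obtain ⟨l, h1, h2⟩ := exists_reduced_word w
    rw [hw, List.length_eq_zero_iff] at h1
    exact ⟨0, by rw [← h2, h1, add_zero]; rfl⟩
  | succ n ih =>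
    intro w hw
    have hw1 : w ≠ 1 := by
      rintro rfl
      have := length_le (w := (1 : weyl R)) (l := []) rfl
      simp at this
      omega
    obtain ⟨v, i, h1, h2, h3⟩ := exists_reduced_decomposition hw1
    obtain ⟨e, he⟩ := ih v (by omega)
    obtain ⟨a, -, ha'⟩ := isPos_iff.1 h3
    refine ⟨e + (-C.pair i d).toNat • a, ?_⟩
    have h4 : (((-C.pair i d).toNat : ℕ) : ℤ) = -C.pair i d :=
      Int.toNat_of_nonneg (neg_nonneg.2 (ha i))
    rw [h1, LinearEquiv.mul_apply, simpleRefl_wt, map_sub, map_zsmul, he, ha', ← add_assoc,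
      wt_add (d + e), wt_nsmul, ← natCast_zsmul, h4, neg_smul, sub_eq_add_neg]

lemma IsStable.exists_wt {d : ι →₀ ℕ} (h : IsStable R d)
    {w : Module.Dual ℂ 𝔥 ≃ₗ[ℂ] Module.Dual ℂ 𝔥} (hw : w ∈ weyl R) :
    ∃ d', w (wt R d) = wt R d' ∧ IsStable R d' := by
  obtain ⟨d', hd'⟩ := mem_rootCone_iff.1 (h w hw)
  exact ⟨d', hd', fun v hv => by rw [← hd', ← LinearEquiv.mul_apply]; exact h _ (mul_mem hv hw)⟩

lemma IsStable.add {d d' : ι →₀ ℕ} (h : IsStable R d) (h' : IsStable R d') :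
    IsStable R (d + d') := fun w hw => by
  rw [wt_add, map_add]; exact add_mem (h w hw) (h' w hw)

lemma isStable_zero : IsStable R (0 : ι →₀ ℕ) := fun w _ => by
  rw [wt_zero, map_zero]; exact zero_mem _

/-- Reflecting in a simple root with positive pairing lowers the height; stability keeps the result
in `Q⁺`, so the descent stops. -/
lemma IsStable.exists_isAntidominant {d : ι →₀ ℕ} (h : IsStable R d) :
    ∃ w ∈ weyl R, ∃ d', w (wt R d) = wt R d' ∧ IsAntidominant C d' := by
  induction hN : Finsupp.degree d using Nat.strong_induction_on generalizing d with
  | _ N ih =>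
  by_cases ha : IsAntidominant C d
  · exact ⟨1, one_mem _, d, rfl, ha⟩
  · rw [IsAntidominant] at ha
    push Not at ha
    obtain ⟨i, hi⟩ := ha
    obtain ⟨d', hd', hs⟩ := h.exists_wt (simpleRefl_mem i)
    have h1 : d' + Finsupp.single i (C.pair i d).toNat = d := by
      apply wt_injective (R := R)
      rw [wt_add, ← hd', simpleRefl_wt, wt_single, ← natCast_zsmul, Int.toNat_of_nonneg hi.le,
        sub_add_cancel]
    obtain ⟨w, hw, d'', h2, h3⟩ := ih (Finsupp.degree d') (by
      rw [← hN, ← h1, map_add, Finsupp.degree_single]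
      omega) hs rfl
    exact ⟨w * simpleRefl R i, mul_mem hw (simpleRefl_mem i), d'', by
      rw [LinearEquiv.mul_apply, hd', h2], h3⟩

lemma neg_notMem_rootCone {α : Module.Dual ℂ 𝔥} (h : IsNeg R α) : α ∉ rootCone R := fun hα =>
  IsPos.not_isNeg ⟨hα, fun h0 => h.2 (by rw [h0, neg_zero])⟩ h

lemma IsStable.of_nsmul {n : ℕ} {d : ι →₀ ℕ} (h : IsStable R (n • d)) (hn : n ≠ 0)
    (hd : IsRoot R (wt R d)) : IsStable R d := by
  intro w hw
  rcases (hd.weyl hw).isPos_or_isNeg with h' | h'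
  · exact h'.1
  · have h1 := h w hw
    rw [wt_nsmul, map_nsmul] at h1
    refine absurd h1 (neg_notMem_rootCone ?_)
    obtain ⟨e, he, hwe⟩ := isNeg_iff.1 h'
    rw [hwe, negWt_eq, smul_neg, ← wt_nsmul, isNeg_neg, isPos_wt]
    exact smul_ne_zero hn he

/-- A disconnected support splits `d` into two orthogonal antidominant pieces of smaller degree. A
connected one makes `d` a multiple of a root, which inherits stability and therefore is not real:
the orbit of a real root contains negative roots. -/
lemma neg_wt_mem_negImCone {d : ι →₀ ℕ} (ha : IsAntidominant C d) : -wt R d ∈ negImCone R := by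
  classical
  induction hN : Finsupp.degree d using Nat.strong_induction_on generalizing d with
  | _ N ih =>
  by_cases hd : d = 0
  · subst hd
    rw [wt_zero, neg_zero]
    exact zero_mem _
  by_cases hc : SupportConnected C d
  · obtain ⟨n, m, hm, rfl⟩ := exists_multiple_isTwoSidedRoot (R := R) hd ha hc
    rw [wt_nsmul, ← smul_neg]
    suffices h : IsImRoot R (-wt R m) ∧ IsNeg R (-wt R m) from
      nsmul_mem (AddSubmonoid.subset_closure
        (show -wt R m ∈ {α | IsImRoot R α ∧ IsNeg R α} from h)) n
    refine ⟨⟨hm.2, fun hreal => ?_⟩, ?_⟩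
    · have hst : IsStable R m := ha.isStable.of_nsmul (by rintro rfl; simp at hd) hm.1
      obtain ⟨w, i, hi⟩ := hreal.2
      have := hst w.1 w.2
      rw [map_neg, neg_eq_iff_eq_neg] at hi
      rw [hi] at this
      exact neg_notMem_rootCone (isNeg_neg.2 (isPos_root i)) this
    · rw [isNeg_neg, isPos_wt]
      exact wt_ne_zero.1 hm.1.2.1
  · rw [SupportConnected] at hc
    push Not at hc
    obtain ⟨U, ⟨i, hi, hdi⟩, hU, j, hj, hjU⟩ := hc
    set d₁ := d.filter (· ∈ U) with hd₁
    set d₂ := d.filter (· ∉ U) with hd₂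
    have hsum : d₁ + d₂ = d := Finsupp.filter_add_filter_not d (· ∈ U)
    have hpair : ∀ k, C.pair k d = C.pair k d₁ + C.pair k d₂ := fun k => by
      rw [← GCM.pair_add, hsum]
    have hz₁ : ∀ k ∈ U, d k ≠ 0 → C.pair k d₂ = 0 := fun k hk hdk =>
      Finset.sum_eq_zero fun l _ => by
        by_cases hl : l ∈ U
        · simp [hd₂, hl]
        · by_cases hdl : d l = 0
          · simp [hd₂, hl, hdl]
          · rw [hU k hk l hl hdk hdl, zero_mul]
    have hz₂ : ∀ k ∉ U, d k ≠ 0 → C.pair k d₁ = 0 := fun k hk hdk =>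
      Finset.sum_eq_zero fun l _ => by
        by_cases hl : l ∈ U
        · by_cases hdl : d l = 0
          · simp [hd₁, hl, hdl]
          · rw [C.zero_symm _ _ (hU l hl k hk hdl hdk), zero_mul]
        · simp [hd₁, hl]
    have ha₁ : IsAntidominant C d₁ := fun k => by
      by_cases hk : d₁ k = 0
      · exact GCM.pair_nonpos_of_apply_eq_zero hk
      · have hkU : k ∈ U := by by_contra h; simp [hd₁, h] at hk
        have hdk : d k ≠ 0 := by simpa [hd₁, hkU] using hk
        have := ha k
        rwa [hpair, hz₁ k hkU hdk, add_zero] at this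
    have ha₂ : IsAntidominant C d₂ := fun k => by
      by_cases hk : d₂ k = 0
      · exact GCM.pair_nonpos_of_apply_eq_zero hk
      · have hkU : k ∉ U := by intro h; simp [hd₂, h] at hk
        have hdk : d k ≠ 0 := by simpa [hd₂, hkU] using hk
        have := ha k
        rwa [hpair, hz₂ k hkU hdk, zero_add] at this
    have hdeg : Finsupp.degree d₁ + Finsupp.degree d₂ = N := by rw [← map_add, hsum, hN]
    have hp₁ : Finsupp.degree d₁ ≠ 0 := by
      rw [Ne, Finsupp.degree_eq_zero_iff]
      intro h
      have := DFunLike.congr_fun h i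
      simp [hd₁, hi, hdi] at this
    have hp₂ : Finsupp.degree d₂ ≠ 0 := by
      rw [Ne, Finsupp.degree_eq_zero_iff]
      intro h
      have := DFunLike.congr_fun h j
      simp [hd₂, hjU, hj] at this
    rw [← hsum, wt_add, neg_add]
    exact add_mem (ih _ (by omega) ha₁ rfl) (ih _ (by omega) ha₂ rfl)

/-- The generators are permuted: an imaginary root that changed sign would be real by
`isRealRoot_of_isNeg`. -/
lemma weyl_mem_negImCone {w : Module.Dual ℂ 𝔥 ≃ₗ[ℂ] Module.Dual ℂ 𝔥} (hw : w ∈ weyl R)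
    {α : Module.Dual ℂ 𝔥} (h : α ∈ negImCone R) : w α ∈ negImCone R := by
  induction h using AddSubmonoid.closure_induction with
  | mem α hα =>
    obtain ⟨him, hneg⟩ := hα
    refine AddSubmonoid.subset_closure ⟨him.weyl hw, ?_⟩
    rcases (him.weyl hw).1.isPos_or_isNeg with h | h
    · have h1 := (him.weyl hw).1.isRealRoot_of_isNeg h (inv_mem hw)
        (by rwa [weyl_inv_apply_apply])
      exact absurd h1 (him.weyl hw).2
    · exact h
  | zero => rw [map_zero]; exact zero_mem _
  | add x y _ _ hx hy => rw [map_add]; exact add_mem hx hy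

lemma IsStable.negWt_mem_negImCone {d : ι →₀ ℕ} (h : IsStable R d) : negWt R d ∈ negImCone R := by
  obtain ⟨w, hw, d', h1, h2⟩ := h.exists_isAntidominant
  have h3 := weyl_mem_negImCone (inv_mem hw) (neg_wt_mem_negImCone (R := R) h2)
  rwa [← h1, map_neg, weyl_inv_apply_apply] at h3

end ImaginaryCone

end KacMoody

end

/-! ### Supports of power series and finite products. -/

noncomputable section

namespace KacMoody

section FormalProducts

variable {ι : Type*}

/-! ### Supports of power series with Laurent series coefficients -/

/-- The support of `f`, as a series in the `e^{-αᵢ}` and in `q`, is contained in `T`. -/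
def SuppIn (T : Set ((ι →₀ ℕ) × ℤ)) (f : MvPowerSeries ι (LaurentSeries ℤ)) : Prop :=
  ∀ d k, (MvPowerSeries.coeff d f).coeff k ≠ 0 → (d, k) ∈ T

lemma SuppIn.coeff_eq_zero {T : Set ((ι →₀ ℕ) × ℤ)} {f : MvPowerSeries ι (LaurentSeries ℤ)}
    (h : SuppIn T f) {d : ι →₀ ℕ} {k : ℤ} (hd : (d, k) ∉ T) :
    (MvPowerSeries.coeff d f).coeff k = 0 := by
  by_contra h'
  exact hd (h d k h')

lemma SuppIn.mono {T T' : Set ((ι →₀ ℕ) × ℤ)} {f : MvPowerSeries ι (LaurentSeries ℤ)}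
    (h : SuppIn T f) (hT : T ⊆ T') : SuppIn T' f := fun d k hd => hT (h d k hd)

lemma SuppIn.add {T : Set ((ι →₀ ℕ) × ℤ)} {f g : MvPowerSeries ι (LaurentSeries ℤ)}
    (hf : SuppIn T f) (hg : SuppIn T g) : SuppIn T (f + g) := by
  intro d k h
  by_contra h'
  rw [map_add, HahnSeries.coeff_add, hf.coeff_eq_zero h', hg.coeff_eq_zero h', add_zero] at h
  exact h rfl

lemma SuppIn.sub {T : Set ((ι →₀ ℕ) × ℤ)} {f g : MvPowerSeries ι (LaurentSeries ℤ)}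
    (hf : SuppIn T f) (hg : SuppIn T g) : SuppIn T (f - g) := by
  intro d k h
  by_contra h'
  rw [map_sub, HahnSeries.coeff_sub, hf.coeff_eq_zero h', hg.coeff_eq_zero h', sub_zero] at h
  exact h rfl

lemma suppIn_zero {T : Set ((ι →₀ ℕ) × ℤ)} :
    SuppIn T (0 : MvPowerSeries ι (LaurentSeries ℤ)) := by
  intro d k h
  rw [map_zero, HahnSeries.coeff_zero] at h
  exact absurd rfl h

lemma suppIn_monomial (d : ι →₀ ℕ) (n : ℤ) (a : ℤ) :
    SuppIn {(d, n)} (MvPowerSeries.monomial d (HahnSeries.single n a)) := by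
  classical
  intro e k h
  rw [MvPowerSeries.coeff_monomial] at h
  split_ifs at h with he
  · by_cases hk : k = n
    · rw [he, hk]; rfl
    · rw [HahnSeries.coeff_single_of_ne hk] at h
      exact absurd rfl h
  · exact absurd rfl h

lemma suppIn_one {T : Set ((ι →₀ ℕ) × ℤ)} (hT : (0, 0) ∈ T) :
    SuppIn T (1 : MvPowerSeries ι (LaurentSeries ℤ)) :=
  (suppIn_monomial 0 0 1).mono (Set.singleton_subset_iff.2 hT)

lemma SuppIn.mul {T B U : Set ((ι →₀ ℕ) × ℤ)} {f g : MvPowerSeries ι (LaurentSeries ℤ)}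
    (hf : SuppIn T f) (hg : SuppIn B g) (hU : ∀ t ∈ T, ∀ b ∈ B, t + b ∈ U) :
    SuppIn U (f * g) := by
  classical
  intro d k h
  rw [MvPowerSeries.coeff_mul, HahnSeries.coeff_sum] at h
  obtain ⟨p, hp, h⟩ := Finset.exists_ne_zero_of_sum_ne_zero h
  obtain ⟨i, hi, j, hj, rfl⟩ := HahnSeries.support_mul_subset ((HahnSeries.mem_support _ _).2 h)
  rw [← Finset.HasAntidiagonal.mem_antidiagonal.1 hp]
  exact hU (p.1, i) (hf _ _ hi) (p.2, j) (hg _ _ hj)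

lemma SuppIn.mul_submonoid {B : AddSubmonoid ((ι →₀ ℕ) × ℤ)}
    {f g : MvPowerSeries ι (LaurentSeries ℤ)} (hf : SuppIn B f) (hg : SuppIn B g) :
    SuppIn B (f * g) := hf.mul hg fun _ ht _ hb => B.add_mem ht hb

lemma SuppIn.pow {B : AddSubmonoid ((ι →₀ ℕ) × ℤ)}
    {f : MvPowerSeries ι (LaurentSeries ℤ)} (hf : SuppIn B f) (n : ℕ) : SuppIn B (f ^ n) := by
  induction n with
  | zero => rw [pow_zero]; exact suppIn_one B.zero_mem
  | succ n ih => rw [pow_succ]; exact ih.mul_submonoid hf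

lemma SuppIn.prod {κ : Type*} {B : AddSubmonoid ((ι →₀ ℕ) × ℤ)} {s : Finset κ}
    {f : κ → MvPowerSeries ι (LaurentSeries ℤ)} (hf : ∀ i ∈ s, SuppIn B (f i)) :
    SuppIn B (∏ i ∈ s, f i) := by
  classical
  induction s using Finset.induction_on with
  | empty => rw [Finset.prod_empty]; exact suppIn_one B.zero_mem
  | insert a s ha ih =>
    rw [Finset.prod_insert ha]
    exact (hf a (by simp)).mul_submonoid (ih fun i hi => hf i (by simp [hi]))

/-- Multiplying by a product of factors that are congruent to `1` does not change a series modulo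
an ideal of exponents. -/
lemma SuppIn.mul_prod_sub {κ : Type*} {B : AddSubmonoid ((ι →₀ ℕ) × ℤ)}
    {T : Set ((ι →₀ ℕ) × ℤ)} (hT : ∀ t ∈ T, ∀ b ∈ B, t + b ∈ T) {s : Finset κ}
    {f : κ → MvPowerSeries ι (LaurentSeries ℤ)} (hf : ∀ i ∈ s, SuppIn T (f i - 1))
    {g : MvPowerSeries ι (LaurentSeries ℤ)} (hg : SuppIn B g) (hfB : ∀ i ∈ s, SuppIn B (f i)) :
    SuppIn T (g * ∏ i ∈ s, f i - g) := by
  classical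
  induction s using Finset.induction_on generalizing g with
  | empty => rw [Finset.prod_empty, mul_one, sub_self]; exact suppIn_zero
  | insert a s ha ih =>
    have h1 := hf a (by simp)
    have h2 : SuppIn B (g * f a) := hg.mul_submonoid (hfB a (by simp))
    have h3 := ih (fun i hi => hf i (by simp [hi])) h2 (fun i hi => hfB i (by simp [hi]))
    have h4 : g * ∏ i ∈ insert a s, f i - g =
        (g * f a * ∏ i ∈ s, f i - g * f a) + (f a - 1) * g := by
      rw [Finset.prod_insert ha]; ring
    rw [h4]
    exact h3.add (h1.mul hg hT)

lemma SuppIn.coeff_eq {T : Set ((ι →₀ ℕ) × ℤ)} {f g : MvPowerSeries ι (LaurentSeries ℤ)}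
    (h : SuppIn T (f - g)) {d : ι →₀ ℕ} {k : ℤ} (hd : (d, k) ∉ T) :
    (MvPowerSeries.coeff d f).coeff k = (MvPowerSeries.coeff d g).coeff k := by
  have := h.coeff_eq_zero hd
  rwa [map_sub, HahnSeries.coeff_sub, sub_eq_zero] at this

/-! ### The factors -/

/-- The nonnegative multiples of an exponent. -/
def rayOf (d : ι →₀ ℕ) (n : ℤ) : AddSubmonoid ((ι →₀ ℕ) × ℤ) := AddSubmonoid.multiples (d, n)

lemma mem_rayOf {d e : ι →₀ ℕ} {n k : ℤ} :
    (e, k) ∈ rayOf d n ↔ ∃ j : ℕ, e = j • d ∧ k = j * n := by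
  rw [rayOf, AddSubmonoid.mem_multiples_iff]
  simp only [Prod.ext_iff, Prod.smul_fst, Prod.smul_snd, nsmul_eq_mul]
  exact exists_congr fun j => and_congr eq_comm eq_comm

lemma factor_suppIn (d : ι →₀ ℕ) (n : ℤ) : SuppIn (rayOf d n) (factor d n) :=
  (suppIn_one (rayOf d n).zero_mem).sub ((suppIn_monomial d n 1).mono
    (Set.singleton_subset_iff.2 (AddSubmonoid.mem_multiples _)))

lemma constantCoeff_factor {d : ι →₀ ℕ} (hd : d ≠ 0) (n : ℤ) :
    MvPowerSeries.constantCoeff (factor d n) = ((1 : (LaurentSeries ℤ)ˣ) : LaurentSeries ℤ) := by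
  rw [factor, map_sub, map_one, ← MvPowerSeries.coeff_zero_eq_constantCoeff_apply,
    MvPowerSeries.coeff_monomial_ne hd.symm, sub_zero, Units.val_one]

lemma factor_mul_inv {d : ι →₀ ℕ} (hd : d ≠ 0) (n : ℤ) :
    factor d n * MvPowerSeries.invOfUnit (factor d n) 1 = 1 :=
  MvPowerSeries.mul_invOfUnit _ _ (constantCoeff_factor hd n)

/-- The inverse satisfies `g = 1 + q^n e^{-d} g`; induction on the degree moves each exponent down
the ray. -/
lemma factor_inv_suppIn {d : ι →₀ ℕ} (hd : d ≠ 0) (n : ℤ) :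
    SuppIn (rayOf d n) (MvPowerSeries.invOfUnit (factor d n) 1) := by
  classical
  set g := MvPowerSeries.invOfUnit (factor d n) 1 with hg
  have h1 : g = 1 + MvPowerSeries.monomial d (qPow n : LaurentSeries ℤ) * g := by
    have := factor_mul_inv hd n
    rw [← hg, show factor d n = 1 - MvPowerSeries.monomial d (qPow n : LaurentSeries ℤ) from rfl,
      sub_mul, one_mul] at this
    rw [← this]; ring
  suffices ∀ N e k, Finsupp.degree e = N → (MvPowerSeries.coeff e g).coeff k ≠ 0 →
      (e, k) ∈ rayOf d n from fun e k h => this _ e k rfl h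
  intro N
  induction N using Nat.strong_induction_on with
  | _ N ih =>
  intro e k he h
  rw [h1, map_add, HahnSeries.coeff_add, MvPowerSeries.coeff_monomial_mul] at h
  by_cases h2 : (MvPowerSeries.coeff e (1 : MvPowerSeries ι (LaurentSeries ℤ))).coeff k = 0
  · rw [h2, zero_add] at h
    split_ifs at h with hde
    · obtain ⟨c, rfl⟩ := exists_add_of_le hde
      rw [add_tsub_cancel_left] at h
      have h3 : (MvPowerSeries.coeff c g).coeff (k - n) ≠ 0 := by
        rw [← sub_add_cancel k n, add_comm] at h
        change ((HahnSeries.single n (1 : ℤ)) * MvPowerSeries.coeff c g).coeff _ ≠ 0 at h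
        rwa [add_comm n, HahnSeries.coeff_single_mul_add, one_mul] at h
      have hdeg : Finsupp.degree d ≠ 0 := by rwa [Ne, Finsupp.degree_eq_zero_iff]
      have h4 := ih (Finsupp.degree c) (by rw [← he, map_add]; omega) c (k - n) rfl h3
      have h5 := (rayOf d n).add_mem (AddSubmonoid.mem_multiples (d, n)) h4
      rwa [Prod.mk_add_mk, add_sub_cancel] at h5
    · exact absurd rfl h
  · exact suppIn_one (rayOf d n).zero_mem e k h2

lemma factorPow_suppIn {d : ι →₀ ℕ} (hd : d ≠ 0) (n m : ℤ) :
    SuppIn (rayOf d n) (factorPow d n m) :=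
  ((factor_suppIn d n).pow _).mul_submonoid ((factor_inv_suppIn hd n).pow _)

@[simp] lemma factorPow_zero (d : ι →₀ ℕ) (n : ℤ) : factorPow d n 0 = 1 := by simp [factorPow]

lemma factorPow_one (d : ι →₀ ℕ) (n : ℤ) : factorPow d n 1 = factor d n := by simp [factorPow]

lemma factorPow_suppIn_submonoid {B : AddSubmonoid ((ι →₀ ℕ) × ℤ)} {d : ι →₀ ℕ} (hd : d ≠ 0)
    {n m : ℤ} (h : m ≠ 0 → (d, n) ∈ B) : SuppIn B (factorPow d n m) := by
  by_cases hm : m = 0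
  · rw [hm, factorPow_zero]
    exact suppIn_one B.zero_mem
  · refine (factorPow_suppIn hd n m).mono ?_
    rw [rayOf, SetLike.coe_subset_coe, AddSubmonoid.multiples_le]
    exact h hm

/-- `f = 1 + (terms of exponent not < d)`. -/
def IsOneBelow (d : ι →₀ ℕ) (f : MvPowerSeries ι (LaurentSeries ℤ)) : Prop :=
  MvPowerSeries.coeff 0 f = 1 ∧ ∀ e, e ≤ d → e ≠ 0 → e ≠ d → MvPowerSeries.coeff e f = 0

/-- All mixed terms of the convolution vanish, so at `d` multiplication becomes addition. This
linearization is what lets exponents be read off from coefficients. -/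
lemma coeff_mul_of_isOneBelow {d : ι →₀ ℕ} (hd : d ≠ 0) {f g : MvPowerSeries ι (LaurentSeries ℤ)}
    (hf : MvPowerSeries.coeff 0 f = 1) (hg : IsOneBelow d g) :
    MvPowerSeries.coeff d (f * g) = MvPowerSeries.coeff d f + MvPowerSeries.coeff d g := by
  classical
  rw [MvPowerSeries.coeff_mul, Finset.sum_eq_add (a := (d, 0)) (b := (0, d))]
  · rw [hg.1, hf, mul_one, one_mul]
  · intro h
    exact hd (Prod.ext_iff.1 h).1
  · rintro ⟨a, b⟩ hab ⟨h1, h2⟩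
    rw [Finset.HasAntidiagonal.mem_antidiagonal] at hab
    have hb0 : b ≠ 0 := by
      rintro rfl
      exact h1 (by rw [← hab, add_zero])
    have hbd : b ≠ d := by
      rintro rfl
      exact h2 (Prod.ext (add_eq_right.1 hab) rfl)
    rw [hg.2 b (hab ▸ le_add_self) hb0 hbd, mul_zero]
  · intro h
    simp at h
  · intro h
    simp at h

lemma IsOneBelow.mul {d : ι →₀ ℕ} {f g : MvPowerSeries ι (LaurentSeries ℤ)}
    (hf : IsOneBelow d f) (hg : IsOneBelow d g) : IsOneBelow d (f * g) := by
  classical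
  refine ⟨?_, fun e hed he0 hed' => ?_⟩
  · rw [MvPowerSeries.coeff_mul]
    simp [hf.1, hg.1]
  · rw [coeff_mul_of_isOneBelow he0 hf.1 ⟨hg.1, fun c hc hc0 _ => ?_⟩, hf.2 e hed he0 hed',
      hg.2 e hed he0 hed', add_zero]
    refine hg.2 c (hc.trans hed) hc0 ?_
    rintro rfl
    exact hed' (le_antisymm hed hc)

lemma IsOneBelow.one (d : ι →₀ ℕ) : IsOneBelow d (1 : MvPowerSeries ι (LaurentSeries ℤ)) := by
  classical
  refine ⟨MvPowerSeries.coeff_zero_one, fun e _ he _ => ?_⟩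
  rw [MvPowerSeries.coeff_one, if_neg he]

lemma IsOneBelow.pow {d : ι →₀ ℕ} (hd : d ≠ 0) {f : MvPowerSeries ι (LaurentSeries ℤ)}
    (hf : IsOneBelow d f) (n : ℕ) : IsOneBelow d (f ^ n) ∧
      MvPowerSeries.coeff d (f ^ n) = n • MvPowerSeries.coeff d f := by
  classical
  induction n with
  | zero =>
    rw [pow_zero]
    exact ⟨.one d, by rw [MvPowerSeries.coeff_one, if_neg hd, zero_smul]⟩
  | succ n ih =>
    rw [pow_succ]
    exact ⟨ih.1.mul hf, by rw [coeff_mul_of_isOneBelow hd ih.1.1 hf, ih.2, succ_nsmul]⟩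

lemma factor_isOneBelow {d : ι →₀ ℕ} (hd : d ≠ 0) (n : ℤ) : IsOneBelow d (factor d n) ∧
    MvPowerSeries.coeff d (factor d n) = -(HahnSeries.single n 1) := by
  classical
  refine ⟨⟨?_, fun e _ he0 hed => ?_⟩, ?_⟩
  · rw [MvPowerSeries.coeff_zero_eq_constantCoeff_apply, constantCoeff_factor hd, Units.val_one]
  · rw [factor, map_sub, MvPowerSeries.coeff_monomial_ne hed, MvPowerSeries.coeff_one,
      if_neg he0, sub_zero]
  · rw [factor, map_sub, MvPowerSeries.coeff_monomial_same, MvPowerSeries.coeff_one,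
      if_neg hd, zero_sub]
    rfl

/-- The linear term of the binomial expansion for either sign of `m`: the two natural powers
contribute `-m.toNat` and `(-m).toNat`, which add to `-m`. -/
lemma factorPow_isOneBelow {d : ι →₀ ℕ} (hd : d ≠ 0) (n m : ℤ) : IsOneBelow d (factorPow d n m) ∧
    MvPowerSeries.coeff d (factorPow d n m) = -(HahnSeries.single n m) := by
  classical
  set g := MvPowerSeries.invOfUnit (factor d n) 1 with hg
  have hf := factor_isOneBelow hd n
  have hg1 : IsOneBelow d g := by
    refine ⟨?_, fun e hed he0 hed' => ?_⟩
    · rw [MvPowerSeries.coeff_zero_eq_constantCoeff_apply, hg,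
        MvPowerSeries.constantCoeff_invOfUnit, inv_one, Units.val_one]
    · ext k
      by_contra h
      obtain ⟨j, rfl, -⟩ := mem_rayOf.1 (factor_inv_suppIn hd n e k h)
      obtain rfl | rfl | hj : j = 0 ∨ j = 1 ∨ 2 ≤ j := by omega
      · exact he0 (zero_smul _ _)
      · exact hed' (one_smul _ _)
      · obtain ⟨i, hi⟩ := Finsupp.ne_iff.1 hd
        rw [Finsupp.coe_zero, Pi.zero_apply] at hi
        have := hed i
        rw [Finsupp.smul_apply, smul_eq_mul] at this
        have : 0 < d i := Nat.pos_of_ne_zero hi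
        nlinarith
  have hgd : MvPowerSeries.coeff d g = HahnSeries.single n 1 := by
    have h1 := coeff_mul_of_isOneBelow hd hf.1.1 hg1
    rw [hg, factor_mul_inv hd, MvPowerSeries.coeff_one, if_neg hd, hf.2, ← hg] at h1
    exact (neg_add_eq_zero.1 h1.symm).symm
  have h2 := hf.1.pow hd m.toNat
  have h3 := hg1.pow hd (-m).toNat
  refine ⟨h2.1.mul h3.1, ?_⟩
  rw [factorPow, coeff_mul_of_isOneBelow hd h2.1.1 h3.1, h2.2, h3.2, hf.2, hgd]
  ext k
  simp only [HahnSeries.coeff_add, HahnSeries.coeff_smul, HahnSeries.coeff_neg,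
    HahnSeries.coeff_single]
  split_ifs
  · simp only [nsmul_eq_mul]
    omega
  · simp

/-! ### Finite products -/

/-- The finite product `∏_{(d, n) ∈ S} (1 - q^n e^{-d})^{m(d, n)}`. -/
def finProd (m : (ι →₀ ℕ) → ℤ → ℤ) (S : Finset ({d : ι →₀ ℕ // d ≠ 0} × ℤ)) :
    MvPowerSeries ι (LaurentSeries ℤ) := ∏ p ∈ S, factorPow p.1.1 p.2 (m p.1.1 p.2)

lemma finProd_suppIn {m : (ι →₀ ℕ) → ℤ → ℤ} {S : Finset ({d : ι →₀ ℕ // d ≠ 0} × ℤ)}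
    {B : AddSubmonoid ((ι →₀ ℕ) × ℤ)}
    (h : ∀ p ∈ S, m p.1.1 p.2 ≠ 0 → (p.1.1, p.2) ∈ B) : SuppIn B (finProd m S) :=
  SuppIn.prod fun p hp => factorPow_suppIn_submonoid p.1.2 (h p hp)

lemma coeff_zero_finProd (m : (ι →₀ ℕ) → ℤ → ℤ) (S : Finset ({d : ι →₀ ℕ // d ≠ 0} × ℤ)) :
    MvPowerSeries.coeff 0 (finProd m S) = 1 := by
  rw [MvPowerSeries.coeff_zero_eq_constantCoeff_apply, finProd, map_prod]
  refine Finset.prod_eq_one fun p _ => ?_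
  rw [← MvPowerSeries.coeff_zero_eq_constantCoeff_apply, (factorPow_isOneBelow p.1.2 _ _).1.1]

/-- Every nonconstant term has exponent `(d, n)` plus a further multiple of it, and the ideal `T`
absorbs the latter. -/
lemma factorPow_sub_one_suppIn {T : Set ((ι →₀ ℕ) × ℤ)} {B : AddSubmonoid ((ι →₀ ℕ) × ℤ)}
    (hT : ∀ t ∈ T, ∀ b ∈ B, t + b ∈ T) {d : ι →₀ ℕ} (hd : d ≠ 0) {n m : ℤ}
    (hB : m ≠ 0 → (d, n) ∈ B) (hm : m ≠ 0 → (d, n) ∈ T) : SuppIn T (factorPow d n m - 1) := by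
  by_cases h0 : m = 0
  · rw [h0, factorPow_zero, sub_self]
    exact suppIn_zero
  intro e k h
  obtain ⟨j, rfl, rfl⟩ := mem_rayOf.1
    (((factorPow_suppIn hd n m).sub (suppIn_one (rayOf d n).zero_mem)) e k h)
  cases j with
  | zero =>
    rw [map_sub, zero_smul, (factorPow_isOneBelow hd n m).1.1, MvPowerSeries.coeff_zero_one,
      sub_self] at h
    exact absurd rfl h
  | succ j =>
    have h1 := hT _ (hm h0) _ (B.nsmul_mem (hB h0) j)
    convert h1 using 1
    rw [Prod.smul_mk, Prod.mk_add_mk, succ_nsmul, add_comm d, nsmul_eq_mul]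
    congr 1
    push_cast
    ring

/-- Factors with exponents in an ideal `T` do not affect the coefficients outside of `T`. -/
lemma coeff_finProd_eq_of_subset {m : (ι →₀ ℕ) → ℤ → ℤ}
    {S S' : Finset ({d : ι →₀ ℕ // d ≠ 0} × ℤ)} {T : Set ((ι →₀ ℕ) × ℤ)}
    {B : AddSubmonoid ((ι →₀ ℕ) × ℤ)} (hT : ∀ t ∈ T, ∀ b ∈ B, t + b ∈ T)
    (hB : ∀ p ∈ S', m p.1.1 p.2 ≠ 0 → (p.1.1, p.2) ∈ B) (hSS : S ⊆ S')
    (hS : ∀ p ∈ S', p ∉ S → m p.1.1 p.2 ≠ 0 → (p.1.1, p.2) ∈ T)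
    {d : ι →₀ ℕ} {k : ℤ} (hd : (d, k) ∉ T) :
    (MvPowerSeries.coeff d (finProd m S')).coeff k =
      (MvPowerSeries.coeff d (finProd m S)).coeff k := by
  classical
  refine SuppIn.coeff_eq (T := T) ?_ hd
  have h1 : finProd m S' =
      finProd m S * ∏ p ∈ S' \ S, factorPow p.1.1 p.2 (m p.1.1 p.2) := by
    rw [finProd, finProd, mul_comm, Finset.prod_sdiff hSS]
  rw [h1]
  refine SuppIn.mul_prod_sub hT (fun p hp => ?_) (finProd_suppIn fun p hp => hB p (hSS hp))
    fun p hp => ?_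
  · rw [Finset.mem_sdiff] at hp
    exact factorPow_sub_one_suppIn hT p.1.2 (hB p hp.1) (hS p hp.1 hp.2)
  · rw [Finset.mem_sdiff] at hp
    exact factorPow_suppIn_submonoid p.1.2 (hB p hp.1)

open Classical in
/-- Only the factors with exponent `≤ d` affect the coefficient at `d`. -/
lemma coeff_finProd_filter_le (m : (ι →₀ ℕ) → ℤ → ℤ) (S : Finset ({d : ι →₀ ℕ // d ≠ 0} × ℤ))
    (d : ι →₀ ℕ) : MvPowerSeries.coeff d (finProd m (S.filter fun p => p.1.1 ≤ d)) =
      MvPowerSeries.coeff d (finProd m S) := by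
  ext k
  refine (coeff_finProd_eq_of_subset (T := {p | ¬ p.1 ≤ d}) (B := ⊤) (fun t ht b _ h => ?_)
    (fun _ _ _ => trivial) (Finset.filter_subset _ _) (fun p hp hp' _ h => ?_) ?_).symm
  · exact ht (le_self_add.trans h)
  · exact hp' (Finset.mem_filter.2 ⟨hp, h⟩)
  · simp

-- Among the factors that matter at `d`, those at exponent `d` itself enter linearly and those
-- strictly below enter through their own product. This triangular shape underlies both existence
-- and uniqueness of product expansions.
open Classical in
lemma coeff_finProd_eq_sub {m : (ι →₀ ℕ) → ℤ → ℤ} (S : Finset ({d : ι →₀ ℕ // d ≠ 0} × ℤ))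
    {d : ι →₀ ℕ} (hd : d ≠ 0) (k : ℤ) : (MvPowerSeries.coeff d (finProd m S)).coeff k =
      (MvPowerSeries.coeff d (finProd m (S.filter fun p => p.1.1 < d))).coeff k -
        if (⟨d, hd⟩, k) ∈ S then m d k else 0 := by
  rw [← coeff_finProd_filter_le]
  set S₁ := S.filter fun p => p.1.1 ≤ d
  have key : ∀ S' : Finset ({d : ι →₀ ℕ // d ≠ 0} × ℤ), (∀ p ∈ S', p.1.1 = d) →
      IsOneBelow d (finProd m S') ∧ (MvPowerSeries.coeff d (finProd m S')).coeff k =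
        - if (⟨d, hd⟩, k) ∈ S' then m d k else 0 := by
    intro S'
    induction S' using Finset.induction_on with
    | empty =>
      intro _
      refine ⟨IsOneBelow.one d, ?_⟩
      rw [finProd, Finset.prod_empty, MvPowerSeries.coeff_one, if_neg hd]
      simp
    | insert p S' hp ih =>
      intro h
      obtain ⟨h1, h2⟩ := ih fun p' hp' => h p' (by simp [hp'])
      obtain ⟨⟨d', hd'⟩, n⟩ := p
      obtain rfl : d' = d := h _ (Finset.mem_insert_self _ _)
      have h3 := factorPow_isOneBelow hd n (m d' n)
      have h4 : finProd m (insert (⟨d', hd'⟩, n) S') = finProd m S' * factorPow d' n (m d' n) := by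
        rw [finProd, Finset.prod_insert hp, mul_comm]; rfl
      rw [h4]
      refine ⟨h1.mul h3.1, ?_⟩
      rw [coeff_mul_of_isOneBelow hd h1.1 h3.1, HahnSeries.coeff_add, h2, h3.2,
        HahnSeries.coeff_neg, HahnSeries.coeff_single]
      by_cases hk : k = n
      · subst hk
        rw [if_neg hp, if_pos rfl, if_pos (Finset.mem_insert_self _ _)]
        simp
      · rw [if_neg hk, neg_zero, add_zero]
        congr 2
        simp [hk]
  have h1 : finProd m S₁ = finProd m (S.filter fun p => p.1.1 < d) *
      finProd m (S.filter fun p => p.1.1 = d) := by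
    rw [finProd, finProd, finProd, ← Finset.prod_union]
    · refine Finset.prod_congr ?_ fun _ _ => rfl
      ext p
      simp only [S₁, Finset.mem_filter, Finset.mem_union, le_iff_lt_or_eq, and_or_left]
    · rw [Finset.disjoint_filter]
      exact fun p _ h => h.ne
  obtain ⟨h2, h3⟩ := key (S.filter fun p => p.1.1 = d) fun p hp => (Finset.mem_filter.1 hp).2
  rw [h1, coeff_mul_of_isOneBelow hd (coeff_zero_finProd _ _) h2, HahnSeries.coeff_add, h3]
  simp [sub_eq_add_neg]

end FormalProducts

end KacMoody

end

/-! ### Infinite products: convergence, uniqueness of exponents, and transport along reflections. -/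

noncomputable section

namespace KacMoody

section Expansions

variable {ι : Type*}

/-! ### Convergence of the products -/

/-- The exponents `(d, k)` with `k ≥ -|d|`. -/
def boundedBelow (ι : Type*) : AddSubmonoid ((ι →₀ ℕ) × ℤ) where
  carrier := {p | -(p.1.degree : ℤ) ≤ p.2}
  zero_mem' := by simp
  add_mem' := by
    rintro ⟨a, k⟩ ⟨b, l⟩ h1 h2
    simp only [Set.mem_ofPred_eq, Prod.mk_add_mk, map_add, Nat.cast_add] at *
    omega

lemma mem_boundedBelow {d : ι →₀ ℕ} {k : ℤ} :
    (d, k) ∈ boundedBelow ι ↔ -(d.degree : ℤ) ≤ k := Iff.rfl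

/-- Exponent functions supported on the exponents with `n ≥ -|d|`. -/
def IsAdmissible (m : (ι →₀ ℕ) → ℤ → ℤ) : Prop := ∀ d n, m d n ≠ 0 → (d, n) ∈ boundedBelow ι

/-- The ideal of the exponents that cannot contribute to the coefficient at `(d, k)`. -/
def beyond (d : ι →₀ ℕ) (k : ℤ) : Set ((ι →₀ ℕ) × ℤ) :=
  {p | ¬ (p.1 ≤ d ∧ p.2 + p.1.degree ≤ k + d.degree)}

/-- The quantity `k + |d|` is nonnegative on `boundedBelow`, so adding an admissible exponent lowers
neither `d` nor `k + |d|`. This compensates for the factors with negative powers of `q` and leaves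
finitely many factors relevant to each coefficient. -/
lemma add_mem_beyond (d : ι →₀ ℕ) (k : ℤ) :
    ∀ t ∈ beyond d k, ∀ b ∈ (boundedBelow ι : Set ((ι →₀ ℕ) × ℤ)), t + b ∈ beyond d k := by
  rintro ⟨a, l⟩ ht ⟨b, l'⟩ hb ⟨h1, h2⟩
  refine ht ⟨le_self_add.trans h1, ?_⟩
  simp only [SetLike.mem_coe, mem_boundedBelow, Prod.mk_add_mk, map_add, Nat.cast_add] at *
  omega

lemma notMem_beyond (d : ι →₀ ℕ) (k : ℤ) : (d, k) ∉ beyond d k := fun h => h ⟨le_rfl, le_rfl⟩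

lemma degree_le_degree {d e : ι →₀ ℕ} (h : d ≤ e) : d.degree ≤ e.degree := by
  obtain ⟨c, rfl⟩ := exists_add_of_le h
  rw [map_add]
  omega

open Classical in
/-- The finitely many factors that contribute to the coefficient at `(d, k)`. -/
def stage (d : ι →₀ ℕ) (k : ℤ) : Finset ({d : ι →₀ ℕ // d ≠ 0} × ℤ) :=
  (Finset.Iic d).subtype (· ≠ 0) ×ˢ Finset.Icc (-(d.degree : ℤ)) (k + d.degree)

lemma mem_stage {d : ι →₀ ℕ} {k : ℤ} {p : {d : ι →₀ ℕ // d ≠ 0} × ℤ} :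
    p ∈ stage d k ↔ p.1.1 ≤ d ∧ -(d.degree : ℤ) ≤ p.2 ∧ p.2 ≤ k + d.degree := by
  simp [stage]

lemma stage_subset {d e : ι →₀ ℕ} {k l : ℤ} (h : (e, l) ∉ beyond d k) : stage e l ⊆ stage d k := by
  intro p hp
  simp only [beyond, Set.mem_ofPred_eq, not_not] at h
  have := degree_le_degree h.1
  rw [mem_stage] at hp ⊢
  exact ⟨hp.1.trans h.1, by omega, by omega⟩

lemma IsAdmissible.mem_beyond {m : (ι →₀ ℕ) → ℤ → ℤ} (hm : IsAdmissible m) {d : ι →₀ ℕ} {k : ℤ}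
    {p : {d : ι →₀ ℕ // d ≠ 0} × ℤ} (hp : p ∉ stage d k) (h : m p.1.1 p.2 ≠ 0) :
    (p.1.1, p.2) ∈ beyond d k := by
  rintro ⟨h1, h2⟩
  have h3 : p.1.1.degree ≤ d.degree := degree_le_degree h1
  have h4 : -(p.1.1.degree : ℤ) ≤ p.2 := hm _ _ h
  simp only at h2
  exact hp (mem_stage.2 ⟨h1, by omega, by omega⟩)

lemma IsAdmissible.coeff_finProd_eq {m : (ι →₀ ℕ) → ℤ → ℤ} (hm : IsAdmissible m) {d : ι →₀ ℕ}
    {k : ℤ} {S S' : Finset ({d : ι →₀ ℕ // d ≠ 0} × ℤ)} (hSS : S ⊆ S')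
    (hS : ∀ p ∈ S', p ∉ S → p ∉ stage d k) :
    (MvPowerSeries.coeff d (finProd m S')).coeff k =
      (MvPowerSeries.coeff d (finProd m S)).coeff k :=
  coeff_finProd_eq_of_subset (add_mem_beyond d k) (fun _ _ h => hm _ _ h) hSS
    (fun p hp hp' h => hm.mem_beyond (hS p hp hp') h) (notMem_beyond d k)

/-- `F` is the infinite product `∏ (1 - q^n e^{-d})^{m(d, n)}`. -/
def Expands (m : (ι →₀ ℕ) → ℤ → ℤ) (F : MvPowerSeries ι (LaurentSeries ℤ)) : Prop :=
  ∀ (d : ι →₀ ℕ) (k : ℤ), ∀ᶠ S in atTop,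
    (MvPowerSeries.coeff d (finProd m S)).coeff k = (MvPowerSeries.coeff d F).coeff k

lemma finProd_congr {m m' : (ι →₀ ℕ) → ℤ → ℤ} {S : Finset ({d : ι →₀ ℕ // d ≠ 0} × ℤ)}
    (h : ∀ p ∈ S, m p.1.1 p.2 = m' p.1.1 p.2) : finProd m S = finProd m' S :=
  Finset.prod_congr rfl fun p hp => by rw [h p hp]

section

variable {m m' : (ι →₀ ℕ) → ℤ → ℤ} {F F' : MvPowerSeries ι (LaurentSeries ℤ)}

lemma Expands.unique (h : Expands m F) (h' : Expands m F') : F = F' := by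
  ext d k
  obtain ⟨S, h1, h2⟩ := ((h d k).and (h' d k)).exists
  rw [← h1, h2]

lemma Expands.coeff_eq (h : Expands m F) (hm : IsAdmissible m) {d : ι →₀ ℕ} {k : ℤ}
    {S : Finset ({d : ι →₀ ℕ // d ≠ 0} × ℤ)} (hS : stage d k ⊆ S) :
    (MvPowerSeries.coeff d F).coeff k = (MvPowerSeries.coeff d (finProd m S)).coeff k := by
  classical
  obtain ⟨S', h1, h2⟩ := ((h d k).and (eventually_ge_atTop S)).exists
  rw [← h1]
  exact hm.coeff_finProd_eq h2 fun p _ hp h => hp (hS h)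

lemma expands_of_coeff_eq (h : ∀ d k S, stage d k ⊆ S → (MvPowerSeries.coeff d F).coeff k =
    (MvPowerSeries.coeff d (finProd m S)).coeff k) : Expands m F := fun d k => by
  filter_upwards [eventually_ge_atTop (stage d k)] with S hS
  exact (h d k S hS).symm

/-- Each coefficient is computed from its finite `stage`; the bound `k ≥ -|d|` makes the resulting
family of integers a Laurent series. -/
lemma IsAdmissible.exists_expands (hm : IsAdmissible m) : ∃ F, Expands m F := by
  have h0 : ∀ d k, (MvPowerSeries.coeff d (finProd m (stage d k))).coeff k ≠ 0 →
      (d, k) ∈ boundedBelow ι := fun d k h => finProd_suppIn (fun p _ => hm _ _) d k h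
  let F : MvPowerSeries ι (LaurentSeries ℤ) := fun d => HahnSeries.ofSuppBddBelow
    (fun k => (MvPowerSeries.coeff d (finProd m (stage d k))).coeff k)
    ⟨-(d.degree : ℤ), fun k hk => h0 d k hk⟩
  refine ⟨F, expands_of_coeff_eq fun d k S hS => ?_⟩
  rw [hm.coeff_finProd_eq hS fun p _ h => h]
  rfl

lemma Expands.suppIn (h : Expands m F) {B : AddSubmonoid ((ι →₀ ℕ) × ℤ)}
    (hB : ∀ d n, m d n ≠ 0 → (d, n) ∈ B) : SuppIn B F := by
  intro d k hdk
  obtain ⟨S, hS⟩ := (h d k).exists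
  rw [← hS] at hdk
  exact finProd_suppIn (fun p _ => hB _ _) d k hdk

lemma Expands.coeff_zero (h : Expands m F) : MvPowerSeries.coeff 0 F = 1 := by
  ext k
  obtain ⟨S, hS⟩ := (h 0 k).exists
  rw [← hS, coeff_zero_finProd]

lemma Expands.suppIn_sub (h : Expands m F) (hm : IsAdmissible m) {d : ι →₀ ℕ} {k : ℤ}
    {S : Finset ({d : ι →₀ ℕ // d ≠ 0} × ℤ)} (hS : stage d k ⊆ S) :
    SuppIn (beyond d k) (finProd m S - F) := by
  intro e l hel
  by_contra h'
  refine hel ?_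
  rw [map_sub, HahnSeries.coeff_sub, sub_eq_zero,
    h.coeff_eq hm ((stage_subset h').trans hS)]

lemma factorPow_add {d : ι →₀ ℕ} (hd : d ≠ 0) (n a b : ℤ) :
    factorPow d n (a + b) = factorPow d n a * factorPow d n b := by
  let u : (MvPowerSeries ι (LaurentSeries ℤ))ˣ := ⟨factor d n, _, factor_mul_inv hd n,
    by rw [mul_comm, factor_mul_inv hd n]⟩
  have key : ∀ a : ℤ, factorPow d n a = ((u ^ a : (MvPowerSeries ι (LaurentSeries ℤ))ˣ) :
      MvPowerSeries ι (LaurentSeries ℤ)) := by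
    intro a
    have : u ^ a = u ^ a.toNat * u⁻¹ ^ (-a).toNat := by
      conv_lhs => rw [← Int.toNat_sub_toNat_neg a]
      rw [zpow_sub, zpow_natCast, zpow_natCast, inv_pow]
    rw [this]
    rfl
  rw [key, key, key, zpow_add, Units.val_mul]

lemma finProd_add (S : Finset ({d : ι →₀ ℕ // d ≠ 0} × ℤ)) :
    finProd (m + m') S = finProd m S * finProd m' S := by
  rw [finProd, finProd, finProd, ← Finset.prod_mul_distrib]
  exact Finset.prod_congr rfl fun p _ => factorPow_add p.1.2 _ _ _

lemma Expands.add (h : Expands m F) (hm : IsAdmissible m) (h' : Expands m' F')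
    (hm' : IsAdmissible m') : Expands (m + m') (F * F') := by
  refine expands_of_coeff_eq fun d k S hS => ?_
  refine (SuppIn.coeff_eq (T := beyond d k) ?_ (notMem_beyond d k)).symm
  have h1 : finProd (m + m') S - F * F' =
      (finProd m S - F) * finProd m' S + (finProd m' S - F') * F := by
    rw [finProd_add]; ring
  rw [h1]
  exact ((h.suppIn_sub hm hS).mul (finProd_suppIn fun p _ => hm' _ _) (add_mem_beyond d k)).add
    ((h'.suppIn_sub hm' hS).mul (h.suppIn hm) (add_mem_beyond d k))

lemma Expands.coeff_congr (h : Expands m F) (h' : Expands m' F') {d : ι →₀ ℕ}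
    (hmm : ∀ e ≤ d, m e = m' e) : MvPowerSeries.coeff d F = MvPowerSeries.coeff d F' := by
  classical
  ext k
  obtain ⟨S, h1, h2⟩ := ((h d k).and (h' d k)).exists
  rw [← h1, ← h2, ← coeff_finProd_filter_le, ← coeff_finProd_filter_le m']
  congr 2
  refine Finset.prod_congr rfl fun p hp => ?_
  rw [hmm _ (Finset.mem_filter.1 hp).2]

-- The triangular formula solved for the exponent at `d`. If `(d, k)` is outside the stage, then `m
-- d k = 0` by admissibility, so no case distinction survives.
open Classical in
lemma Expands.apply_eq (h : Expands m F) (hm : IsAdmissible m) {d : ι →₀ ℕ} (hd : d ≠ 0) (k : ℤ) :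
    m d k = (MvPowerSeries.coeff d (finProd m ((stage d k).filter fun p => p.1.1 < d))).coeff k -
      (MvPowerSeries.coeff d F).coeff k := by
  have h0 := coeff_finProd_eq_sub (m := m) (stage d k) hd k
  rw [h.coeff_eq hm subset_rfl, h0, sub_sub_cancel]
  split_ifs with h1
  · rfl
  · by_contra h2
    exact hm.mem_beyond h1 h2 ⟨le_rfl, le_rfl⟩

/-- The exponents of a product are determined by its expansion. -/
lemma Expands.exponent_eq (h : Expands m F) (hm : IsAdmissible m) (h' : Expands m' F')
    (hm' : IsAdmissible m') {d : ι →₀ ℕ} (hd : d ≠ 0)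
    (hF : ∀ e ≤ d, MvPowerSeries.coeff e F = MvPowerSeries.coeff e F') : m d = m' d := by
  classical
  induction d using WellFoundedLT.induction with
  | _ d ih =>
  ext k
  rw [h.apply_eq hm hd, h'.apply_eq hm' hd, hF d le_rfl]
  congr 3
  refine Finset.prod_congr rfl fun p hp => ?_
  have hp := (Finset.mem_filter.1 hp).2
  rw [ih _ hp p.1.2 fun e he => hF e (he.trans hp.le)]

/-- By induction on `d`, the finite product of the lower factors is supported in `B`; outside `B`
the recursion then returns zero. This passes positivity in `q` and stability from the series to its
exponents. -/
lemma Expands.mem_of_suppIn (h : Expands m F) (hm : IsAdmissible m)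
    {B : AddSubmonoid ((ι →₀ ℕ) × ℤ)} (hF : SuppIn B F) {d : ι →₀ ℕ} (hd : d ≠ 0) {k : ℤ}
    (hdk : m d k ≠ 0) : (d, k) ∈ B := by
  classical
  induction d using WellFoundedLT.induction generalizing k with
  | _ d ih =>
  by_contra hB
  refine hdk ?_
  rw [h.apply_eq hm hd, hF.coeff_eq_zero hB, sub_zero]
  refine (finProd_suppIn fun p hp hp' => ?_).coeff_eq_zero hB
  exact ih _ (Finset.mem_filter.1 hp).2 p.1.2 hp'

end

open Classical in
/-- The exponents of the product with expansion `F`, by recursion. -/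
def exponents (F : MvPowerSeries ι (LaurentSeries ℤ)) : (ι →₀ ℕ) → ℤ → ℤ :=
  WellFounded.fix (wellFounded_lt (α := ι →₀ ℕ)) fun d rec k => if d = 0 then 0 else
    (MvPowerSeries.coeff d (finProd (fun e n => if he : e < d then rec e he n else 0)
      ((stage d k).filter fun p => p.1.1 < d))).coeff k - (MvPowerSeries.coeff d F).coeff k

open Classical in
lemma exponents_eq (F : MvPowerSeries ι (LaurentSeries ℤ)) (d : ι →₀ ℕ) :
    exponents F d = fun k => if d = 0 then 0 else
      (MvPowerSeries.coeff d (finProd (fun e n => if e < d then exponents F e n else 0)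
        ((stage d k).filter fun p => p.1.1 < d))).coeff k - (MvPowerSeries.coeff d F).coeff k := by
  rw [exponents, WellFounded.fix_eq]
  rfl

lemma exponents_zero (F : MvPowerSeries ι (LaurentSeries ℤ)) : exponents F 0 = 0 := by
  ext k
  rw [exponents_eq]
  exact if_pos rfl

open Classical in
lemma exponents_apply (F : MvPowerSeries ι (LaurentSeries ℤ)) {d : ι →₀ ℕ} (hd : d ≠ 0) (k : ℤ) :
    exponents F d k = (MvPowerSeries.coeff d (finProd (exponents F)
      ((stage d k).filter fun p => p.1.1 < d))).coeff k - (MvPowerSeries.coeff d F).coeff k := by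
  rw [exponents_eq]
  simp only [if_neg hd]
  rw [finProd_congr (m' := exponents F) fun p hp => ?_]
  exact if_pos (Finset.mem_filter.1 hp).2

lemma isAdmissible_exponents {F : MvPowerSeries ι (LaurentSeries ℤ)}
    (hF : SuppIn (boundedBelow ι) F) : IsAdmissible (exponents F) := by
  classical
  intro d
  induction d using WellFoundedLT.induction with
  | _ d ih =>
  intro k hdk
  by_cases hd : d = 0
  · rw [hd, exponents_zero] at hdk
    exact absurd rfl hdk
  by_contra hB
  refine hdk ?_
  rw [exponents_apply F hd, hF.coeff_eq_zero hB, sub_zero]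
  exact (finProd_suppIn fun p hp hp' => ih _ (Finset.mem_filter.1 hp).2 _ hp').coeff_eq_zero hB

/-- Every power series with constant term `1` is an infinite product. -/
lemma expands_exponents {F : MvPowerSeries ι (LaurentSeries ℤ)}
    (hF : SuppIn (boundedBelow ι) F) (h0 : MvPowerSeries.coeff 0 F = 1) :
    Expands (exponents F) F := by
  classical
  have hm := isAdmissible_exponents hF
  refine expands_of_coeff_eq fun d k S hS => ?_
  by_cases hd : d = 0
  · rw [hd, coeff_zero_finProd, h0]
  rw [coeff_finProd_eq_sub S hd]
  have h1 : (if (⟨d, hd⟩, k) ∈ S then exponents F d k else 0) = exponents F d k := by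
    split_ifs with h1
    · rfl
    · by_contra h2
      exact hm.mem_beyond (p := (⟨d, hd⟩, k)) (fun h => h1 (hS h)) (Ne.symm h2) ⟨le_rfl, le_rfl⟩
  rw [h1, exponents_apply F hd, hm.coeff_finProd_eq (Finset.filter_subset_filter _ hS), sub_sub_cancel]
  intro p hp hp' h
  exact hp' (Finset.mem_filter.2 ⟨h, (Finset.mem_filter.1 hp).2⟩)

/-! ### Products with separated exponents -/

open Classical in
/-- If the exponents below `d₁ + d₂` that occur are below `d₁` or below `d₂`, where `d₁` and `d₂`
have disjoint supports, then the coefficient at `d₁ + d₂` is a product. -/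
lemma Expands.coeff_add_eq_mul {m m₁ m₂ : (ι →₀ ℕ) → ℤ → ℤ}
    {F F₁ F₂ : MvPowerSeries ι (LaurentSeries ℤ)} (h : Expands m F) (h₁ : Expands m₁ F₁)
    (h₂ : Expands m₂ F₂) (hm₁ : IsAdmissible m₁) (hm₂ : IsAdmissible m₂)
    {d₁ d₂ : ι →₀ ℕ} (hd : Disjoint d₁.support d₂.support)
    (hs : ∀ e ≤ d₁ + d₂, e ≠ 0 → m e ≠ 0 → e ≤ d₁ ∨ e ≤ d₂)
    (he₁ : ∀ e ≤ d₁, e ≠ 0 → m e = m₁ e) (he₂ : ∀ e ≤ d₂, e ≠ 0 → m e = m₂ e) :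
    MvPowerSeries.coeff (d₁ + d₂) F =
      MvPowerSeries.coeff d₁ F₁ * MvPowerSeries.coeff d₂ F₂ := by
  have hdis : ∀ e, e ≤ d₁ → e ≤ d₂ → e = 0 := by
    intro e h1 h2
    ext i
    by_contra hi
    have h1 := h1 i
    have h2 := h2 i
    rw [Finsupp.coe_zero, Pi.zero_apply] at hi
    exact Finset.disjoint_left.1 hd (Finsupp.mem_support_iff.2 (by omega : d₁ i ≠ 0))
      (Finsupp.mem_support_iff.2 (by omega))
  -- Truncating to exponents below `d` does not change the coefficient at `d`, and confines the
  -- product to the support of `d`.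
  let r (m : (ι →₀ ℕ) → ℤ → ℤ) (d : ι →₀ ℕ) : (ι →₀ ℕ) → ℤ → ℤ :=
    fun e => if e ≤ d ∧ e ≠ 0 then m e else 0
  have hr : ∀ {m} (d), IsAdmissible m → IsAdmissible (r m d) := by
    intro m d hm e n hen
    simp only [r] at hen
    split_ifs at hen
    · exact hm e n hen
    · exact absurd rfl hen
  -- The value of `m` at the zero exponent never enters a product, so it may be reset to zero before
  -- comparing exponent functions.
  have hr' : ∀ {m : (ι →₀ ℕ) → ℤ → ℤ} {F}, Expands m F →
      Expands (fun e => if e = 0 then 0 else m e) F := by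
    intro m F h d k
    filter_upwards [h d k] with S hS
    rw [← hS, finProd_congr (m' := m) fun p _ => ?_]
    simp only [if_neg p.1.2]
  obtain ⟨G₁, hG₁⟩ := (hr d₁ hm₁).exists_expands
  obtain ⟨G₂, hG₂⟩ := (hr d₂ hm₂).exists_expands
  have hG := hG₁.add (hr d₁ hm₁) hG₂ (hr d₂ hm₂)
  have hsup : ∀ {m G} d, Expands (r m d) G → ∀ e, ¬ e.support ⊆ d.support →
      MvPowerSeries.coeff e G = 0 := by
    intro m G d hG e he
    ext k
    refine (hG.suppIn (B := (Finsupp.supported ℕ ℕ (d.support : Set ι)).toAddSubmonoid.prod ⊤)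
      fun e n hen => ?_).coeff_eq_zero fun hek => he ?_
    · simp only [r] at hen
      split_ifs at hen with hed
      · refine ⟨?_, trivial⟩
        change e ∈ Finsupp.supported ℕ ℕ _
        rw [Finsupp.mem_supported, Finset.coe_subset]
        exact Finsupp.support_mono hed.1
      · exact absurd rfl hen
    · have h1 : e ∈ Finsupp.supported ℕ ℕ (d.support : Set ι) := hek.1
      rwa [Finsupp.mem_supported, Finset.coe_subset] at h1
  have e1 : MvPowerSeries.coeff (d₁ + d₂) F = MvPowerSeries.coeff (d₁ + d₂) (G₁ * G₂) := by
    refine (hr' h).coeff_congr hG fun e he => ?_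
    ext n
    simp only [r, Pi.add_apply]
    by_cases h0 : e = 0
    · simp [h0]
    by_cases h1 : e ≤ d₁
    · rw [if_neg h0, if_pos ⟨h1, h0⟩, if_neg fun h2 => h0 (hdis e h1 h2.1), he₁ e h1 h0]
      simp
    by_cases h2 : e ≤ d₂
    · rw [if_neg h0, if_neg fun h1' => h1 h1'.1, if_pos ⟨h2, h0⟩, he₂ e h2 h0]
      simp
    · rw [if_neg h0, if_neg fun h1' => h1 h1'.1, if_neg fun h2' => h2 h2'.1]
      by_contra h3
      refine (hs e he h0 fun h4 => h3 ?_).elim h1 h2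
      rw [h4]; simp
  have e2 : ∀ {m F d G}, Expands m F → Expands (r m d) G →
      MvPowerSeries.coeff d F = MvPowerSeries.coeff d G := by
    intro m F d G h hG
    refine (hr' h).coeff_congr hG fun e he => ?_
    simp only [r]
    by_cases h0 : e = 0
    · rw [if_pos h0, if_neg fun h => h.2 h0]
    · rw [if_neg h0, if_pos ⟨he, h0⟩]
  -- The truncated series live on disjoint sets of variables, so `(d₁, d₂)` is the only term of the
  -- convolution.
  rw [e1, e2 h₁ hG₁, e2 h₂ hG₂, MvPowerSeries.coeff_mul, Finset.sum_eq_single (d₁, d₂)]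
  · rintro ⟨a, b⟩ hab hne
    rw [Finset.HasAntidiagonal.mem_antidiagonal] at hab
    by_cases ha : a.support ⊆ d₁.support
    · by_cases hb : b.support ⊆ d₂.support
      · refine absurd ?_ hne
        have key : ∀ i, a i = d₁ i ∧ b i = d₂ i := by
          intro i
          have h1 := DFunLike.congr_fun hab i
          simp only [Finsupp.add_apply] at h1
          have h2 : a i ≠ 0 → d₁ i ≠ 0 := by
            simpa using @ha i
          have h3 : b i ≠ 0 → d₂ i ≠ 0 := by
            simpa using @hb i
          have h4 : d₁ i ≠ 0 → d₂ i = 0 := by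
            intro h4
            by_contra h5
            exact Finset.disjoint_left.1 hd (Finsupp.mem_support_iff.2 h4)
              (Finsupp.mem_support_iff.2 h5)
          omega
        exact Prod.ext (Finsupp.ext fun i => (key i).1) (Finsupp.ext fun i => (key i).2)
      · rw [hsup d₂ hG₂ b hb, mul_zero]
    · rw [hsup d₁ hG₁ a ha, zero_mul]
  · intro h
    simp at h

/-! ### Single factors -/

open Classical in
/-- The exponents of a single factor. -/
def singleExp (d : ι →₀ ℕ) (n a : ℤ) (e : ι →₀ ℕ) (k : ℤ) : ℤ := if e = d ∧ k = n then a else 0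

lemma isAdmissible_singleExp {d : ι →₀ ℕ} {n : ℤ} (h : (d, n) ∈ boundedBelow ι) (a : ℤ) :
    IsAdmissible (singleExp d n a) := by
  intro e k hek
  rw [singleExp] at hek
  split_ifs at hek with h1
  · rwa [h1.1, h1.2]
  · exact absurd rfl hek

lemma expands_singleExp {d : ι →₀ ℕ} (hd : d ≠ 0) (n a : ℤ) :
    Expands (singleExp d n a) (factorPow d n a) := by
  classical
  intro e k
  filter_upwards [eventually_ge_atTop {(⟨d, hd⟩, n)}] with S hS
  rw [finProd, Finset.prod_eq_single (⟨d, hd⟩, n)]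
  · rw [singleExp, if_pos ⟨rfl, rfl⟩]
  · intro p _ hp
    rw [singleExp, if_neg fun h => hp (Prod.ext (Subtype.ext h.1) h.2), factorPow_zero]
  · intro h
    exact absurd (hS (Finset.mem_singleton_self _)) h

/-! ### Transport of structure -/

/-- An involution of the exponents that is additive on a submonoid. -/
structure PartialReflection (σ : Equiv.Perm (ι →₀ ℕ)) (B : AddSubmonoid (ι →₀ ℕ)) : Prop where
  invol : ∀ d, σ (σ d) = d
  mem : ∀ d ∈ B, σ d ∈ B
  add : ∀ d ∈ B, ∀ e ∈ B, σ (d + e) = σ d + σ e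

open Classical in
/-- The series with the coefficients in `B` permuted by `σ` and the others removed. -/
def transport (σ : Equiv.Perm (ι →₀ ℕ)) (B : AddSubmonoid (ι →₀ ℕ))
    (f : MvPowerSeries ι (LaurentSeries ℤ)) : MvPowerSeries ι (LaurentSeries ℤ) :=
  fun d => if d ∈ B then MvPowerSeries.coeff (σ d) f else 0

open Classical in
lemma coeff_transport (σ : Equiv.Perm (ι →₀ ℕ)) (B : AddSubmonoid (ι →₀ ℕ))
    (f : MvPowerSeries ι (LaurentSeries ℤ)) (d : ι →₀ ℕ) :
    MvPowerSeries.coeff d (transport σ B f) =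
      if d ∈ B then MvPowerSeries.coeff (σ d) f else 0 := rfl

section

variable {σ : Equiv.Perm (ι →₀ ℕ)} {B : AddSubmonoid (ι →₀ ℕ)}

lemma PartialReflection.zero (h : PartialReflection σ B) : σ 0 = 0 := by
  have := h.add 0 B.zero_mem 0 B.zero_mem
  rw [add_zero] at this
  exact left_eq_add.1 this

lemma PartialReflection.ne_zero (h : PartialReflection σ B) {d : ι →₀ ℕ} (hd : d ≠ 0) :
    σ d ≠ 0 := fun h0 => hd (by rw [← h.invol d, h0, h.zero])

lemma SuppIn.coeff_eq_zero_of_notMem {f : MvPowerSeries ι (LaurentSeries ℤ)}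
    (hf : SuppIn (B.prod ⊤ : AddSubmonoid ((ι →₀ ℕ) × ℤ)) f) {d : ι →₀ ℕ} (hd : d ∉ B) :
    MvPowerSeries.coeff d f = 0 := by
  ext k
  exact hf.coeff_eq_zero fun h => hd h.1

lemma transport_one (h : PartialReflection σ B) : transport σ B 1 = 1 := by
  classical
  ext d : 1
  rw [coeff_transport, MvPowerSeries.coeff_one, MvPowerSeries.coeff_one]
  by_cases hd : d = 0
  · rw [hd, if_pos B.zero_mem, h.zero]
  · rw [if_neg hd, if_neg (h.ne_zero hd), ite_self]

/-- `σ` reindexes the antidiagonal. It is additive only on `B`, so both series must be supported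
there. -/
lemma transport_mul (h : PartialReflection σ B) {f g : MvPowerSeries ι (LaurentSeries ℤ)}
    (hf : SuppIn (B.prod ⊤ : AddSubmonoid ((ι →₀ ℕ) × ℤ)) f)
    (hg : SuppIn (B.prod ⊤ : AddSubmonoid ((ι →₀ ℕ) × ℤ)) g) :
    transport σ B (f * g) = transport σ B f * transport σ B g := by
  classical
  ext d : 1
  rw [coeff_transport, MvPowerSeries.coeff_mul, MvPowerSeries.coeff_mul]
  split_ifs with hd
  · refine (Finset.sum_bij_ne_zero (fun p _ _ => (σ p.1, σ p.2)) ?_ ?_ ?_ ?_).symm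
    · intro p hp hp'
      rw [Finset.HasAntidiagonal.mem_antidiagonal] at hp ⊢
      rw [coeff_transport, coeff_transport] at hp'
      split_ifs at hp' with h1 h2
      · rw [← hp, h.add _ h1 _ h2]
      · exact absurd (mul_zero _) hp'
      · exact absurd (zero_mul _) hp'
      · exact absurd (zero_mul _) hp'
    · intro p _ _ p' _ _ hpp
      rw [Prod.ext_iff] at hpp
      exact Prod.ext (σ.injective hpp.1) (σ.injective hpp.2)
    · intro p hp hp'
      have h1 : p.1 ∈ B := by
        by_contra h1
        rw [hf.coeff_eq_zero_of_notMem h1, zero_mul] at hp'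
        exact hp' rfl
      have h2 : p.2 ∈ B := by
        by_contra h2
        rw [hg.coeff_eq_zero_of_notMem h2, mul_zero] at hp'
        exact hp' rfl
      refine ⟨(σ p.1, σ p.2), ?_, ?_, ?_⟩
      · rw [Finset.HasAntidiagonal.mem_antidiagonal] at hp ⊢
        rw [← h.add _ h1 _ h2, hp, h.invol]
      · rw [coeff_transport, coeff_transport, if_pos (h.mem _ h1), if_pos (h.mem _ h2), h.invol,
          h.invol]
        exact hp'
      · rw [h.invol, h.invol]
    · intro p _ hp'
      rw [coeff_transport, coeff_transport] at hp' ⊢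
      split_ifs at hp' with h1 h2
      · rw [if_pos h1, if_pos h2]
      · exact absurd (mul_zero _) hp'
      · exact absurd (zero_mul _) hp'
      · exact absurd (zero_mul _) hp'
  · refine (Finset.sum_eq_zero fun p hp => ?_).symm
    rw [Finset.HasAntidiagonal.mem_antidiagonal] at hp
    by_cases h1 : p.1 ∈ B
    · rw [coeff_transport _ _ g, if_neg fun h2 => hd (hp ▸ B.add_mem h1 h2), mul_zero]
    · rw [coeff_transport, if_neg h1, zero_mul]

lemma rayOf_le_prod {d : ι →₀ ℕ} (hd : d ∈ B) (n : ℤ) :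
    (rayOf d n : Set ((ι →₀ ℕ) × ℤ)) ⊆ (B.prod ⊤ : AddSubmonoid ((ι →₀ ℕ) × ℤ)) := by
  rw [rayOf, SetLike.coe_subset_coe, AddSubmonoid.multiples_le]
  exact ⟨hd, trivial⟩

lemma transport_factor (h : PartialReflection σ B) {d : ι →₀ ℕ} (hd : d ∈ B) (n : ℤ) :
    transport σ B (factor d n) = factor (σ d) n := by
  classical
  ext e : 1
  rw [coeff_transport, factor, factor, map_sub, map_sub, MvPowerSeries.coeff_one,
    MvPowerSeries.coeff_one, MvPowerSeries.coeff_monomial, MvPowerSeries.coeff_monomial]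
  have h1 : σ e = 0 ↔ e = 0 := ⟨fun h' => by_contra fun h0 => h.ne_zero h0 h', fun h' => h' ▸ h.zero⟩
  have h2 : σ e = d ↔ e = σ d := ⟨fun h' => h' ▸ (h.invol e).symm, fun h' => h' ▸ h.invol d⟩
  simp only [h1, h2]
  by_cases h3 : e ∈ B
  · rw [if_pos h3]
  · have h4 : e ≠ 0 := fun h0 => h3 (h0 ▸ B.zero_mem)
    have h5 : e ≠ σ d := fun h0 => h3 (h0 ▸ h.mem d hd)
    rw [if_neg h3, if_neg h4, if_neg h5, sub_zero]

lemma transport_factorPow (h : PartialReflection σ B) {d : ι →₀ ℕ} (hd : d ∈ B) (hd0 : d ≠ 0)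
    (n m : ℤ) : transport σ B (factorPow d n m) = factorPow (σ d) n m := by
  have hf : SuppIn (B.prod ⊤ : AddSubmonoid ((ι →₀ ℕ) × ℤ)) (factor d n) :=
    (factor_suppIn d n).mono (rayOf_le_prod hd n)
  have hg : SuppIn (B.prod ⊤ : AddSubmonoid ((ι →₀ ℕ) × ℤ))
      (MvPowerSeries.invOfUnit (factor d n) 1) :=
    (factor_inv_suppIn hd0 n).mono (rayOf_le_prod hd n)
  have hpow : ∀ {f}, SuppIn (B.prod ⊤ : AddSubmonoid ((ι →₀ ℕ) × ℤ)) f → ∀ k : ℕ,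
      transport σ B (f ^ k) = transport σ B f ^ k := by
    intro f hf k
    induction k with
    | zero => rw [pow_zero, pow_zero, transport_one h]
    | succ k ih => rw [pow_succ, pow_succ, transport_mul h (hf.pow k) hf, ih]
  have hinv : transport σ B (MvPowerSeries.invOfUnit (factor d n) 1) =
      MvPowerSeries.invOfUnit (factor (σ d) n) 1 := by
    have h1 := factor_mul_inv (h.ne_zero hd0) n
    have h2 := transport_mul h hf hg
    rw [factor_mul_inv hd0, transport_one h, transport_factor h hd] at h2
    calc _ = transport σ B (MvPowerSeries.invOfUnit (factor d n) 1) *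
        (factor (σ d) n * MvPowerSeries.invOfUnit (factor (σ d) n) 1) := by rw [h1, mul_one]
      _ = factor (σ d) n * transport σ B (MvPowerSeries.invOfUnit (factor d n) 1) *
        MvPowerSeries.invOfUnit (factor (σ d) n) 1 := by ring
      _ = _ := by rw [← h2, one_mul]
  rw [factorPow, transport_mul h (hf.pow _) (hg.pow _), hpow hf, hpow hg, hinv,
    transport_factor h hd, factorPow]

/-- A product with exponents permuted by `σ` has permuted coefficients. -/
lemma Expands.transport (h : PartialReflection σ B) {m m' : (ι →₀ ℕ) → ℤ → ℤ}
    {F F' : MvPowerSeries ι (LaurentSeries ℤ)} (hF : Expands m F) (hF' : Expands m' F')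
    (hm : ∀ d, d ≠ 0 → d ∉ B → m d = 0) (hm' : ∀ d, d ≠ 0 → m' (σ d) = m d) :
    F' = KacMoody.transport σ B F := by
  classical
  let φ : {d : ι →₀ ℕ // d ≠ 0} × ℤ ↪ {d : ι →₀ ℕ // d ≠ 0} × ℤ :=
    ⟨fun p => (⟨σ p.1.1, h.ne_zero p.1.2⟩, p.2), fun p p' hpp => by
      simp only [Prod.mk.injEq, Subtype.mk.injEq, EmbeddingLike.apply_eq_iff_eq] at hpp
      exact Prod.ext (Subtype.ext hpp.1) hpp.2⟩
  have hφ : ∀ p, φ (φ p) = p := fun p => Prod.ext (Subtype.ext (h.invol _)) rfl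
  have h1 : ∀ S, SuppIn (B.prod ⊤ : AddSubmonoid ((ι →₀ ℕ) × ℤ)) (finProd m S) ∧
      finProd m' (S.map φ) = KacMoody.transport σ B (finProd m S) := by
    intro S
    have hs : ∀ S, SuppIn (B.prod ⊤ : AddSubmonoid ((ι →₀ ℕ) × ℤ)) (finProd m S) := fun S =>
      finProd_suppIn fun p _ hp => ⟨by
        by_contra h1
        rw [hm _ p.1.2 h1] at hp
        exact hp rfl, trivial⟩
    refine ⟨hs S, ?_⟩
    rw [finProd, Finset.prod_map]
    induction S using Finset.induction_on with
    | empty => rw [finProd, Finset.prod_empty, Finset.prod_empty, transport_one h]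
    | insert p S hp ih =>
      have h2 : finProd m (insert p S) = finProd m {p} * finProd m S := by
        rw [finProd, Finset.prod_insert hp, finProd, Finset.prod_singleton, finProd]
      rw [h2, transport_mul h (hs _) (hs _), Finset.prod_insert hp, ih]
      congr 1
      rw [finProd, Finset.prod_singleton]
      change factorPow (σ p.1.1) p.2 (m' (σ p.1.1) p.2) = _
      rw [hm' _ p.1.2]
      by_cases hB : p.1.1 ∈ B
      · rw [transport_factorPow h hB p.1.2]
      · rw [hm _ p.1.2 hB, Pi.zero_apply, factorPow_zero, factorPow_zero, transport_one h]
  -- The involution `φ` maps finite index sets cofinally, so the partial products of both sides can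
  -- be compared along it.
  have h2 : Tendsto (Finset.map φ) atTop atTop := by
    refine tendsto_atTop_atTop.2 fun S => ⟨S.map φ, fun S' hS' => ?_⟩
    have h3 := Finset.map_subset_map (f := φ) |>.2 hS'
    refine le_trans (fun p hp => ?_) h3
    rw [Finset.mem_map]
    exact ⟨φ p, Finset.mem_map_of_mem φ hp, hφ p⟩
  ext d k
  obtain ⟨S, h3, h4⟩ := ((h2.eventually (hF' d k)).and (hF (σ d) k)).exists
  rw [← h3, (h1 S).2, coeff_transport, coeff_transport]
  split_ifs
  · exact h4
  · rfl

end

end Expansions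

end KacMoody

end

/-! ### Simple reflections on exponents and symmetry along root strings. -/

noncomputable section

namespace KacMoody

section Strings

variable {ι : Type*} [Fintype ι] {C : GCM ι} {𝔥 : Type*} [AddCommGroup 𝔥] [Module ℂ 𝔥]
  {R : Realization C 𝔥}

/-! ### Simple reflections on exponents -/

/-- The length of the `αᵢ`-string through `∑ dⱼ αⱼ`, starting at its intersection with the
hyperplane `dᵢ = 0`. -/
def GCM.stringLength (C : GCM ι) (i : ι) (d : ι →₀ ℕ) : ℕ := (-C.pair i (d.erase i)).toNat

lemma GCM.coe_stringLength (i : ι) (d : ι →₀ ℕ) :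
    (C.stringLength i d : ℤ) = -C.pair i (d.erase i) :=
  Int.toNat_of_nonneg (neg_nonneg.2 (GCM.pair_nonpos_of_apply_eq_zero (Finsupp.erase_same)))

lemma GCM.stringLength_add (i : ι) (d e : ι →₀ ℕ) :
    C.stringLength i (d + e) = C.stringLength i d + C.stringLength i e := by
  zify
  rw [coe_stringLength, coe_stringLength, coe_stringLength, Finsupp.erase_add, GCM.pair_add, neg_add]

lemma GCM.pair_single (i : ι) (n : ℕ) : C.pair i (Finsupp.single i n) = 2 * n := by
  classical
  rw [GCM.pair, Finset.sum_eq_single i]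
  · rw [C.diag, Finsupp.single_eq_same]
  · intro j _ hj
    rw [Finsupp.single_eq_of_ne hj, Nat.cast_zero, mul_zero]
  · simp

/-- With `N` the string length, `sᵢ` therefore replaces the coordinate `d i` by `N - d i`, which
stays in `Q⁺` exactly when `d i ≤ N`. -/
lemma GCM.pair_eq (i : ι) (d : ι →₀ ℕ) : C.pair i d = 2 * d i - C.stringLength i d := by
  conv_lhs => rw [← Finsupp.erase_add_single i d]
  rw [GCM.pair_add, GCM.pair_single, GCM.coe_stringLength]
  ring

variable (C) in
/-- The exponents `d` such that `sᵢ (∑ dⱼ αⱼ) ∈ Q⁺`. -/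
def reflDomain (i : ι) : AddSubmonoid (ι →₀ ℕ) where
  carrier := {d | d i ≤ C.stringLength i d}
  zero_mem' := by simp
  add_mem' := by
    intro d e hd he
    simp only [Set.mem_ofPred_eq, Finsupp.add_apply, GCM.stringLength_add] at *
    omega

lemma mem_reflDomain {i : ι} {d : ι →₀ ℕ} : d ∈ reflDomain C i ↔ d i ≤ C.stringLength i d := Iff.rfl

open Classical in
variable (C) in
/-- The action of the simple reflection `sᵢ` on exponents, where it is defined. -/
def reflFun (i : ι) (d : ι →₀ ℕ) : ι →₀ ℕ :=
  if d ∈ reflDomain C i then d.erase i + Finsupp.single i (C.stringLength i d - d i) else d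

lemma GCM.stringLength_erase_add (i : ι) (d : ι →₀ ℕ) (n : ℕ) :
    C.stringLength i (d.erase i + Finsupp.single i n) = C.stringLength i d := by
  rw [GCM.stringLength, GCM.stringLength, Finsupp.erase_add, Finsupp.erase_single, add_zero,
    Finsupp.erase_idem]

lemma erase_add_single_mem_reflDomain {i : ι} {d : ι →₀ ℕ} {n : ℕ} :
    d.erase i + Finsupp.single i n ∈ reflDomain C i ↔ n ≤ C.stringLength i d := by
  rw [mem_reflDomain, GCM.stringLength_erase_add]
  simp

lemma reflFun_erase_add_single {i : ι} {d : ι →₀ ℕ} {n : ℕ} (hn : n ≤ C.stringLength i d) :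
    reflFun C i (d.erase i + Finsupp.single i n) =
      d.erase i + Finsupp.single i (C.stringLength i d - n) := by
  rw [reflFun, if_pos (erase_add_single_mem_reflDomain.2 hn), GCM.stringLength_erase_add,
    Finsupp.erase_add, Finsupp.erase_single, add_zero, Finsupp.erase_idem]
  simp

lemma reflFun_reflFun (i : ι) (d : ι →₀ ℕ) : reflFun C i (reflFun C i d) = d := by
  by_cases hd : d ∈ reflDomain C i
  · have h1 : d.erase i + Finsupp.single i (d i) = d := Finsupp.erase_add_single i d
    rw [← h1] at hd
    have h2 := erase_add_single_mem_reflDomain.1 hd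
    conv_lhs => rw [← h1]
    rw [reflFun_erase_add_single h2, reflFun_erase_add_single (Nat.sub_le _ _),
      Nat.sub_sub_self h2, h1]
  · rw [reflFun, reflFun, if_neg hd, if_neg hd]

variable (C) in
/-- The action of the simple reflection `sᵢ` on exponents, extended by the identity. -/
def reflPerm (i : ι) : Equiv.Perm (ι →₀ ℕ) :=
  ⟨reflFun C i, reflFun C i, reflFun_reflFun i, reflFun_reflFun i⟩

open Classical in
lemma reflPerm_apply (i : ι) (d : ι →₀ ℕ) : reflPerm C i d =
    if d ∈ reflDomain C i then d.erase i + Finsupp.single i (C.stringLength i d - d i) else d := rfl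

lemma reflPerm_erase_add_single {i : ι} {d : ι →₀ ℕ} {n : ℕ} (hn : n ≤ C.stringLength i d) :
    reflPerm C i (d.erase i + Finsupp.single i n) =
      d.erase i + Finsupp.single i (C.stringLength i d - n) := reflFun_erase_add_single hn

lemma partialReflection (i : ι) : PartialReflection (reflPerm C i) (reflDomain C i) where
  invol := reflFun_reflFun i
  mem d hd := by
    rw [reflPerm_apply, if_pos hd, erase_add_single_mem_reflDomain]
    exact Nat.sub_le _ _
  add d hd e he := by
    rw [reflPerm_apply, reflPerm_apply, reflPerm_apply, if_pos hd, if_pos he,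
      if_pos (add_mem hd he), Finsupp.erase_add, GCM.stringLength_add, Finsupp.add_apply]
    rw [mem_reflDomain] at hd he
    rw [show C.stringLength i d + C.stringLength i e - (d i + e i) =
      (C.stringLength i d - d i) + (C.stringLength i e - e i) by omega, Finsupp.single_add]
    abel

lemma simpleRefl_wt_of_mem {i : ι} {d : ι →₀ ℕ} (hd : d ∈ reflDomain C i) :
    simpleRefl R i (wt R d) = wt R (reflPerm C i d) := by
  rw [simpleRefl_wt, reflPerm_apply, if_pos hd, wt_add, wt_single, GCM.pair_eq]
  conv_lhs => rw [← Finsupp.erase_add_single i d, wt_add, wt_single]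
  simp only [Finsupp.add_apply, Finsupp.erase_same, Finsupp.single_eq_same, zero_add,
    GCM.stringLength_erase_add]
  rw [mem_reflDomain] at hd
  obtain ⟨c, hc⟩ := Nat.exists_eq_add_of_le hd
  rw [hc, Nat.add_sub_cancel_left, add_sub_assoc]
  congr 1
  rw [← natCast_zsmul, ← natCast_zsmul, ← sub_smul]
  congr 1
  push_cast
  ring

lemma mem_reflDomain_of_simpleRefl {i : ι} {d : ι →₀ ℕ}
    (h : simpleRefl R i (wt R d) ∈ rootCone R) : d ∈ reflDomain C i := by
  obtain ⟨e, he⟩ := mem_rootCone_iff.1 h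
  rw [simpleRefl_wt, sub_eq_iff_eq_add] at he
  rw [mem_reflDomain]
  have h1 := GCM.pair_eq (C := C) i d
  by_contra! h2
  obtain ⟨c, hc⟩ := Int.eq_ofNat_of_zero_le (show 0 ≤ C.pair i d by omega)
  rw [hc, natCast_zsmul, ← wt_single, ← wt_add] at he
  have h3 := DFunLike.congr_fun (wt_injective he) i
  rw [Finsupp.add_apply, Finsupp.single_eq_same] at h3
  rw [hc] at h1
  omega

/-! ### Extension to the dual of the Cartan subalgebra -/

open Classical in
variable (R) in
/-- The function on `𝔥*` with value `f d` at `-∑ dᵢ αᵢ` and supported on `Q⁻`. -/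
def extend {X : Type*} [Zero X] (f : (ι →₀ ℕ) → X) (μ : Module.Dual ℂ 𝔥) : X :=
  if h : ∃ d, μ = negWt R d then f h.choose else 0

section

variable {X : Type*} [Zero X] {f : (ι →₀ ℕ) → X}

@[simp] lemma extend_negWt (d : ι →₀ ℕ) : extend R f (negWt R d) = f d := by
  have h : ∃ e, negWt R d = negWt R e := ⟨d, rfl⟩
  rw [extend, dif_pos h, ← negWt_injective h.choose_spec]

lemma extend_of_forall_ne {μ : Module.Dual ℂ 𝔥} (h : ∀ d, μ ≠ negWt R d) : extend R f μ = 0 :=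
  dif_neg fun ⟨d, hd⟩ => h d hd

lemma exists_of_extend_ne_zero {μ : Module.Dual ℂ 𝔥} (h : extend R f μ ≠ 0) :
    ∃ d, μ = negWt R d ∧ f d ≠ 0 := by
  by_cases hμ : ∃ d, μ = negWt R d
  · obtain ⟨d, rfl⟩ := hμ
    rw [extend_negWt] at h
    exact ⟨d, rfl, h⟩
  · exact absurd (dif_neg hμ) h

variable (C) in
/-- `f` is invariant under the simple reflections and vanishes where they are not defined. -/
def IsReflInvariant (f : (ι →₀ ℕ) → X) : Prop :=
  ∀ i d, (d ∈ reflDomain C i → f (reflPerm C i d) = f d) ∧ (d ∉ reflDomain C i → f d = 0)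

/-- Since `sᵢ` is an involution, it suffices to compare values when the one at `sᵢ μ` is nonzero;
then all exponents involved lie in `reflDomain`. -/
lemma IsReflInvariant.extend_weyl (hf : IsReflInvariant C f)
    {w : Module.Dual ℂ 𝔥 ≃ₗ[ℂ] Module.Dual ℂ 𝔥} (hw : w ∈ weyl R) (μ : Module.Dual ℂ 𝔥) :
    extend R f (w μ) = extend R f μ := by
  have key : ∀ i μ, extend R f (simpleRefl R i μ) ≠ 0 →
      extend R f μ = extend R f (simpleRefl R i μ) := by
    intro i μ h
    obtain ⟨d, hd, h0⟩ := exists_of_extend_ne_zero h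
    have hB : d ∈ reflDomain C i := by
      by_contra hB
      exact h0 ((hf i d).2 hB)
    have hμ : μ = negWt R (reflPerm C i d) := by
      rw [negWt_eq, ← simpleRefl_wt_of_mem hB, ← map_neg, ← negWt_eq, ← hd, simpleRefl_simpleRefl]
    rw [hd, hμ, extend_negWt, extend_negWt, (hf i d).1 hB]
  have key' : ∀ i μ, extend R f (simpleRefl R i μ) = extend R f μ := by
    intro i μ
    by_cases h : extend R f (simpleRefl R i μ) = 0
    · by_contra h'
      have := key i (simpleRefl R i μ)
      rw [simpleRefl_simpleRefl] at this
      exact h' (this (fun h0 => h' (h.trans h0.symm)))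
    · exact (key i μ h).symm
  obtain ⟨l, rfl⟩ := exists_wordProd_eq hw
  induction l generalizing μ with
  | nil => rfl
  | cons i l ih =>
    rw [wordProd_cons, LinearEquiv.mul_apply, key']
    exact ih μ (wordProd_mem l)

lemma IsReflInvariant.isStable (R : Realization C 𝔥) (hf : IsReflInvariant C f) {d : ι →₀ ℕ}
    (hd : f d ≠ 0) : IsStable R d := by
  intro w hw
  have h1 := hf.extend_weyl hw (negWt R d)
  rw [extend_negWt] at h1
  obtain ⟨e, he, -⟩ := exists_of_extend_ne_zero (h1.trans_ne hd)
  rw [negWt_eq, negWt_eq, map_neg, neg_inj] at he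
  exact mem_rootCone_iff.2 ⟨e, he⟩

end

lemma IsStable.mem_reflDomain {d : ι →₀ ℕ} (h : IsStable R d) (i : ι) : d ∈ reflDomain C i :=
  mem_reflDomain_of_simpleRefl (h _ (simpleRefl_mem i))

/-! ### Symmetrization along strings -/

/-- The difference `g t - g (N - t)` is constant in `t` by the hypotheses and changes sign under `t
↦ N - t`, so twice it is zero. No boundary condition on `g` is needed. -/
lemma symm_of_sub_antisymm {A : Type*} [AddCommGroup A] [IsAddTorsionFree A] {g h : ℤ → A} {N : ℤ}
    (hg : ∀ t, g t - g (t - 1) = h t) (hh : ∀ t, h (N + 1 - t) = -h t) (t : ℤ) :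
    g (N - t) = g t := by
  set f : ℤ → A := fun t => g t - g (N - t) with hf
  have h1 : ∀ t, f t = f (t - 1) := by
    intro t
    have e1 := hg t
    have e2 := hg (N - (t - 1))
    rw [show N - (t - 1) = N + 1 - t by ring, hh, ← e1, show N + 1 - t - 1 = N - t by ring] at e2
    simp only [hf]
    rw [show N - (t - 1) = N + 1 - t by ring, sub_eq_sub_iff_add_eq_add]
    rw [sub_eq_iff_eq_add] at e2
    rw [e2]
    abel
  have h2 : ∀ t, f t = f 0 := by
    intro t
    induction t using Int.induction_on with
    | zero => rfl
    | succ n ih => rw [h1, add_sub_cancel_right, ih]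
    | pred n ih => rw [← h1, ih]
  have h3 : f (N - t) = -f t := by
    simp only [hf, sub_sub_cancel, neg_sub]
  rw [h2, ← h2 t] at h3
  have h4 : f t = 0 := by
    have : (2 : ℕ) • f t = 0 := by
      rw [two_nsmul]
      nth_rewrite 2 [h3]
      exact add_neg_cancel _
    simpa using this
  exact (sub_eq_zero.1 h4).symm

variable (i : ι)

/-- The coefficients of `F` along the `αᵢ`-string through `d`. -/
def stringCoeff (d : ι →₀ ℕ) (F : MvPowerSeries ι (LaurentSeries ℤ)) (t : ℤ) : LaurentSeries ℤ :=
  if t < 0 then 0 else MvPowerSeries.coeff (d.erase i + Finsupp.single i t.toNat) F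

lemma stringCoeff_natCast (d : ι →₀ ℕ) (F : MvPowerSeries ι (LaurentSeries ℤ)) (t : ℕ) :
    stringCoeff i d F t = MvPowerSeries.coeff (d.erase i + Finsupp.single i t) F := by
  rw [stringCoeff, if_neg (by omega), Int.toNat_natCast]

lemma stringCoeff_mul_factor (d : ι →₀ ℕ) (F : MvPowerSeries ι (LaurentSeries ℤ)) (n t : ℤ) :
    stringCoeff i d (F * factor (Finsupp.single i 1) n) t =
      stringCoeff i d F t - qPow n * stringCoeff i d F (t - 1) := by
  classical
  by_cases ht : t < 0
  · rw [stringCoeff, stringCoeff, stringCoeff, if_pos ht, if_pos ht, if_pos (by omega), mul_zero,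
      sub_zero]
  obtain ⟨t, rfl⟩ := Int.eq_ofNat_of_zero_le (not_lt.1 ht)
  rw [stringCoeff_natCast, stringCoeff_natCast, factor, mul_sub, mul_one,
    map_sub, MvPowerSeries.coeff_mul_monomial, mul_comm]
  congr 1
  cases t with
  | zero =>
    rw [if_neg, stringCoeff, if_pos (by omega), mul_zero]
    intro h
    have := h i
    simp at this
  | succ t =>
    rw [if_pos, Nat.cast_add, Nat.cast_one, add_sub_cancel_right, stringCoeff_natCast]
    · congr 2
      rw [Finsupp.single_add, ← add_assoc, add_tsub_cancel_right]
    · rw [Finsupp.single_add, ← add_assoc]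
      exact le_add_self

/-- Reflection reverses the string. Extending by zero to negative `t` makes this hold for all
integers: positions beyond the string length vanish on one side by `hP` and on the other by
convention. -/
lemma stringCoeff_transport {P : MvPowerSeries ι (LaurentSeries ℤ)}
    (hP : ∀ d ∉ reflDomain C i, MvPowerSeries.coeff d P = 0) (d : ι →₀ ℕ) (t : ℤ) :
    stringCoeff i d (transport (reflPerm C i) (reflDomain C i) P) t =
      stringCoeff i d P (C.stringLength i d - t) := by
  classical
  by_cases ht : t < 0
  · obtain ⟨s, hs⟩ := Int.eq_ofNat_of_zero_le (show 0 ≤ (C.stringLength i d : ℤ) - t by omega)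
    rw [hs, stringCoeff, if_pos ht, stringCoeff_natCast, hP]
    rw [erase_add_single_mem_reflDomain]
    omega
  obtain ⟨t, rfl⟩ := Int.eq_ofNat_of_zero_le (not_lt.1 ht)
  rw [stringCoeff_natCast, coeff_transport]
  split_ifs with h
  · rw [erase_add_single_mem_reflDomain] at h
    rw [reflPerm_erase_add_single h, ← stringCoeff_natCast]
    congr 1
    omega
  · rw [erase_add_single_mem_reflDomain] at h
    rw [stringCoeff, if_pos (by omega)]

instance : IsAddTorsionFree (LaurentSeries ℤ) where
  nsmul_right_injective n hn x y hxy := by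
    ext k
    have h1 : n • x.coeff k = n • y.coeff k := by
      have := congrArg (fun z : LaurentSeries ℤ => z.coeff k) hxy
      simpa only [HahnSeries.coeff_nsmul, Pi.smul_apply] using this
    exact nsmul_right_injective hn h1


/-- The sum of the two series attached to `w` and `sᵢ w` is invariant under `sᵢ`. -/
lemma coeff_add_symm {P F F' : MvPowerSeries ι (LaurentSeries ℤ)}
    (hP : ∀ d ∉ reflDomain C i, MvPowerSeries.coeff d P = 0)
    (hF : F * factor (Finsupp.single i 1) 0 = P * factor (Finsupp.single i 1) 1)
    (hF' : F' * factor (Finsupp.single i 1) 0 =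
      transport (reflPerm C i) (reflDomain C i) P * factor (Finsupp.single i 1) (-1))
    (d : ι →₀ ℕ) {f : (ι →₀ ℕ) → LaurentSeries ℤ}
    (hf : ∀ d, f d = MvPowerSeries.coeff d F + qPow 1 * MvPowerSeries.coeff d F') :
    (d ∈ reflDomain C i → f (reflPerm C i d) = f d) ∧ (d ∉ reflDomain C i → f d = 0) := by
  set N := C.stringLength i d with hN
  set g : ℤ → LaurentSeries ℤ := fun t => stringCoeff i d F t + qPow 1 * stringCoeff i d F' t with hg
  -- Multiplying by `1 - e^{-αᵢ}` takes differences along the string. The prefactor `q` on `F'`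
  -- turns its numerator `1 - q⁻¹ e^{-αᵢ}` into `q - e^{-αᵢ}`, making the right-hand side
  -- antisymmetric under `t ↦ N + 1 - t`.
  have h1 : ∀ t, g t - g (t - 1) = stringCoeff i d P t - qPow 1 * stringCoeff i d P (t - 1) +
      (qPow 1 * stringCoeff i d P (N - t) - stringCoeff i d P (N - (t - 1))) := by
    intro t
    have e1 := congrArg (fun Z => stringCoeff i d Z t) hF
    have e2 := congrArg (fun Z => stringCoeff i d Z t) hF'
    simp only [stringCoeff_mul_factor, stringCoeff_transport i hP] at e1 e2
    have e3 : (qPow 0 : LaurentSeries ℤ) = 1 := rfl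
    have e4 : (qPow 1 : LaurentSeries ℤ) * qPow (-1) = 1 := (qPow 1).mul_inv
    rw [e3, one_mul] at e1 e2
    simp only [hg]
    linear_combination e1 + (qPow 1 : LaurentSeries ℤ) * e2 -
      stringCoeff i d P (N - (t - 1)) * e4
  have h2 : ∀ t, g (N - t) = g t := symm_of_sub_antisymm h1 fun t => by
    rw [show (N : ℤ) - (N + 1 - t) = t - 1 by ring, show (N : ℤ) - (N + 1 - t - 1) = t by ring,
      show (N : ℤ) + 1 - t - 1 = N - t by ring, show (N : ℤ) + 1 - t = N - (t - 1) by ring]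
    ring
  have h3 : ∀ t : ℕ, g t = f (d.erase i + Finsupp.single i t) := fun t => by
    simp only [hg, hf, stringCoeff_natCast]
  have h4 : f d = g (d i) := by rw [h3, Finsupp.erase_add_single]
  constructor
  · intro hd
    rw [h4, reflPerm_apply, if_pos hd, ← h3, ← hN, Nat.cast_sub hd, ← hN, h2]
  · intro hd
    rw [mem_reflDomain] at hd
    -- Outside the domain `d i > N`, so the mirrored position `N - d i` is negative and its
    -- coefficient is zero.
    rw [h4, ← h2]
    simp only [hg]
    rw [stringCoeff, stringCoeff, if_pos (by omega), if_pos (by omega), mul_zero, add_zero]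

end Strings

end KacMoody

end

/-! ### The products `Δ^w`, their bounds, and the sum over the Weyl group. -/

noncomputable section

namespace KacMoody

section Correction

variable {ι : Type*} [Fintype ι] {C : GCM ι} {𝔥 : Type*} [AddCommGroup 𝔥] [Module ℂ 𝔥]
  {R : Realization C 𝔥}

/-! ### Lengths of inverses and products -/

lemma wordProd_reverse (l : List ι) : wordProd R l.reverse = (wordProd R l)⁻¹ := by
  induction l with
  | nil => simp
  | cons i l ih =>
    rw [List.reverse_cons, wordProd_append, wordProd_cons, wordProd_cons, wordProd_nil, mul_one, ih,
      mul_inv_rev, simpleRefl_inv]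

lemma length_inv (w : weyl R) : length R w⁻¹ = length R w := by
  have key : ∀ w : weyl R, length R w⁻¹ ≤ length R w := by
    intro w
    obtain ⟨l, hl, hw⟩ := exists_reduced_word w
    rw [← hl, ← List.length_reverse]
    exact length_le (by rw [wordProd_reverse, hw]; rfl)
  exact le_antisymm (key w) (by simpa using key w⁻¹)

variable (R) in
/-- The simple reflection `sᵢ` as an element of the Weyl group. -/
def weylRefl (i : ι) : weyl R := ⟨simpleRefl R i, simpleRefl_mem i⟩

lemma weylRefl_mul_self (i : ι) : weylRefl R i * weylRefl R i = 1 :=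
  Subtype.ext (simpleRefl_mul_self i)

lemma weylRefl_inv (i : ι) : (weylRefl R i)⁻¹ = weylRefl R i :=
  inv_eq_of_mul_eq_one_left (weylRefl_mul_self i)

lemma length_weylRefl_mul {w : weyl R} {i : ι} (h : IsPos R (w.1⁻¹ (R.root i))) :
    length R (weylRefl R i * w) = length R w + 1 := by
  rw [← length_inv, ← length_inv w, length_eq_ncard_inversions, length_eq_ncard_inversions,
    mul_inv_rev, weylRefl_inv]
  exact ncard_inversions_mul_simpleRefl (inv_mem w.2) h

lemma length_one : length R (1 : weyl R) = 0 :=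
  Nat.le_zero.1 (length_le (l := []) rfl)

lemma eq_one_of_length_eq_zero {w : weyl R} (h : length R w = 0) : w = 1 := by
  obtain ⟨l, hl, hw⟩ := exists_reduced_word w
  rw [h, List.length_eq_zero_iff] at hl
  subst hl
  exact Subtype.ext hw.symm

/-! ### The products `Δ^w` -/

open Classical in
variable (R) in
/-- The exponents of the product `Δ^w`. -/
def deltaExp (w : weyl R) (d : ι →₀ ℕ) (n : ℤ) : ℤ :=
  if n = (if IsNeg R (w.1⁻¹ (wt R d)) then -1 else 1) then mult R (wt R d)
  else if n = 0 then -mult R (wt R d) else 0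

lemma deltaExp_eq_zero {w : weyl R} {d : ι →₀ ℕ} (h : mult R (wt R d) = 0) :
    deltaExp R w d = 0 := by
  ext n
  simp [deltaExp, h]

lemma isRoot_of_deltaExp_ne_zero {w : weyl R} {d : ι →₀ ℕ} (hd : d ≠ 0) {n : ℤ}
    (h : deltaExp R w d n ≠ 0) : IsRoot R (wt R d) := by
  refine isRoot_of_mult_ne_zero (isPos_wt.2 hd) fun h0 => h ?_
  rw [deltaExp_eq_zero h0]
  rfl

lemma isNeg_weyl_negWt {w : Module.Dual ℂ 𝔥 ≃ₗ[ℂ] Module.Dual ℂ 𝔥} {d : ι →₀ ℕ} :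
    IsNeg R (w (negWt R d)) ↔ IsPos R (w (wt R d)) := by
  rw [negWt_eq, map_neg, isNeg_neg]

lemma isPos_weyl_negWt {w : Module.Dual ℂ 𝔥 ≃ₗ[ℂ] Module.Dual ℂ 𝔥} {d : ι →₀ ℕ} :
    IsPos R (w (negWt R d)) ↔ IsNeg R (w (wt R d)) := by
  rw [negWt_eq, map_neg, isPos_neg]

open Classical in
lemma Delta_m {μ : Module.Dual ℂ 𝔥} (h : IsNeg R μ) (n : ℤ) : (Delta R).m μ n =
    if n = 1 then (mult R (-μ) : ℤ) else if n = 0 then -(mult R (-μ) : ℤ) else 0 := if_pos h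

lemma IsRealRoot.neg {α : Module.Dual ℂ 𝔥} (h : IsRealRoot R α) : IsRealRoot R (-α) := by
  obtain ⟨w, i, hi⟩ := h.2
  have h1 := h.weyl (mul_mem (mul_mem (inv_mem w.2) (simpleRefl_mem i)) w.2)
  rwa [LinearEquiv.mul_apply, LinearEquiv.mul_apply, hi, simpleRefl_root, map_neg, ← hi,
    weyl_inv_apply_apply] at h1

/-- Roots that change sign under the Weyl group have the same multiplicity as their negatives. -/
lemma mult_neg_eq {w : Module.Dual ℂ 𝔥 ≃ₗ[ℂ] Module.Dual ℂ 𝔥} (hw : w ∈ weyl R)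
    {α : Module.Dual ℂ 𝔥} (hpos : IsPos R α) (hneg : IsNeg R (w α)) :
    mult R (-α) = mult R α := by
  by_cases h : mult R α = 0
  · by_contra h'
    rw [h] at h'
    have h1 : mult R (w (-α)) ≠ 0 := by rwa [mult_weyl hw]
    have h2 : IsPos R (w (-α)) := by rwa [map_neg, isPos_neg]
    have h3 := (isRoot_of_mult_ne_zero h2 h1).isRealRoot_of_isNeg h2 (inv_mem hw) (by
      rwa [weyl_inv_apply_apply, isNeg_neg])
    have h4 := (h3.weyl (inv_mem hw)).neg
    rw [weyl_inv_apply_apply, neg_neg] at h4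
    rw [h4.mult_eq_one] at h
    exact one_ne_zero h
  · have h1 := (isRoot_of_mult_ne_zero hpos h).isRealRoot_of_isNeg hpos hw hneg
    rw [h1.mult_eq_one, h1.neg.mult_eq_one]

/-- If the sign is preserved, this is `W`-invariance of multiplicities; if it changes, `n` becomes
`-n` and `mult_neg_eq` is also needed. Weights that are neither positive nor negative after `w⁻¹`
are not roots and have multiplicity zero. -/
lemma act_Delta_m (w : weyl R) {d : ι →₀ ℕ} (hd : d ≠ 0) (n : ℤ) :
    (act R w.1 (Delta R)).m (negWt R d) n = deltaExp R w d n := by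
  classical
  have h0 : IsNeg R (negWt R d) := isNeg_iff.2 ⟨d, hd, rfl⟩
  set μ := w.1.symm (negWt R d) with hμ
  have h1 : IsNeg R μ ↔ IsPos R (w.1⁻¹ (wt R d)) := isNeg_weyl_negWt
  have h2 : IsPos R μ ↔ IsNeg R (w.1⁻¹ (wt R d)) := isPos_weyl_negWt
  have h4 : mult R (-μ) = mult R (wt R d) := by
    rw [hμ, ← map_neg, negWt_eq, neg_neg]
    exact mult_weyl (inv_mem w.2) _
  have h3 : IsPos R μ → mult R (-(-μ)) = mult R (wt R d) := by
    intro h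
    rw [neg_neg, ← h4]
    refine (mult_neg_eq w.2 h ?_).symm
    rwa [hμ, LinearEquiv.apply_symm_apply]
  have h6 : (act R w.1 (Delta R)).m (negWt R d) n = if IsNeg R μ then (Delta R).m μ n
      else if IsPos R μ then (Delta R).m (-μ) (-n) else 0 := if_pos h0
  rw [h6]
  by_cases hm : mult R (wt R d) = 0
  · rw [deltaExp_eq_zero hm]
    split_ifs with h5 h7
    · rw [Delta_m h5, h4, hm]
      simp
    · rw [Delta_m (isNeg_neg.2 h7), h3 h7, hm]
      simp
    · rfl
  · have hr := (isRoot_of_mult_ne_zero (isPos_wt.2 hd) hm).weyl (inv_mem w.2)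
    rcases hr.isPos_or_isNeg with h5 | h5
    · rw [if_pos (h1.2 h5), Delta_m (h1.2 h5), h4, deltaExp, if_neg h5.not_isNeg]
    · have h7 : ¬ IsPos R (w.1⁻¹ (wt R d)) := fun h => h.not_isNeg h5
      rw [if_neg fun h => h7 (h1.1 h), if_pos (h2.2 h5), Delta_m (isNeg_neg.2 (h2.2 h5)), h3 (h2.2 h5),
        deltaExp, if_pos h5]
      simp only [neg_eq_zero, show -n = 1 ↔ n = -1 by omega]

lemma act_Delta_m_ne_zero {w : weyl R} {μ : Module.Dual ℂ 𝔥} {n : ℤ}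
    (h : (act R w.1 (Delta R)).m μ n ≠ 0) :
    ∃ d, d ≠ 0 ∧ μ = negWt R d ∧ deltaExp R w d n ≠ 0 := by
  have h1 : IsNeg R μ := by
    by_contra h1
    simp [act, h1] at h
  obtain ⟨d, hd, rfl⟩ := isNeg_iff.1 h1
  rw [act_Delta_m w hd] at h
  exact ⟨d, hd, rfl, h⟩

lemma deltaExp_bound {w : weyl R} {d : ι →₀ ℕ} {n : ℤ} (h : deltaExp R w d n ≠ 0) :
    n = 0 ∨ n = 1 ∨ (n = -1 ∧ IsNeg R (w.1⁻¹ (wt R d))) := by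
  by_contra! h'
  refine h ?_
  rw [deltaExp, if_neg, if_neg h'.1]
  split_ifs with h1
  · exact fun h2 => h'.2.2 h2 h1
  · exact h'.2.1

/-- The exponent `n = -1` occurs only at nonzero `d`, whose degree is at least one. -/
lemma isAdmissible_deltaExp (w : weyl R) : IsAdmissible (deltaExp R w) := by
  intro d n h
  rw [mem_boundedBelow]
  rcases deltaExp_bound h with rfl | rfl | ⟨rfl, hneg⟩
  · omega
  · omega
  · have hd : d ≠ 0 := by
      rintro rfl
      rw [wt_zero, map_zero] at hneg
      exact hneg.2 neg_zero
    have : Finsupp.degree d ≠ 0 := by rwa [Ne, Finsupp.degree_eq_zero_iff]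
    omega

/-- Only inversions contribute, and they are real of multiplicity one. The numerator gives `-q` and
the denominator `(-1)⁻¹`, so each inversion yields one factor `q`; their contributions to the shift
cancel. -/
lemma act_Delta_u (w : weyl R) : (act R w.1 (Delta R)).u = qPow (length R w) ∧
    (act R w.1 (Delta R)).shift = 0 := by
  classical
  have hfin := inversions_finite w.2
  -- A finite rectangle containing every index that contributes to the two finite-support operations
  -- in `act`.
  set s := (hfin.toFinset.image fun α => -α) ×ˢ ({0, 1} : Finset ℤ) with hs
  have hm : ∀ p : Module.Dual ℂ 𝔥 × ℤ, p ∉ s → IsPos R (w.1 p.1) →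
      (Delta R).m p.1 p.2 = 0 := by
    rintro ⟨μ, n⟩ hp hpos
    by_contra h
    simp only [Delta] at h
    by_cases h1 : IsNeg R μ
    · rw [if_pos h1] at h
      have h2 : mult R (-μ) ≠ 0 := by
        intro h2
        simp [h2] at h
      have h3 : n = 0 ∨ n = 1 := by
        by_contra! h3
        simp [h3] at h
      refine hp ?_
      simp only [hs, Finset.mem_product, Finset.mem_image, Set.Finite.mem_toFinset,
        Finset.mem_insert, Finset.mem_singleton]
      refine ⟨⟨-μ, ⟨isRoot_of_mult_ne_zero h1 h2, h1, ?_⟩, neg_neg μ⟩, h3⟩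
      rwa [map_neg, isNeg_neg]
    · rw [if_neg h1] at h
      exact h rfl
  have hinv : ∀ α ∈ hfin.toFinset, IsPos R (w.1 (-α)) ∧ (Delta R).m (-α) 0 = -1 ∧
      (Delta R).m (-α) 1 = 1 := by
    intro α hα
    obtain ⟨h1, h2, h3⟩ := hfin.mem_toFinset.1 hα
    have h4 := (h1.isRealRoot_of_isNeg h2 w.2 h3).mult_eq_one
    have h5 : IsNeg R (-α) := isNeg_neg.2 h2
    refine ⟨by rwa [map_neg, isPos_neg], ?_, ?_⟩ <;> simp [Delta, h5, h4]
  constructor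
  · have h1 : (act R w.1 (Delta R)).u = 1 * ∏ᶠ p : Module.Dual ℂ 𝔥 × ℤ,
        if IsPos R (w.1 p.1) then (-qPow p.2) ^ (Delta R).m p.1 p.2 else 1 := by
      rfl
    rw [h1, one_mul, finprod_eq_prod_of_mulSupport_subset (s := s), hs, Finset.prod_product,
      Finset.prod_image (fun _ _ _ _ h => neg_injective h), Finset.prod_congr rfl (g := fun _ => qPow 1)]
    · rw [Finset.prod_const, length_eq_ncard_inversions, Set.ncard_eq_toFinset_card _ hfin]
      generalize hfin.toFinset.card = k
      induction k with
      | zero => exact Units.ext rfl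
      | succ k ih =>
        rw [pow_succ, ih]
        refine Units.ext ?_
        change HahnSeries.single _ _ * HahnSeries.single _ _ = HahnSeries.single _ _
        rw [HahnSeries.single_mul_single, mul_one, Nat.cast_succ]
    · intro α hα
      obtain ⟨h1, h2, h3⟩ := hinv α hα
      rw [Finset.prod_pair zero_ne_one]
      simp only [h2, h3, if_pos h1, zpow_neg, zpow_one]
      have : (qPow 0 : (LaurentSeries ℤ)ˣ) = 1 := Units.ext rfl
      rw [this]
      simp
    · intro p hp
      by_contra h
      refine hp ?_
      simp only
      split_ifs with h1
      · rw [hm p h h1, zpow_zero]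
      · rfl
  · have h1 : (act R w.1 (Delta R)).shift = w.1 0 + ∑ᶠ p : Module.Dual ℂ 𝔥 × ℤ,
        if IsPos R (w.1 p.1) then (Delta R).m p.1 p.2 • w.1 p.1 else 0 := by
      rfl
    rw [h1, map_zero, zero_add, finsum_eq_sum_of_support_subset (s := s), hs, Finset.sum_product,
      Finset.sum_image (fun _ _ _ _ h => neg_injective h)]
    · refine Finset.sum_eq_zero fun α hα => ?_
      obtain ⟨h1, h2, h3⟩ := hinv α hα
      rw [Finset.sum_pair zero_ne_one]
      simp only [h2, h3, if_pos h1]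
      simp
    · intro p hp
      by_contra h
      refine hp ?_
      simp only
      split_ifs with h1
      · rw [hm p h h1, zero_smul]
      · rfl

lemma isGood_act_Delta (w : weyl R) : IsGood R (act R w.1 (Delta R)) where
  shift_mem := by
    rw [(act_Delta_u w).2]
    exact zero_mem _
  neg_of_ne μ n h := by
    obtain ⟨d, hd, rfl, -⟩ := act_Delta_m_ne_zero h
    exact isNeg_iff.2 ⟨d, hd, rfl⟩
  bddBelow μ := by
    refine ⟨-1, fun n h => ?_⟩
    obtain ⟨d, -, -, h⟩ := act_Delta_m_ne_zero h
    rcases deltaExp_bound h with h | h | h <;> omega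
  multiple μ n h := by
    obtain ⟨d, hd, rfl, h'⟩ := act_Delta_m_ne_zero h
    exact ⟨_, isRoot_of_deltaExp_ne_zero hd h', -1, by rw [negWt_eq, neg_one_smul]⟩
  finite_real α hα := by
    refine ((Set.toFinite {α, -α}).prod (Set.toFinite ({0, 1, -1} : Set ℤ))).subset ?_
    rintro ⟨μ, n⟩ ⟨h, k, hk⟩
    obtain ⟨d, hd, hμ, h⟩ := act_Delta_m_ne_zero h
    simp only at hk hμ h
    have h1 : wt R d = (-k) • α := by rw [neg_smul, ← hk, hμ, negWt_eq, neg_neg]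
    have h2 := isRoot_of_deltaExp_ne_zero hd h
    rw [h1] at h2
    refine ⟨?_, ?_⟩
    · rcases hα.isUnit_of_isRoot_zsmul h2 with h3 | h3
      · refine Or.inr ?_
        change μ = -α
        rw [hk, show k = -1 by omega, neg_one_smul]
      · refine Or.inl ?_
        change μ = α
        rw [hk, show k = 1 by omega, one_smul]
    · rcases deltaExp_bound h with h | h | h
      · exact Or.inl h
      · exact Or.inr (Or.inl h)
      · exact Or.inr (Or.inr h.1)

variable (R) in
/-- The product `Δ^w` without its leading coefficient, as a power series in the `e^{-αᵢ}`. -/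
def deltaSeries (w : weyl R) : MvPowerSeries ι (LaurentSeries ℤ) :=
  (isAdmissible_deltaExp w).exists_expands.choose

lemma expands_deltaSeries (w : weyl R) : Expands (deltaExp R w) (deltaSeries R w) :=
  (isAdmissible_deltaExp w).exists_expands.choose_spec

variable (R) in
/-- The coefficient of `Δ^w` at `-∑ dᵢ αᵢ`. -/
def deltaCoeff (w : weyl R) (d : ι →₀ ℕ) : LaurentSeries ℤ :=
  qPow (length R w) * MvPowerSeries.coeff d (deltaSeries R w)

lemma isExpansion_iff {D : ProductData 𝔥} {m : (ι →₀ ℕ) → ℤ → ℤ}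
    {F : MvPowerSeries ι (LaurentSeries ℤ)} (hF : Expands m F) (hD : D.shift = 0)
    (hm : ∀ d, d ≠ 0 → D.m (negWt R d) = m d) {f : FormalSum 𝔥} :
    IsExpansion R D f ↔ f = extend R fun d => D.u * MvPowerSeries.coeff d F := by
  have h0 : ∀ S, partialProd R D S = finProd m S := fun S =>
    (rfl : _ = finProd (fun d => D.m (negWt R d)) S).trans
      (finProd_congr fun p _ => by rw [hm _ p.1.2])
  simp only [IsExpansion, hD, zero_add, h0]
  constructor
  · rintro ⟨G, h1, h2, h3⟩
    obtain rfl : G = F := Expands.unique h1 hF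
    ext μ : 1
    by_cases hμ : ∃ d, μ = negWt R d
    · obtain ⟨d, rfl⟩ := hμ
      rw [h2, extend_negWt]
    · rw [extend_of_forall_ne fun d h => hμ ⟨d, h⟩, h3 μ fun d h => hμ ⟨d, h⟩]
  · rintro rfl
    exact ⟨F, hF, fun d => extend_negWt d, fun μ hμ => extend_of_forall_ne hμ⟩

lemma isExpansion_act_Delta_iff {w : weyl R} {f : FormalSum 𝔥} :
    IsExpansion R (act R w.1 (Delta R)) f ↔ f = extend R (deltaCoeff R w) := by
  rw [isExpansion_iff (expands_deltaSeries w) (act_Delta_u w).2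
    (fun d hd => funext fun n => act_Delta_m w hd n), (act_Delta_u w).1]
  rfl

lemma coeff_qPow_mul (n : ℤ) (x : LaurentSeries ℤ) (k : ℤ) :
    ((qPow n : LaurentSeries ℤ) * x).coeff k = x.coeff (k - n) := by
  change (HahnSeries.single n (1 : ℤ) * x).coeff k = _
  conv_lhs => rw [← sub_add_cancel k n]
  rw [HahnSeries.coeff_single_mul_add, one_mul]

/-- Negative powers of `q` come only from numerator factors with `n = -1`. These are indexed by
inversions of `w⁻¹` and occur to the first power, so at most `ℓ(w)` powers of `q` can be lost. -/
lemma deltaSeries_coeff_nonneg {w : weyl R} {d : ι →₀ ℕ} {k : ℤ}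
    (h : (MvPowerSeries.coeff d (deltaSeries R w)).coeff k ≠ 0) : 0 ≤ k + length R w := by
  classical
  obtain ⟨S, hS⟩ := (expands_deltaSeries w d k).exists
  rw [← hS] at h
  -- The factors of `S` that carry `q⁻¹`; the induction on `S` tracks their number as the largest
  -- possible loss in the order in `q`.
  set U : Finset ({d : ι →₀ ℕ // d ≠ 0} × ℤ) → Finset ({d : ι →₀ ℕ // d ≠ 0} × ℤ) :=
    fun S => S.filter fun p => p.2 = -1 ∧ deltaExp R w p.1.1 p.2 ≠ 0 with hU
  have hinv : ∀ p ∈ U S, wt R p.1.1 ∈ inversions R w.1⁻¹ := by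
    intro p hp
    obtain ⟨-, h1, h2⟩ := Finset.mem_filter.1 hp
    refine ⟨isRoot_of_deltaExp_ne_zero p.1.2 h2, isPos_wt.2 p.1.2, ?_⟩
    rcases deltaExp_bound h2 with h3 | h3 | h3
    · omega
    · omega
    · exact h3.2
  have h1 : (U S).card ≤ length R w := by
    rw [← length_inv, length_eq_ncard_inversions, InvMemClass.coe_inv,
      Set.ncard_eq_toFinset_card _ (inversions_finite (inv_mem w.2))]
    refine Finset.card_le_card_of_injOn (fun p => wt R p.1.1)
      (fun p hp => (Set.Finite.mem_toFinset _).2 (hinv p hp)) ?_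
    intro p hp p' hp' hpp
    refine Prod.ext (Subtype.ext (wt_injective hpp)) ?_
    rw [(Finset.mem_filter.1 hp).2.1, (Finset.mem_filter.1 hp').2.1]
  have h2 : ∀ S, SuppIn {p : (ι →₀ ℕ) × ℤ | 0 ≤ p.2 + (U S).card} (finProd (deltaExp R w) S) := by
    intro S
    induction S using Finset.induction_on with
    | empty =>
      rw [finProd, Finset.prod_empty]
      refine suppIn_one ?_
      simp
    | insert p S hp ih =>
      have e1 : finProd (deltaExp R w) (insert p S) =
          factorPow p.1.1 p.2 (deltaExp R w p.1.1 p.2) * finProd (deltaExp R w) S := by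
        rw [finProd, Finset.prod_insert hp, finProd]
      rw [e1]
      by_cases hpU : p.2 = -1 ∧ deltaExp R w p.1.1 p.2 ≠ 0
      · have e2 : (U (insert p S)).card = (U S).card + 1 := by
          simp only [hU]
          rw [Finset.filter_insert, if_pos hpU, Finset.card_insert_of_notMem]
          exact fun h => hp (Finset.mem_filter.1 h).1
        have hroot := isRoot_of_deltaExp_ne_zero p.1.2 hpU.2
        have hneg : IsNeg R (w.1⁻¹ (wt R p.1.1)) := by
          rcases deltaExp_bound hpU.2 with h3 | h3 | h3
          · omega
          · omega
          · exact h3.2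
        have e3 : deltaExp R w p.1.1 p.2 = 1 := by
          rw [deltaExp, if_pos hneg, if_pos hpU.1,
            (hroot.isRealRoot_of_isNeg (isPos_wt.2 p.1.2) (inv_mem w.2) hneg).mult_eq_one]
          rfl
        rw [e3, factorPow_one, e2]
        have e4 : SuppIn {p : (ι →₀ ℕ) × ℤ | 0 ≤ p.2 + 1} (factor p.1.1 p.2) := by
          refine (suppIn_one (by simp)).sub ((suppIn_monomial p.1.1 p.2 1).mono ?_)
          rw [Set.singleton_subset_iff, hpU.1]
          simp
        refine e4.mul ih fun t ht b hb => ?_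
        simp only [Set.mem_ofPred_eq, Prod.snd_add] at *
        push_cast
        omega
      · have e2 : (U (insert p S)).card = (U S).card := by
          simp only [hU]
          rw [Finset.filter_insert, if_neg hpU]
        rw [e2]
        have e4 : SuppIn ((⊤ : AddSubmonoid (ι →₀ ℕ)).prod (AddSubmonoid.nonneg ℤ) :
            AddSubmonoid ((ι →₀ ℕ) × ℤ)) (factorPow p.1.1 p.2 (deltaExp R w p.1.1 p.2)) := by
          refine factorPow_suppIn_submonoid p.1.2 fun h3 => ⟨trivial, ?_⟩
          change 0 ≤ p.2
          rcases deltaExp_bound h3 with h4 | h4 | h4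
          · omega
          · omega
          · exact absurd ⟨h4.1, h3⟩ hpU
        refine e4.mul ih fun t ht b hb => ?_
        have h4 : 0 ≤ t.2 := ht.2
        simp only [Set.mem_ofPred_eq, Prod.snd_add] at *
        omega
  have h3 : 0 ≤ k + ((U S).card : ℤ) := h2 S d k h
  omega

/-- The first bound sets the factor `q^{ℓ(w)}` against the possible loss and puts coefficients in
`ℤ[[q]]`. The second uses only `k ≥ -|d|` and bounds `ℓ(w)` for the contributing `w`, whence local
finiteness. -/
lemma deltaCoeff_bound {w : weyl R} {d : ι →₀ ℕ} {k : ℤ} (h : (deltaCoeff R w d).coeff k ≠ 0) :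
    0 ≤ k ∧ (length R w : ℤ) ≤ k + d.degree := by
  rw [deltaCoeff, coeff_qPow_mul] at h
  have h1 := deltaSeries_coeff_nonneg h
  have h2 := mem_boundedBelow.1 ((expands_deltaSeries w).suppIn (isAdmissible_deltaExp w) _ _ h)
  omega

lemma deltaCoeff_zero (w : weyl R) : deltaCoeff R w 0 = qPow (length R w) := by
  rw [deltaCoeff, (expands_deltaSeries w).coeff_zero, mul_one]

/-! ### The correction sum -/

variable (R) in
/-- The coefficient of the correction sum at `-∑ dᵢ αᵢ`, as a power series in `q`. -/
def corrSeries (d : ι →₀ ℕ) : PowerSeries ℤ :=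
  PowerSeries.mk fun k => ∑' w, (deltaCoeff R w d).coeff k

variable (R) in
/-- The coefficient of the correction sum at `-∑ dᵢ αᵢ`. -/
def corrCoeff (d : ι →₀ ℕ) : LaurentSeries ℤ := HahnSeries.ofPowerSeries ℤ ℤ (corrSeries R d)

lemma summable_deltaCoeff (d : ι →₀ ℕ) (k : ℤ) :
    Summable fun w => (deltaCoeff R w d).coeff k := by
  refine summable_of_hasFiniteSupport ((finite_length_le (R := R) (k + d.degree).toNat).subset ?_)
  intro w hw
  have := deltaCoeff_bound hw
  change length R w ≤ _
  omega

lemma coeff_ofPowerSeries (f : PowerSeries ℤ) (k : ℤ) :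
    (HahnSeries.ofPowerSeries ℤ ℤ f).coeff k = if k < 0 then 0 else PowerSeries.coeff k.natAbs f :=
  PowerSeries.coeff_coe f k

lemma hasSum_corrCoeff (d : ι →₀ ℕ) (k : ℤ) :
    HasSum (fun w => (deltaCoeff R w d).coeff k) ((corrCoeff R d).coeff k) := by
  rw [corrCoeff, coeff_ofPowerSeries]
  split_ifs with hk
  · convert hasSum_zero using 2 with w
    by_contra h
    have := deltaCoeff_bound h
    omega
  · rw [corrSeries, PowerSeries.coeff_mk, Int.natAbs_of_nonneg (by omega)]
    exact (summable_deltaCoeff d k).hasSum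

lemma isCorrectionSum_iff {M : FormalSum 𝔥} :
    IsCorrectionSum R M ↔ M = extend R (corrCoeff R) := by
  have key : ∀ μ k, HasSum (fun w => (extend R (deltaCoeff R w) μ).coeff k)
      ((extend R (corrCoeff R) μ).coeff k) := by
    intro μ k
    by_cases hμ : ∃ d, μ = negWt R d
    · obtain ⟨d, rfl⟩ := hμ
      simp only [extend_negWt]
      exact hasSum_corrCoeff d k
    · simp only [extend_of_forall_ne fun d h => hμ ⟨d, h⟩, HahnSeries.coeff_zero]
      exact hasSum_zero
  constructor
  · rintro ⟨E, h1, h2⟩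
    ext μ k
    refine (h2 μ k).unique ?_
    simp only [fun w => isExpansion_act_Delta_iff.1 (h1 w).2]
    exact key μ k
  · rintro rfl
    exact ⟨fun w => extend R (deltaCoeff R w),
      fun w => ⟨isGood_act_Delta w, isExpansion_act_Delta_iff.2 rfl⟩, key⟩

lemma corrSeries_zero : corrSeries R 0 = poincare R := by
  classical
  ext k
  rw [corrSeries, poincare, PowerSeries.coeff_mk, PowerSeries.coeff_mk]
  have h1 : ∀ w : weyl R, (deltaCoeff R w 0).coeff k = if length R w = k then 1 else 0 := by
    intro w
    rw [deltaCoeff_zero]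
    change (HahnSeries.single _ _).coeff _ = _
    rw [HahnSeries.coeff_single]
    simp only [Nat.cast_inj, eq_comm]
  have hfin := finite_length_eq (R := R) k
  simp only [h1]
  rw [tsum_eq_sum (s := hfin.toFinset), Finset.sum_congr rfl (g := fun _ => 1)]
  · rw [Finset.sum_const, nsmul_eq_mul, mul_one, ← Set.ncard_eq_toFinset_card _ hfin]
    rfl
  · intro w hw
    exact if_pos (hfin.mem_toFinset.1 hw)
  · intro w hw
    exact if_neg fun h => hw (hfin.mem_toFinset.2 h)

end Correction

end KacMoody

end

/-! ### Invariance of the correction sum under simple reflections. -/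

noncomputable section

namespace KacMoody

section Invariance

variable {ι : Type*} [Fintype ι] {C : GCM ι} {𝔥 : Type*} [AddCommGroup 𝔥] [Module ℂ 𝔥]
  {R : Realization C 𝔥}

/-! ### Invariance of the correction sum -/

lemma single_notMem_reflDomain (i : ι) : Finsupp.single i 1 ∉ reflDomain C i := by
  rw [mem_reflDomain, GCM.stringLength, Finsupp.erase_single, Finsupp.single_eq_same]
  simp [GCM.pair]

lemma mult_eq_zero_of_notMem {i : ι} {d : ι →₀ ℕ} (hd : d ≠ 0) (hi : d ≠ Finsupp.single i 1)
    (hB : d ∉ reflDomain C i) : mult R (wt R d) = 0 := by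
  by_contra h
  have h1 := (isRoot_of_mult_ne_zero (isPos_wt.2 hd) h).isPos_simpleRefl (isPos_wt.2 hd) (i := i)
    fun h => hi (wt_injective (R := R) (by rw [h, wt_single, one_smul]))
  exact hB (mem_reflDomain_of_simpleRefl h1.1)

open Classical in
variable (R) in
/-- The exponents of `Δ^w` with those at `-αᵢ` removed. -/
def deltaExpAway (i : ι) (w : weyl R) (d : ι →₀ ℕ) : ℤ → ℤ :=
  if d = Finsupp.single i 1 then 0 else deltaExp R w d

lemma isAdmissible_deltaExpAway (i : ι) (w : weyl R) : IsAdmissible (deltaExpAway R i w) := by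
  intro d n h
  rw [deltaExpAway] at h
  split_ifs at h
  · exact absurd rfl h
  · exact isAdmissible_deltaExp w d n h

lemma wt_single_one (i : ι) : wt R (Finsupp.single i 1) = R.root i := by rw [wt_single, one_smul]

-- As `αᵢ` has multiplicity one, its factor is a single quotient. Cross-multiplying isolates the
-- part of the product on which `sᵢ` acts by permuting exponents.
open Classical in
lemma deltaSeries_mul_factor {i : ι} {w : weyl R} {P : MvPowerSeries ι (LaurentSeries ℤ)}
    (hP : Expands (deltaExpAway R i w) P) :
    deltaSeries R w * factor (Finsupp.single i 1) 0 = P * factor (Finsupp.single i 1)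
      (if IsNeg R (w.1⁻¹ (R.root i)) then -1 else 1) := by
  have h0 : (Finsupp.single i 1 : ι →₀ ℕ) ≠ 0 := by simp
  have hb : ∀ n : ℤ, -1 ≤ n → (Finsupp.single i 1, n) ∈ boundedBelow ι := fun n hn => by
    rw [mem_boundedBelow, Finsupp.degree_single]
    exact hn
  set ε : ℤ := if IsNeg R (w.1⁻¹ (R.root i)) then -1 else 1 with hε
  have hε' : -1 ≤ ε ∧ ε ≠ 0 := by
    rw [hε]
    split_ifs <;> norm_num
  have h1 := (expands_deltaSeries w).add (isAdmissible_deltaExp w) (expands_singleExp h0 0 1)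
    (isAdmissible_singleExp (hb _ (by norm_num)) _)
  have h2 := hP.add (isAdmissible_deltaExpAway i w) (expands_singleExp h0 ε 1)
    (isAdmissible_singleExp (hb _ hε'.1) _)
  rw [factorPow_one] at h1 h2
  refine h1.unique ?_
  convert h2 using 1
  ext d n
  simp only [Pi.add_apply, singleExp, deltaExpAway]
  by_cases hd : d = Finsupp.single i 1
  · subst hd
    rw [if_pos rfl, deltaExp, wt_single_one, mult_root, ← hε]
    by_cases h3 : n = ε
    · subst h3
      simp [hε'.2]
    · by_cases h4 : n = 0
      · subst h4
        simp [hε'.2.symm]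
      · simp [h3, h4]
  · rw [if_neg hd]
    simp [hd]

/-- The signs agree because `(sᵢ w)⁻¹ sᵢ = w⁻¹`, and the multiplicities by `W`-invariance. Exponents
left fixed because `sᵢ` is undefined on them are not roots, apart from `αᵢ`, which was removed. -/
lemma deltaExpAway_reflPerm (i : ι) (w : weyl R) {d : ι →₀ ℕ} (hd : d ≠ 0) :
    deltaExpAway R i (weylRefl R i * w) (reflPerm C i d) = deltaExpAway R i w d := by
  classical
  by_cases hi : d = Finsupp.single i 1
  · rw [hi, reflPerm_apply, if_neg (single_notMem_reflDomain i), deltaExpAway, deltaExpAway,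
      if_pos rfl, if_pos rfl]
  by_cases hB : d ∈ reflDomain C i
  · have hi' : reflPerm C i d ≠ Finsupp.single i 1 := fun h =>
      single_notMem_reflDomain (C := C) i (h ▸ (partialReflection i).mem d hB)
    rw [deltaExpAway, deltaExpAway, if_neg hi, if_neg hi']
    ext n
    have h1 : (weylRefl R i * w).1⁻¹ (wt R (reflPerm C i d)) = w.1⁻¹ (wt R d) := by
      rw [← simpleRefl_wt_of_mem hB]
      change (simpleRefl R i * w.1)⁻¹ _ = _
      rw [mul_inv_rev, simpleRefl_inv, LinearEquiv.mul_apply, simpleRefl_simpleRefl]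
    have h2 : mult R (wt R (reflPerm C i d)) = mult R (wt R d) := by
      rw [← simpleRefl_wt_of_mem hB, mult_weyl (simpleRefl_mem i)]
    rw [deltaExp, deltaExp, h1, h2]
  · rw [reflPerm_apply, if_neg hB, deltaExpAway, deltaExpAway, if_neg hi, if_neg hi,
      deltaExp_eq_zero (mult_eq_zero_of_notMem hd hi hB),
      deltaExp_eq_zero (mult_eq_zero_of_notMem hd hi hB)]

lemma deltaCoeff_add_symm (i : ι) (w : weyl R) (d : ι →₀ ℕ) :
    (d ∈ reflDomain C i →
      deltaCoeff R w (reflPerm C i d) + deltaCoeff R (weylRefl R i * w) (reflPerm C i d) =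
        deltaCoeff R w d + deltaCoeff R (weylRefl R i * w) d) ∧
    (d ∉ reflDomain C i → deltaCoeff R w d + deltaCoeff R (weylRefl R i * w) d = 0) := by
  classical
  -- Exactly one of `w` and `sᵢ w` satisfies this sign condition, and the claim is symmetric in the
  -- two. Under it `ℓ(sᵢ w) = ℓ(w) + 1`, which supplies the relative factor `q` in `coeff_add_symm`.
  have key : ∀ w : weyl R, IsPos R (w.1⁻¹ (R.root i)) →
      (d ∈ reflDomain C i →
        deltaCoeff R w (reflPerm C i d) + deltaCoeff R (weylRefl R i * w) (reflPerm C i d) =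
          deltaCoeff R w d + deltaCoeff R (weylRefl R i * w) d) ∧
      (d ∉ reflDomain C i → deltaCoeff R w d + deltaCoeff R (weylRefl R i * w) d = 0) := by
    intro w hw
    obtain ⟨P, hP⟩ := (isAdmissible_deltaExpAway i w).exists_expands
    obtain ⟨P', hP'⟩ := (isAdmissible_deltaExpAway i (weylRefl R i * w)).exists_expands
    have hm : ∀ d, d ≠ 0 → d ∉ reflDomain C i → deltaExpAway R i w d = 0 := by
      intro d hd hB
      rw [deltaExpAway]
      split_ifs with hi
      · rfl
      · exact deltaExp_eq_zero (mult_eq_zero_of_notMem hd hi hB)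
    have h1 := hP.transport (partialReflection i) hP' hm fun d hd => deltaExpAway_reflPerm i w hd
    have h2 := deltaSeries_mul_factor hP
    have h3 := deltaSeries_mul_factor hP'
    have h4 : (weylRefl R i * w).1⁻¹ (R.root i) = -(w.1⁻¹ (R.root i)) := by
      change (simpleRefl R i * w.1)⁻¹ _ = _
      rw [mul_inv_rev, simpleRefl_inv, LinearEquiv.mul_apply, simpleRefl_root, map_neg]
    rw [if_neg hw.not_isNeg] at h2
    rw [h4, if_pos (isNeg_neg.2 hw), h1] at h3
    have hP0 : ∀ d ∉ reflDomain C i, MvPowerSeries.coeff d P = 0 := by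
      intro d hd
      refine SuppIn.coeff_eq_zero_of_notMem (B := reflDomain C i) ?_ hd
      intro e k hek
      obtain ⟨S, hS⟩ := (hP e k).exists
      rw [← hS] at hek
      have h7 : SuppIn ((reflDomain C i).prod ⊤ : AddSubmonoid ((ι →₀ ℕ) × ℤ))
          (finProd (deltaExpAway R i w) S) := finProd_suppIn fun p _ hp => ⟨by
        by_contra hB
        rw [hm _ p.1.2 hB] at hp
        exact hp rfl, trivial⟩
      exact h7 e k hek
    have h5 := coeff_add_symm i hP0 h2 h3 d (f := fun d => MvPowerSeries.coeff d (deltaSeries R w) +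
      qPow 1 * MvPowerSeries.coeff d (deltaSeries R (weylRefl R i * w))) fun d => rfl
    have h6 : ∀ d, deltaCoeff R w d + deltaCoeff R (weylRefl R i * w) d = qPow (length R w) *
        (MvPowerSeries.coeff d (deltaSeries R w) +
          qPow 1 * MvPowerSeries.coeff d (deltaSeries R (weylRefl R i * w))) := by
      intro d
      rw [deltaCoeff, deltaCoeff, length_weylRefl_mul hw, mul_add, ← mul_assoc]
      congr 2
      ext k
      rw [coeff_qPow_mul]
      change (HahnSeries.single _ _).coeff _ = (HahnSeries.single _ _).coeff _
      rw [HahnSeries.coeff_single, HahnSeries.coeff_single]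
      congr 1
      push_cast
      exact propext ⟨fun h => by omega, fun h => by omega⟩
    rw [h6, h6]
    exact ⟨fun hd => by rw [h5.1 hd], fun hd => by rw [h5.2 hd, mul_zero]⟩
  rcases ((isRoot_root (R := R) i).weyl (inv_mem w.2)).isPos_or_isNeg with h | h
  · exact key w h
  · have h1 := key (weylRefl R i * w) (by
      change IsPos R ((simpleRefl R i * w.1)⁻¹ _)
      rwa [mul_inv_rev, simpleRefl_inv, LinearEquiv.mul_apply, simpleRefl_root, map_neg, isPos_neg])
    rw [← mul_assoc, weylRefl_mul_self, one_mul] at h1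
    rw [add_comm (deltaCoeff R w d), add_comm (deltaCoeff R w (reflPerm C i d))]
    exact h1

/-- Summing the pairs `w`, `sᵢ w` over all `w` counts the correction sum twice. Since `ℤ((q))` has
no torsion, symmetry of each pair gives symmetry of the sum. -/
lemma corrCoeff_isReflInvariant : IsReflInvariant C (corrCoeff R) := by
  intro i d
  have h1 : ∀ d k, HasSum
      (fun w => (deltaCoeff R w d + deltaCoeff R (weylRefl R i * w) d).coeff k)
      ((2 • corrCoeff R d).coeff k) := by
    intro d k
    rw [two_nsmul]
    simp only [HahnSeries.coeff_add]
    refine (hasSum_corrCoeff d k).add ?_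
    exact (Equiv.hasSum_iff (Equiv.mulLeft (weylRefl R i))
      (f := fun w => (deltaCoeff R w d).coeff k)).2 (hasSum_corrCoeff d k)
  have h2 : Function.Injective fun x : LaurentSeries ℤ => 2 • x := nsmul_right_injective two_ne_zero
  constructor
  · intro hd
    refine h2 ?_
    ext k
    refine (h1 _ k).unique ?_
    convert h1 d k using 3 with w
    exact (deltaCoeff_add_symm i w d).1 hd
  · intro hd
    refine h2 ?_
    ext k
    refine (h1 _ k).unique ?_
    simp only [(deltaCoeff_add_symm i _ d).2 hd, HahnSeries.coeff_zero, smul_zero]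
    exact hasSum_zero

end Invariance

end KacMoody

end

/-! ### Parabolic factorization and multiplicativity of coefficients. -/

noncomputable section

namespace KacMoody

section Parabolic

variable {ι : Type*} [Fintype ι] {C : GCM ι} {𝔥 : Type*} [AddCommGroup 𝔥] [Module ℂ 𝔥]
  {R : Realization C 𝔥}

/-! ### Parabolic subgroups -/

variable (R) in
/-- The standard parabolic subgroup of the Weyl group. -/
def parabolic (J : Set ι) : Subgroup (weyl R) := Subgroup.closure (weylRefl R '' J)

variable (R) in
/-- The minimal representatives of the cosets of the parabolic subgroup. -/
def minReps (J : Set ι) : Set (weyl R) := {v | ∀ j ∈ J, IsPos R (v.1⁻¹ (R.root j))}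

variable (R) in
/-- The root lattice of a parabolic subgroup. -/
def subLattice (J : Set ι) : AddSubgroup (Module.Dual ℂ 𝔥) := AddSubgroup.closure (R.root '' J)

variable {J : Set ι}

lemma root_mem_subLattice {j : ι} (hj : j ∈ J) : R.root j ∈ subLattice R J :=
  AddSubgroup.subset_closure (Set.mem_image_of_mem _ hj)

lemma wt_mem_subLattice_iff {d : ι →₀ ℕ} : wt R d ∈ subLattice R J ↔ ∀ i, d i ≠ 0 → i ∈ J := by
  classical
  constructor
  · intro h
    have key : ∀ x ∈ subLattice R J,
        ∃ c : ι → ℤ, (∀ i, c i ≠ 0 → i ∈ J) ∧ x = ∑ i, c i • R.root i := by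
      intro x h
      induction h using AddSubgroup.closure_induction with
      | mem x hx =>
        obtain ⟨j, hj, rfl⟩ := hx
        refine ⟨Pi.single j 1, fun i hi => ?_, ?_⟩
        · by_cases hij : i = j
          · rwa [hij]
          · rw [Pi.single_eq_of_ne hij] at hi
            exact absurd rfl hi
        · rw [Finset.sum_eq_single j]
          · simp
          · intro i _ hi
            rw [Pi.single_eq_of_ne hi, zero_smul]
          · simp
      | zero => exact ⟨0, fun i hi => absurd rfl hi, by simp⟩
      | add x y _ _ hx hy =>
        obtain ⟨c, hc, rfl⟩ := hx
        obtain ⟨c', hc', rfl⟩ := hy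
        refine ⟨c + c', fun i hi => ?_, by simp [add_smul, Finset.sum_add_distrib]⟩
        by_contra hJ
        refine hi ?_
        rw [Pi.add_apply, not_imp_comm.1 (hc i) hJ, not_imp_comm.1 (hc' i) hJ, add_zero]
      | neg x _ hx =>
        obtain ⟨c, hc, rfl⟩ := hx
        exact ⟨-c, fun i hi => hc i (neg_ne_zero.1 hi), by simp⟩
    obtain ⟨c, hc, h1⟩ := key _ h
    intro i hi
    rw [wt_eq_zsmul] at h1
    have := congrFun (sum_zsmul_root_injective R h1) i
    refine hc i ?_
    rw [← this]
    exact_mod_cast hi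
  · intro h
    refine sum_mem fun i _ => ?_
    by_cases hi : d i = 0
    · rw [hi, zero_smul]
      exact zero_mem _
    · exact nsmul_mem (root_mem_subLattice (h i hi)) _

lemma parabolic_induction {P : weyl R → Prop} (h1 : P 1)
    (h2 : ∀ j ∈ J, ∀ u ∈ parabolic R J, P u → P (weylRefl R j * u)) {u : weyl R}
    (hu : u ∈ parabolic R J) : P u := by
  induction hu using Subgroup.closure_induction_left with
  | one => exact h1
  | mul_left x hx y hy ih =>
    obtain ⟨j, hj, rfl⟩ := hx
    exact h2 j hj y hy ih
  | inv_mul_cancel x hx y hy ih =>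
    obtain ⟨j, hj, rfl⟩ := hx
    rw [weylRefl_inv]
    exact h2 j hj y hy ih

lemma simpleRefl_mem_subLattice {j : ι} (hj : j ∈ J) {α : Module.Dual ℂ 𝔥}
    (h : α ∈ subLattice R J) : simpleRefl R j α ∈ subLattice R J := by
  induction h using AddSubgroup.closure_induction with
  | mem x hx =>
    obtain ⟨i, hi, rfl⟩ := hx
    rw [simpleRefl_apply, R.pairing, Int.cast_smul_eq_zsmul]
    exact sub_mem (root_mem_subLattice hi) (zsmul_mem (root_mem_subLattice hj) _)
  | zero => rw [map_zero]; exact zero_mem _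
  | add x y _ _ hx hy => rw [map_add]; exact add_mem hx hy
  | neg x _ hx => rw [map_neg]; exact neg_mem hx

lemma parabolic_mem_subLattice {u : weyl R} (hu : u ∈ parabolic R J) {α : Module.Dual ℂ 𝔥}
    (h : α ∈ subLattice R J) : u.1 α ∈ subLattice R J := by
  exact parabolic_induction (P := fun u => u.1 α ∈ subLattice R J) h
    (fun j hj u _ ih => simpleRefl_mem_subLattice hj ih) hu

lemma parabolic_apply_of_orthogonal {u : weyl R} (hu : u ∈ parabolic R J) {d : ι →₀ ℕ}
    (hd : ∀ k, d k ≠ 0 → ∀ j ∈ J, C.A j k = 0) : u.1 (wt R d) = wt R d := by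
  refine parabolic_induction (P := fun u => u.1 (wt R d) = wt R d) rfl (fun j hj u _ ih => ?_) hu
  change simpleRefl R j (u.1 (wt R d)) = _
  rw [ih, simpleRefl_wt, GCM.pair, Finset.sum_eq_zero, zero_smul, sub_zero]
  intro k _
  by_cases hk : d k = 0
  · rw [hk, Nat.cast_zero, mul_zero]
  · rw [hd k hk j hj, zero_mul]

lemma minReps_isPos {v : weyl R} (hv : v ∈ minReps R J) {α : Module.Dual ℂ 𝔥}
    (h : α ∈ subLattice R J) (hpos : IsPos R α) : IsPos R (v.1⁻¹ α) := by
  obtain ⟨d, hd, rfl⟩ := isPos_iff.1 hpos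
  rw [wt_mem_subLattice_iff] at h
  refine ⟨?_, by simpa using hpos.2⟩
  rw [wt, map_sum]
  refine sum_mem fun i _ => ?_
  rw [map_nsmul]
  by_cases hi : d i = 0
  · rw [hi, zero_smul]
    exact zero_mem _
  · exact nsmul_mem (hv i (h i hi)).1 _

lemma mul_inv_apply (u v : weyl R) (α : Module.Dual ℂ 𝔥) :
    (u * v).1⁻¹ α = v.1⁻¹ (u.1⁻¹ α) := by
  rw [Subgroup.coe_mul, mul_inv_rev, LinearEquiv.mul_apply]

/-- `u⁻¹` preserves the sublattice of `J`, and `v⁻¹` preserves signs there by minimality of `v`. -/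
lemma isNeg_mul_inv_iff {u v : weyl R} (hu : u ∈ parabolic R J) (hv : v ∈ minReps R J)
    {α : Module.Dual ℂ 𝔥} (hα : IsRoot R α) (h : α ∈ subLattice R J) :
    IsNeg R ((u * v).1⁻¹ α) ↔ IsNeg R (u.1⁻¹ α) := by
  have h1 : u.1⁻¹ α ∈ subLattice R J := parabolic_mem_subLattice (inv_mem hu) h
  rw [mul_inv_apply]
  rcases (hα.weyl (inv_mem u.2)).isPos_or_isNeg with h2 | h2
  · exact iff_of_false (minReps_isPos hv h1 h2).not_isNeg h2.not_isNeg
  · refine iff_of_true ?_ h2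
    have := minReps_isPos hv (neg_mem h1) h2
    rwa [map_neg] at this

lemma weylRefl_mul_inv_apply (i : ι) (u : weyl R) :
    (weylRefl R i * u).1⁻¹ (R.root i) = -(u.1⁻¹ (R.root i)) := by
  rw [mul_inv_apply]
  change u.1⁻¹ ((simpleRefl R i)⁻¹ (R.root i)) = _
  rw [simpleRefl_inv, simpleRefl_root, map_neg]

lemma length_weylRefl_mul_add {w : weyl R} {i : ι} (h : IsNeg R (w.1⁻¹ (R.root i))) :
    length R w = length R (weylRefl R i * w) + 1 := by
  have h1 := length_weylRefl_mul (w := weylRefl R i * w) (i := i) (by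
    rwa [weylRefl_mul_inv_apply, isPos_neg])
  rwa [← mul_assoc, weylRefl_mul_self, one_mul] at h1

/-- By `isNeg_mul_inv_iff`, left multiplication by `sⱼ` with `j ∈ J` raises or lowers the lengths of
`u` and of `u * v` together. -/
lemma length_mul_minReps {u v : weyl R} (hu : u ∈ parabolic R J) (hv : v ∈ minReps R J) :
    length R (u * v) = length R u + length R v := by
  refine parabolic_induction (P := fun u => length R (u * v) = length R u + length R v)
    (by rw [one_mul, length_one, zero_add]) (fun j hj u hu ih => ?_) hu
  have h1 := isNeg_mul_inv_iff hu hv (isRoot_root j) (root_mem_subLattice hj)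
  rw [mul_assoc]
  rcases ((isRoot_root (R := R) j).weyl (inv_mem u.2)).isPos_or_isNeg with h | h
  · have h2 : IsPos R ((u * v).1⁻¹ (R.root j)) :=
      ((isRoot_root (R := R) j).weyl (inv_mem (u * v).2)).isPos_or_isNeg.resolve_right
        fun h2 => h.not_isNeg (h1.1 h2)
    rw [length_weylRefl_mul h, length_weylRefl_mul h2, ih]
    omega
  · have e1 := length_weylRefl_mul_add h
    have e2 := length_weylRefl_mul_add (h1.2 h)
    omega

lemma exists_mul_minReps (J : Set ι) (w : weyl R) :
    ∃ u ∈ parabolic R J, ∃ v ∈ minReps R J, w = u * v := by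
  induction hn : length R w using Nat.strong_induction_on generalizing w with
  | _ n ih =>
  by_cases h : w ∈ minReps R J
  · exact ⟨1, one_mem _, w, h, (one_mul w).symm⟩
  · simp only [minReps, Set.mem_ofPred_eq] at h
    push Not at h
    obtain ⟨j, hj, h⟩ := h
    have h1 := ((isRoot_root (R := R) j).weyl (inv_mem w.2)).isPos_or_isNeg.resolve_left h
    have h2 := length_weylRefl_mul_add h1
    obtain ⟨u, hu, v, hv, huv⟩ := ih _ (by omega) (weylRefl R j * w) rfl
    refine ⟨weylRefl R j * u,
      mul_mem (Subgroup.subset_closure (Set.mem_image_of_mem _ hj)) hu, v, hv, ?_⟩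
    rw [mul_assoc, ← huv, ← mul_assoc, weylRefl_mul_self, one_mul]

/-- Additivity of length, applied to `v'` in terms of `v` and conversely, leaves no length for `u'⁻¹
* u`. -/
lemma mul_minReps_injective {u u' v v' : weyl R} (hu : u ∈ parabolic R J)
    (hu' : u' ∈ parabolic R J) (hv : v ∈ minReps R J) (hv' : v' ∈ minReps R J)
    (h : u * v = u' * v') : u = u' ∧ v = v' := by
  have h1 := length_mul_minReps (mul_mem (inv_mem hu') hu) hv
  have h2 := length_mul_minReps (mul_mem (inv_mem hu) hu') hv'
  rw [mul_assoc, h, inv_mul_cancel_left] at h1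
  rw [mul_assoc, ← h, inv_mul_cancel_left] at h2
  have h3 := eq_one_of_length_eq_zero (show length R (u'⁻¹ * u) = 0 by omega)
  have h4 : u = u' := (inv_mul_eq_one.1 h3).symm
  subst h4
  exact ⟨rfl, mul_left_cancel h⟩

variable (R J) in
/-- The factorization of the Weyl group. -/
def parabolicEquiv : ↥(parabolic R J : Set (weyl R)) × minReps R J ≃ weyl R :=
  Equiv.ofBijective (fun p => p.1.1 * p.2.1)
    ⟨fun p p' h => by
      obtain ⟨h1, h2⟩ := mul_minReps_injective p.1.2 p'.1.2 p.2.2 p'.2.2 h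
      exact Prod.ext (Subtype.ext h1) (Subtype.ext h2),
    fun w => by
      obtain ⟨u, hu, v, hv, rfl⟩ := exists_mul_minReps J w
      exact ⟨(⟨u, hu⟩, ⟨v, hv⟩), rfl⟩⟩

lemma parabolicEquiv_apply (p : ↥(parabolic R J : Set (weyl R)) × minReps R J) :
    parabolicEquiv R J p = p.1.1 * p.2.1 := rfl

/-! ### Factorization of the correction sum -/

lemma qPow_add (a b : ℤ) : (qPow (a + b) : LaurentSeries ℤ) = qPow a * qPow b := by
  change HahnSeries.single _ _ = HahnSeries.single _ _ * HahnSeries.single _ _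
  rw [HahnSeries.single_mul_single, mul_one]

/-- Roots below `d₁ + d₂` have connected support, so they lie below `d₁` or below `d₂`. For the
former, the sign under `(u * v)⁻¹` is decided by `u`; the latter are orthogonal to `J` and fixed by
`u`, so `v` alone matters. -/
lemma deltaCoeff_mul {u v : weyl R} (hu : u ∈ parabolic R J) (hv : v ∈ minReps R J)
    {d₁ d₂ : ι →₀ ℕ} (h₁ : ∀ i, d₁ i ≠ 0 → i ∈ J) (h₂ : ∀ i, d₂ i ≠ 0 → i ∉ J)
    (h₃ : ∀ k, d₂ k ≠ 0 → ∀ j ∈ J, C.A j k = 0) :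
    deltaCoeff R (u * v) (d₁ + d₂) = deltaCoeff R u d₁ * deltaCoeff R v d₂ := by
  have key : MvPowerSeries.coeff (d₁ + d₂) (deltaSeries R (u * v)) =
      MvPowerSeries.coeff d₁ (deltaSeries R u) * MvPowerSeries.coeff d₂ (deltaSeries R v) := by
    refine (expands_deltaSeries (u * v)).coeff_add_eq_mul (expands_deltaSeries u)
      (expands_deltaSeries v) (isAdmissible_deltaExp u) (isAdmissible_deltaExp v) ?_ ?_ ?_ ?_
    · rw [Finset.disjoint_left]
      intro i hi hi'
      exact h₂ i (Finsupp.mem_support_iff.1 hi') (h₁ i (Finsupp.mem_support_iff.1 hi))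
    · intro e he he0 hne
      obtain ⟨n, hn⟩ := Function.ne_iff.1 hne
      have hroot := isRoot_of_deltaExp_ne_zero he0 hn
      have hle : ∀ i, e i ≤ d₁ i + d₂ i := he
      refine (hroot.support_connected (J := J) fun i hi j hj _ hej => ?_).imp ?_ ?_
      · refine h₃ j (fun h0 => ?_) i hi
        have := hle j
        have := not_imp_comm.1 (h₁ j) hj
        omega
      · intro h i
        by_cases hi : e i = 0
        · omega
        · have := hle i
          have := not_imp_not.2 (h₂ i) (not_not.2 (h i hi))
          omega
      · intro h i
        by_cases hi : e i = 0
        · omega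
        · have := hle i
          have := not_imp_comm.1 (h₁ i) (h i hi)
          omega
    · intro e he he0
      by_cases hm : mult R (wt R e) = 0
      · rw [deltaExp_eq_zero hm, deltaExp_eq_zero hm]
      · have h4 : wt R e ∈ subLattice R J := wt_mem_subLattice_iff.2 fun i hi => h₁ i (by
          have := he i
          omega)
        ext n
        rw [deltaExp, deltaExp,
          propext (isNeg_mul_inv_iff hu hv (isRoot_of_mult_ne_zero (isPos_wt.2 he0) hm) h4)]
    · intro e he he0
      ext n
      rw [deltaExp, deltaExp, mul_inv_apply]
      have h4 := parabolic_apply_of_orthogonal (d := e) (inv_mem hu) fun k hk => h₃ k (by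
        have := he k
        omega)
      rw [InvMemClass.coe_inv] at h4
      rw [h4]
  rw [deltaCoeff, deltaCoeff, deltaCoeff, key, length_mul_minReps hu hv, Nat.cast_add, qPow_add]
  ring

variable (R) in
/-- The coefficient of `Δ^w` at `-∑ dᵢ αᵢ`, as a power series in `q`. -/
def deltaPowerSeries (w : weyl R) (d : ι →₀ ℕ) : PowerSeries ℤ :=
  PowerSeries.mk fun k => (deltaCoeff R w d).coeff k

lemma ofPowerSeries_deltaPowerSeries (w : weyl R) (d : ι →₀ ℕ) :
    HahnSeries.ofPowerSeries ℤ ℤ (deltaPowerSeries R w d) = deltaCoeff R w d := by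
  ext k
  rw [coeff_ofPowerSeries]
  split_ifs with hk
  · by_contra h
    have := deltaCoeff_bound (Ne.symm h)
    omega
  · rw [deltaPowerSeries, PowerSeries.coeff_mk, Int.natAbs_of_nonneg (by omega)]

variable (R) in
/-- The part of the coefficient of the correction sum coming from a set of Weyl group elements. -/
def partialCorr (S : Set (weyl R)) (d : ι →₀ ℕ) : PowerSeries ℤ :=
  PowerSeries.mk fun k => ∑' w : S, (deltaCoeff R w.1 d).coeff k

lemma hasSum_partialCorr (S : Set (weyl R)) (d : ι →₀ ℕ) (k : ℕ) :
    HasSum (fun w : S => PowerSeries.coeff k (deltaPowerSeries R w.1 d))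
      (PowerSeries.coeff k (partialCorr R S d)) := by
  rw [partialCorr, PowerSeries.coeff_mk]
  simp only [deltaPowerSeries, PowerSeries.coeff_mk]
  exact ((summable_deltaCoeff d k).subtype S).hasSum

lemma finite_support_deltaPowerSeries (S : Set (weyl R)) (d : ι →₀ ℕ) (k : ℕ) :
    (Function.support fun w : S => PowerSeries.coeff k (deltaPowerSeries R w.1 d)).Finite := by
  refine Set.Finite.of_finite_image (f := Subtype.val)
    ((finite_length_le (R := R) (k + d.degree)).subset ?_) Subtype.val_injective.injOn
  rintro _ ⟨w, hw, rfl⟩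
  rw [Function.mem_support, deltaPowerSeries, PowerSeries.coeff_mk] at hw
  have := deltaCoeff_bound hw
  change length R w.1 ≤ _
  omega

lemma summable_mul_of_finite_support {κ κ' : Type*} {f : κ → ℤ} {g : κ' → ℤ}
    (hf : f.support.Finite) (hg : g.support.Finite) :
    Summable fun p : κ × κ' => f p.1 * g p.2 := by
  refine summable_of_hasFiniteSupport ((hf.prod hg).subset fun p hp => ?_)
  exact ⟨left_ne_zero_of_mul hp, right_ne_zero_of_mul hp⟩

lemma hasSum_coeff_mul {κ κ' : Type*} {f : κ → PowerSeries ℤ} {g : κ' → PowerSeries ℤ}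
    {x y : PowerSeries ℤ} (hf : ∀ k, HasSum (fun i => PowerSeries.coeff k (f i))
      (PowerSeries.coeff k x)) (hg : ∀ k, HasSum (fun j => PowerSeries.coeff k (g j))
      (PowerSeries.coeff k y))
    (hf' : ∀ k, (Function.support fun i => PowerSeries.coeff k (f i)).Finite)
    (hg' : ∀ k, (Function.support fun j => PowerSeries.coeff k (g j)).Finite) (k : ℕ) :
    HasSum (fun p : κ × κ' => PowerSeries.coeff k (f p.1 * g p.2)) (PowerSeries.coeff k (x * y)) := by
  simp only [PowerSeries.coeff_mul]
  have h : ∀ ab : ℕ × ℕ, HasSum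
      (fun p : κ × κ' => PowerSeries.coeff ab.1 (f p.1) * PowerSeries.coeff ab.2 (g p.2))
      (PowerSeries.coeff ab.1 x * PowerSeries.coeff ab.2 y) := fun ab =>
    HasSum.mul (f := fun i => PowerSeries.coeff ab.1 (f i)) (g := fun j => PowerSeries.coeff ab.2 (g j))
      (hf ab.1) (hg ab.2) (summable_mul_of_finite_support
        (f := fun i => PowerSeries.coeff ab.1 (f i)) (g := fun j => PowerSeries.coeff ab.2 (g j))
        (hf' ab.1) (hg' ab.2))
  exact hasSum_sum (f := fun (ab : ℕ × ℕ) (p : κ × κ') =>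
    PowerSeries.coeff ab.1 (f p.1) * PowerSeries.coeff ab.2 (g p.2)) fun ab _ => h ab

lemma hasSum_partialCorr_mul (S T : Set (weyl R)) (d₁ d₂ : ι →₀ ℕ) (k : ℕ) :
    HasSum (fun p : S × T => PowerSeries.coeff k
      (deltaPowerSeries R p.1.1 d₁ * deltaPowerSeries R p.2.1 d₂))
      (PowerSeries.coeff k (partialCorr R S d₁ * partialCorr R T d₂)) :=
  hasSum_coeff_mul (hasSum_partialCorr S d₁) (hasSum_partialCorr T d₂)
    (finite_support_deltaPowerSeries S d₁) (finite_support_deltaPowerSeries T d₂) k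

lemma hasSum_corrSeries (d : ι →₀ ℕ) (k : ℕ) :
    HasSum (fun w => PowerSeries.coeff k (deltaPowerSeries R w d))
      (PowerSeries.coeff k (corrSeries R d)) := by
  have h := hasSum_corrCoeff (R := R) d k
  rw [corrCoeff, coeff_ofPowerSeries, if_neg (by omega), Int.natAbs_natCast] at h
  simpa only [deltaPowerSeries, PowerSeries.coeff_mk] using h

lemma deltaPowerSeries_mul {u v : weyl R} (hu : u ∈ parabolic R J) (hv : v ∈ minReps R J)
    {d₁ d₂ : ι →₀ ℕ} (h₁ : ∀ i, d₁ i ≠ 0 → i ∈ J) (h₂ : ∀ i, d₂ i ≠ 0 → i ∉ J)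
    (h₃ : ∀ k, d₂ k ≠ 0 → ∀ j ∈ J, C.A j k = 0) : deltaPowerSeries R (u * v) (d₁ + d₂) =
      deltaPowerSeries R u d₁ * deltaPowerSeries R v d₂ := by
  refine HahnSeries.ofPowerSeries_injective (Γ := ℤ) ?_
  rw [map_mul, ofPowerSeries_deltaPowerSeries, ofPowerSeries_deltaPowerSeries,
    ofPowerSeries_deltaPowerSeries, deltaCoeff_mul hu hv h₁ h₂ h₃]

lemma corrSeries_add {d₁ d₂ : ι →₀ ℕ} (h₁ : ∀ i, d₁ i ≠ 0 → i ∈ J) (h₂ : ∀ i, d₂ i ≠ 0 → i ∉ J)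
    (h₃ : ∀ k, d₂ k ≠ 0 → ∀ j ∈ J, C.A j k = 0) : corrSeries R (d₁ + d₂) =
      partialCorr R (parabolic R J : Set (weyl R)) d₁ * partialCorr R (minReps R J) d₂ := by
  ext k
  refine ((parabolicEquiv R J).hasSum_iff.2 (hasSum_corrSeries (d₁ + d₂) k)).unique ?_
  have h4 : (fun w => PowerSeries.coeff k (deltaPowerSeries R w (d₁ + d₂))) ∘ parabolicEquiv R J =
      fun p => PowerSeries.coeff k
        (deltaPowerSeries R p.1.1 d₁ * deltaPowerSeries R p.2.1 d₂) := by
    ext p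
    rw [Function.comp_apply, parabolicEquiv_apply, deltaPowerSeries_mul p.1.2 p.2.2 h₁ h₂ h₃]
  rw [h4]
  exact hasSum_partialCorr_mul _ _ d₁ d₂ k

/-- The coefficients of the correction sum are multiplicative on orthogonal exponents. -/
lemma corrSeries_mul_corrSeries {d₁ d₂ : ι →₀ ℕ} (h₁ : ∀ i, d₁ i ≠ 0 → i ∈ J)
    (h₂ : ∀ i, d₂ i ≠ 0 → i ∉ J) (h₃ : ∀ k, d₂ k ≠ 0 → ∀ j ∈ J, C.A j k = 0) :
    corrSeries R (d₁ + d₂) * corrSeries R 0 = corrSeries R d₁ * corrSeries R d₂ := by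
  have h0 : ∀ {Q : ι → Prop} (i : ι), (0 : ι →₀ ℕ) i ≠ 0 → Q i := fun i hi => absurd rfl hi
  -- Specializing the factorization to `d₁ = 0` and `d₂ = 0` lets the two partial sums, which are
  -- not correction sums themselves, be eliminated.
  have e0 := corrSeries_add (R := R) (J := J) (d₁ := 0) (d₂ := 0) h0 h0 h0
  have e1 := corrSeries_add (R := R) (J := J) (d₁ := d₁) (d₂ := 0) h₁ h0 h0
  have e2 := corrSeries_add (R := R) (J := J) (d₁ := 0) (d₂ := d₂) h0 h₂ h₃
  rw [add_zero] at e0 e1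
  rw [zero_add] at e2
  rw [corrSeries_add h₁ h₂ h₃, e0, e1, e2]
  ring

end Parabolic

end KacMoody

end

/-! ### The product expansion of the correction sum. -/

noncomputable section

namespace KacMoody

section Factorization

variable {ι : Type*} [Fintype ι] {C : GCM ι} {𝔥 : Type*} [AddCommGroup 𝔥] [Module ℂ 𝔥]
  {R : Realization C 𝔥}

/-! ### The correction sum as a product -/

lemma constantCoeff_poincare : PowerSeries.constantCoeff (poincare R) = ((1 : ℤˣ) : ℤ) := by
  rw [← PowerSeries.coeff_zero_eq_constantCoeff_apply, poincare, PowerSeries.coeff_mk, Units.val_one]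
  have : Unique {w : weyl R // length R w = 0} :=
    ⟨⟨⟨1, length_one⟩⟩, fun w => Subtype.ext (eq_one_of_length_eq_zero w.2)⟩
  rw [Nat.card_unique, Nat.cast_one]

lemma poincare_mul_inv : poincare R * PowerSeries.invOfUnit (poincare R) 1 = 1 :=
  PowerSeries.mul_invOfUnit _ _ constantCoeff_poincare

variable (R) in
/-- The Poincaré series as a unit of `ℤ((q))`. -/
def poincareUnit : (LaurentSeries ℤ)ˣ where
  val := HahnSeries.ofPowerSeries ℤ ℤ (poincare R)
  inv := HahnSeries.ofPowerSeries ℤ ℤ (PowerSeries.invOfUnit (poincare R) 1)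
  val_inv := by rw [← map_mul, poincare_mul_inv, map_one]
  inv_val := by rw [mul_comm, ← map_mul, poincare_mul_inv, map_one]

variable (R) in
/-- The correction sum, normalized to have constant term `1`. -/
def normSeries : MvPowerSeries ι (LaurentSeries ℤ) := fun d => HahnSeries.ofPowerSeries ℤ ℤ
  (PowerSeries.invOfUnit (poincare R) 1 * corrSeries R d)

lemma coeff_normSeries (d : ι →₀ ℕ) : MvPowerSeries.coeff d (normSeries R) =
    HahnSeries.ofPowerSeries ℤ ℤ (PowerSeries.invOfUnit (poincare R) 1 * corrSeries R d) := rfl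

lemma coeff_normSeries_eq (d : ι →₀ ℕ) : MvPowerSeries.coeff d (normSeries R) =
    ((poincareUnit R)⁻¹ : (LaurentSeries ℤ)ˣ) * corrCoeff R d := by
  rw [coeff_normSeries, map_mul]
  rfl

lemma poincareUnit_mul_coeff (d : ι →₀ ℕ) :
    (poincareUnit R : LaurentSeries ℤ) * MvPowerSeries.coeff d (normSeries R) = corrCoeff R d := by
  rw [coeff_normSeries_eq, ← mul_assoc, Units.mul_inv, one_mul]

lemma coeff_zero_normSeries : MvPowerSeries.coeff 0 (normSeries R) = 1 := by
  rw [coeff_normSeries, corrSeries_zero, mul_comm, poincare_mul_inv, map_one]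

lemma normSeries_suppIn_nonneg : SuppIn ((⊤ : AddSubmonoid (ι →₀ ℕ)).prod (AddSubmonoid.nonneg ℤ) :
    AddSubmonoid ((ι →₀ ℕ) × ℤ)) (normSeries R) := by
  intro d k h
  refine ⟨trivial, ?_⟩
  change 0 ≤ k
  by_contra hk
  rw [coeff_normSeries, coeff_ofPowerSeries, if_pos (by omega)] at h
  exact h rfl

lemma normSeries_suppIn : SuppIn (boundedBelow ι) (normSeries R) := by
  refine normSeries_suppIn_nonneg.mono fun p hp => ?_
  have h : 0 ≤ p.2 := hp.2
  change -(p.1.degree : ℤ) ≤ p.2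
  omega

lemma coeff_normSeries_isReflInvariant :
    IsReflInvariant C fun d => MvPowerSeries.coeff d (normSeries R) := by
  intro i d
  simp only [coeff_normSeries_eq]
  exact ⟨fun hd => by rw [(corrCoeff_isReflInvariant i d).1 hd],
    fun hd => by rw [(corrCoeff_isReflInvariant i d).2 hd, mul_zero]⟩

lemma coeff_normSeries_add {J : Set ι} {d₁ d₂ : ι →₀ ℕ} (h₁ : ∀ i, d₁ i ≠ 0 → i ∈ J)
    (h₂ : ∀ i, d₂ i ≠ 0 → i ∉ J) (h₃ : ∀ k, d₂ k ≠ 0 → ∀ j ∈ J, C.A j k = 0) :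
    MvPowerSeries.coeff (d₁ + d₂) (normSeries R) =
      MvPowerSeries.coeff d₁ (normSeries R) * MvPowerSeries.coeff d₂ (normSeries R) := by
  have h := corrSeries_mul_corrSeries (R := R) h₁ h₂ h₃
  rw [corrSeries_zero] at h
  rw [coeff_normSeries, coeff_normSeries, coeff_normSeries, ← map_mul]
  congr 1
  have h' := poincare_mul_inv (R := R)
  set x := PowerSeries.invOfUnit (poincare R) 1
  linear_combination x * x * h - x * corrSeries R (d₁ + d₂) * h'

variable (R) in
/-- The exponents of the product expansion of the normalized correction sum. -/
def corrExp : (ι →₀ ℕ) → ℤ → ℤ := exponents (normSeries R)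

lemma isAdmissible_corrExp : IsAdmissible (corrExp R) := isAdmissible_exponents normSeries_suppIn

lemma expands_corrExp : Expands (corrExp R) (normSeries R) :=
  expands_exponents normSeries_suppIn coeff_zero_normSeries

lemma ne_zero_of_corrExp_ne_zero {d : ι →₀ ℕ} {n : ℤ} (h : corrExp R d n ≠ 0) : d ≠ 0 := by
  rintro rfl
  rw [corrExp, exponents_zero] at h
  exact h rfl

lemma nonneg_of_corrExp_ne_zero {d : ι →₀ ℕ} {n : ℤ} (h : corrExp R d n ≠ 0) : 0 ≤ n :=
  (expands_corrExp.mem_of_suppIn isAdmissible_corrExp normSeries_suppIn_nonneg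
    (ne_zero_of_corrExp_ne_zero h) h).2

variable (R) in
/-- The exponents with all conjugates in `Q⁺`. -/
def stableSubmonoid : AddSubmonoid (ι →₀ ℕ) where
  carrier := {d | IsStable R d}
  zero_mem' := isStable_zero
  add_mem' := IsStable.add

/-- Invariance makes every weight in the support of the series stable, and stable exponents form a
submonoid, so the product exponents are stable as well. -/
lemma isStable_of_corrExp_ne_zero {d : ι →₀ ℕ} {n : ℤ} (h : corrExp R d n ≠ 0) :
    IsStable R d := by
  have h1 : SuppIn ((stableSubmonoid R).prod ⊤ : AddSubmonoid ((ι →₀ ℕ) × ℤ)) (normSeries R) := by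
    intro e k hek
    refine ⟨(coeff_normSeries_isReflInvariant (R := R)).isStable R (d := e) fun h0 => hek ?_, trivial⟩
    rw [h0, HahnSeries.coeff_zero]
  exact (expands_corrExp.mem_of_suppIn isAdmissible_corrExp h1 (ne_zero_of_corrExp_ne_zero h) h).1

lemma corrExp_eq_zero_of_not_isStable {d : ι →₀ ℕ} (h : ¬ IsStable R d) : corrExp R d = 0 := by
  ext n
  by_contra hn
  exact h (isStable_of_corrExp_ne_zero hn)

/-- Permuting the exponents by `sᵢ` permutes the coefficients of the product, which are invariant;
uniqueness of exponents does the rest. -/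
lemma corrExp_isReflInvariant : IsReflInvariant C (corrExp R) := by
  classical
  intro i d
  have hout : ∀ d ∉ reflDomain C i, corrExp R d = 0 := fun d hd =>
    corrExp_eq_zero_of_not_isStable fun h => hd (h.mem_reflDomain i)
  refine ⟨fun hd => ?_, hout d⟩
  have hσ := partialReflection (C := C) i
  by_cases h0 : d = 0
  · rw [h0, hσ.zero]
  have hadm : IsAdmissible fun d => corrExp R (reflPerm C i d) := by
    intro e n h
    have := nonneg_of_corrExp_ne_zero h
    rw [mem_boundedBelow]
    omega
  obtain ⟨F, hF⟩ := hadm.exists_expands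
  have h1 := expands_corrExp.transport hσ hF (fun e _ he => hout e he)
    fun e _ => by rw [hσ.invol]
  have h2 : F = normSeries R := by
    rw [h1]
    ext e : 1
    rw [coeff_transport]
    split_ifs with he
    · exact (coeff_normSeries_isReflInvariant i e).1 he
    · exact ((coeff_normSeries_isReflInvariant i e).2 he).symm
  rw [h2] at hF
  exact hF.exponent_eq hadm expands_corrExp isAdmissible_corrExp h0 fun _ _ => rfl

/-- Delete the exponent at `d` from the product. By induction the remaining exponents below `d` lie
on one side of the cut, so the coefficient at `d` is the product of those at the two pieces.
Multiplicativity gives the original series the same coefficient, and uniqueness makes the deleted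
exponent zero. -/
lemma corrExp_eq_zero_of_not_supportConnected {d : ι →₀ ℕ} (hd : ¬ SupportConnected C d) :
    corrExp R d = 0 := by
  classical
  induction d using WellFoundedLT.induction with
  | _ d ih =>
  rw [SupportConnected] at hd
  push Not at hd
  obtain ⟨U, ⟨i₁, hi₁, hi₁'⟩, hU, i₂, hi₂, hi₂'⟩ := hd
  set d₁ := d.filter (· ∈ U) with hd₁
  set d₂ := d.filter (· ∉ U) with hd₂
  have hadd : d₁ + d₂ = d := Finsupp.filter_add_filter_not d _
  have e₁ : ∀ i ∈ U, d₁ i = d i := fun i hi => Finsupp.filter_apply_pos _ _ hi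
  have e₁' : ∀ i ∉ U, d₁ i = 0 := fun i hi => Finsupp.filter_apply_neg _ _ hi
  have e₂ : ∀ i ∉ U, d₂ i = d i := fun i hi => Finsupp.filter_apply_pos (fun i => i ∉ U) _ hi
  have e₂' : ∀ i ∈ U, d₂ i = 0 := fun i hi =>
    Finsupp.filter_apply_neg (fun i => i ∉ U) _ (not_not.2 hi)
  have hd0 : d ≠ 0 := by
    rintro rfl
    exact hi₁' rfl
  set m : (ι →₀ ℕ) → ℤ → ℤ := fun e => if e = d then 0 else corrExp R e with hm
  have hadm : IsAdmissible m := by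
    intro e n h
    simp only [hm] at h
    split_ifs at h
    · exact absurd rfl h
    · exact isAdmissible_corrExp e n h
  obtain ⟨F, hF⟩ := hadm.exists_expands
  have hlt : ∀ e, e < d → MvPowerSeries.coeff e F = MvPowerSeries.coeff e (normSeries R) :=
    fun e he => hF.coeff_congr expands_corrExp fun e' he' => if_neg (he'.trans_lt he).ne
  have hF₁ : MvPowerSeries.coeff (d₁ + d₂) F =
      MvPowerSeries.coeff d₁ (normSeries R) * MvPowerSeries.coeff d₂ (normSeries R) := by
    refine hF.coeff_add_eq_mul expands_corrExp expands_corrExp isAdmissible_corrExp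
      isAdmissible_corrExp ?_ ?_ ?_ ?_
    · rw [Finset.disjoint_left]
      intro i h1 h2
      rw [Finsupp.mem_support_iff] at h1 h2
      by_cases hi : i ∈ U
      · exact h2 (e₂' i hi)
      · exact h1 (e₁' i hi)
    · intro e he _ hme
      rw [hadd] at he
      have hne : e ≠ d := by
        rintro rfl
        exact hme (if_pos rfl)
      have hme' : m e = corrExp R e := if_neg hne
      have hconn : SupportConnected C e := by
        by_contra h
        exact hme (hme'.trans (ih e (lt_of_le_of_ne he hne) h))
      by_cases h : ∃ i ∈ U, e i ≠ 0
      · refine Or.inl fun i => ?_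
        by_cases hi : e i = 0
        · omega
        · have hiU := hconn U h (fun i hi j hj h1 h2 => hU i hi j hj
            (by have := he i; omega) (by have := he j; omega)) i hi
          rw [e₁ i hiU]
          exact he i
      · push Not at h
        refine Or.inr fun i => ?_
        by_cases hi : e i = 0
        · omega
        · rw [e₂ i fun hiU => hi (h i hiU)]
          exact he i
    · intro e he _
      refine if_neg ?_
      rintro rfl
      have := he i₂
      rw [e₁' i₂ hi₂'] at this
      omega
    · intro e he _
      refine if_neg ?_
      rintro rfl
      have := he i₁
      rw [e₂' i₁ hi₁] at this
      omega
  -- `U` is intersected with the support of `d`, because orthogonality across the cut is known only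
  -- for vertices of that support.
  have hF₂ := coeff_normSeries_add (R := R) (J := {i | i ∈ U ∧ d i ≠ 0}) (d₁ := d₁) (d₂ := d₂)
    (fun i hi => by
      have hiU : i ∈ U := by
        by_contra h
        exact hi (e₁' i h)
      exact ⟨hiU, e₁ i hiU ▸ hi⟩)
    (fun i hi h => hi (e₂' i h.1))
    (fun k hk j hj => by
      have hkU : k ∉ U := fun h => hk (e₂' k h)
      exact hU j hj.1 k hkU hj.2 (e₂ k hkU ▸ hk))
  rw [← hF₂, hadd] at hF₁
  have h := expands_corrExp.exponent_eq isAdmissible_corrExp hF hadm hd0 fun e he => by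
    rcases he.lt_or_eq with h | rfl
    · exact (hlt e h).symm
    · exact hF₁.symm
  rw [h]
  exact if_pos rfl

variable (R) in
/-- The good product expanding to the correction sum. -/
def corrProduct : ProductData 𝔥 where
  u := poincareUnit R
  shift := 0
  m := extend R (corrExp R)

lemma corrProduct_m_ne_zero {μ : Module.Dual ℂ 𝔥} {n : ℤ} (h : (corrProduct R).m μ n ≠ 0) :
    ∃ d, μ = negWt R d ∧ corrExp R d n ≠ 0 := by
  obtain ⟨d, rfl, -⟩ := exists_of_extend_ne_zero (R := R) (f := corrExp R) (μ := μ) fun h0 => by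
    simp only [corrProduct, h0] at h
    exact h rfl
  simp only [corrProduct, extend_negWt] at h
  exact ⟨d, rfl, h⟩

lemma isNeg_of_corrProduct_m_ne_zero {μ : Module.Dual ℂ 𝔥} {n : ℤ}
    (h : (corrProduct R).m μ n ≠ 0) {w : Module.Dual ℂ 𝔥 ≃ₗ[ℂ] Module.Dual ℂ 𝔥}
    (hw : w ∈ weyl R) : IsNeg R (w μ) := by
  obtain ⟨d, rfl, h'⟩ := corrProduct_m_ne_zero h
  rw [isNeg_weyl_negWt]
  refine ⟨isStable_of_corrExp_ne_zero h' w hw, ?_⟩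
  rw [(map_ne_zero_iff w w.injective), wt_ne_zero]
  exact ne_zero_of_corrExp_ne_zero h'

lemma corrProduct_m_weyl {w : Module.Dual ℂ 𝔥 ≃ₗ[ℂ] Module.Dual ℂ 𝔥} (hw : w ∈ weyl R)
    (μ : Module.Dual ℂ 𝔥) : (corrProduct R).m (w μ) = (corrProduct R).m μ :=
  corrExp_isReflInvariant.extend_weyl hw μ

/-- No factor changes sign, since its weight is stable; thus `w` contributes no unit and no shift,
and only permutes the exponents, which are invariant. -/
lemma act_corrProduct {w : Module.Dual ℂ 𝔥 ≃ₗ[ℂ] Module.Dual ℂ 𝔥} (hw : w ∈ weyl R) :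
    act R w (corrProduct R) = corrProduct R := by
  classical
  have h0 : ∀ p : Module.Dual ℂ 𝔥 × ℤ, IsPos R (w p.1) → (corrProduct R).m p.1 p.2 = 0 := by
    intro p hp
    by_contra h
    exact hp.not_isNeg (isNeg_of_corrProduct_m_ne_zero h hw)
  have hu : (act R w (corrProduct R)).u = (corrProduct R).u := by
    refine mul_eq_left.2 (finprod_eq_one_of_forall_eq_one fun p => ?_)
    split_ifs with hp
    · rw [h0 p hp, zpow_zero]
    · rfl
  have hshift : (act R w (corrProduct R)).shift = (corrProduct R).shift := by
    refine (congrArg₂ (· + ·) (map_zero w) (finsum_eq_zero_of_forall_eq_zero fun p => ?_)).trans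
      (add_zero _)
    split_ifs with hp
    · rw [h0 p hp, zero_smul]
    · rfl
  have hm : (act R w (corrProduct R)).m = (corrProduct R).m := by
    ext μ n
    have hinv : (corrProduct R).m (w.symm μ) n = (corrProduct R).m μ n :=
      congrFun (corrProduct_m_weyl (inv_mem hw) μ) n
    by_cases h : (corrProduct R).m μ n = 0
    · rw [h] at hinv ⊢
      change (if IsNeg R μ then if IsNeg R (w.symm μ) then (corrProduct R).m (w.symm μ) n
        else if IsPos R (w.symm μ) then (corrProduct R).m (-w.symm μ) (-n) else 0 else 0) = 0
      split_ifs with h1 h2 h3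
      · exact hinv
      · by_contra h4
        have h5 := isNeg_of_corrProduct_m_ne_zero h4 hw
        rw [map_neg, LinearEquiv.apply_symm_apply, isNeg_neg] at h5
        exact h5.not_isNeg h1
      · rfl
      · rfl
    · have h1 : IsNeg R μ := isNeg_of_corrProduct_m_ne_zero h (one_mem _)
      have h2 : IsNeg R (w.symm μ) := isNeg_of_corrProduct_m_ne_zero h (inv_mem hw)
      exact (if_pos h1).trans ((if_pos h2).trans hinv)
  calc act R w (corrProduct R) = ⟨(act R w (corrProduct R)).u, (act R w (corrProduct R)).shift,
        (act R w (corrProduct R)).m⟩ := rfl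
    _ = _ := by rw [hu, hshift, hm]

lemma isGood_corrProduct : IsGood R (corrProduct R) where
  shift_mem := zero_mem _
  neg_of_ne μ n h := isNeg_of_corrProduct_m_ne_zero h (one_mem _)
  bddBelow μ := by
    refine ⟨0, fun n h => ?_⟩
    obtain ⟨d, -, h⟩ := corrProduct_m_ne_zero h
    exact nonneg_of_corrExp_ne_zero h
  multiple μ n h := by
    obtain ⟨d, rfl, hd⟩ := corrProduct_m_ne_zero h
    -- Conjugate to the antidominant chamber, where a connected support gives a multiple of a root,
    -- and carry that root back by `w⁻¹`.
    obtain ⟨w, hw, e, he, ha⟩ := (isStable_of_corrExp_ne_zero hd).exists_isAntidominant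
    have h1 : corrExp R e n ≠ 0 := by
      have h2 := congrFun (corrProduct_m_weyl hw (negWt R d)) n
      rw [negWt_eq, map_neg, he, ← negWt_eq, ← negWt_eq] at h2
      simp only [corrProduct, extend_negWt] at h2
      rwa [h2]
    have hc : SupportConnected C e := by
      by_contra hc
      rw [corrExp_eq_zero_of_not_supportConnected hc] at h1
      exact h1 rfl
    obtain ⟨k, m, hm, rfl⟩ :=
      exists_multiple_isTwoSidedRoot (R := R) (ne_zero_of_corrExp_ne_zero h1) ha hc
    refine ⟨w⁻¹ (wt R m), hm.1.weyl (inv_mem hw), -k, ?_⟩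
    rw [← weyl_inv_apply_apply w (negWt R d), negWt_eq, map_neg, he, wt_nsmul, map_neg, map_nsmul,
      neg_smul, natCast_zsmul]
  finite_real α hα := by
    refine Set.Finite.subset Set.finite_empty ?_
    rintro ⟨μ, n⟩ ⟨h, k, hk⟩
    simp only at h hk
    -- No exponent lies on a real root line: `w` takes such a weight to a multiple of `αᵢ`, and `sᵢ
    -- w` to its negative, while stability makes both negative.
    obtain ⟨w, i, hi⟩ := hα.2
    have h1 := isNeg_of_corrProduct_m_ne_zero h w.2
    have h2 := isNeg_of_corrProduct_m_ne_zero h (mul_mem (simpleRefl_mem i) w.2)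
    rw [hk, map_zsmul] at h1 h2
    rw [LinearEquiv.mul_apply, hi, simpleRefl_root, smul_neg, isNeg_neg] at h2
    rw [hi] at h1
    exact h2.not_isNeg h1

lemma isExpansion_corrProduct : IsExpansion R (corrProduct R) (extend R (corrCoeff R)) := by
  rw [isExpansion_iff expands_corrExp rfl fun d _ => extend_negWt d]
  congr 1
  ext d : 1
  exact (poincareUnit_mul_coeff d).symm

lemma extend_corrCoeff_mem :
    extend R (corrCoeff R) ∈ invariantGoodProducts R powerSeriesSubring := by
  refine ⟨corrProduct R, isGood_corrProduct, ⟨_, rfl⟩, ⟨_, rfl⟩, isExpansion_corrProduct,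
    fun μ => ?_, fun w => ?_⟩
  · by_cases h : extend R (corrCoeff R) μ = 0
    · rw [h]
      exact zero_mem _
    · obtain ⟨d, rfl, -⟩ := exists_of_extend_ne_zero h
      rw [extend_negWt]
      exact ⟨_, rfl⟩
  · rw [act_corrProduct w.2]
    exact ⟨isGood_corrProduct, isExpansion_corrProduct⟩

end Factorization

end KacMoody

end

/-! ### The main theorem. -/

theorem mainTheorem2 {ι : Type*} [Fintype ι] {C : KacMoody.GCM ι}
    {𝔥 : Type*} [AddCommGroup 𝔥] [Module ℂ 𝔥] (R : KacMoody.Realization C 𝔥) :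
    (∃! M : KacMoody.FormalSum 𝔥, KacMoody.IsCorrectionSum R M) ∧
    ∀ M : KacMoody.FormalSum 𝔥, KacMoody.IsCorrectionSum R M →
      M ∈ KacMoody.invariantGoodProducts R KacMoody.powerSeriesSubring ∧
      (∀ (w : KacMoody.weyl R) (μ : Module.Dual ℂ 𝔥), M (w.1 μ) = M μ) ∧
      (∀ μ : Module.Dual ℂ 𝔥, M μ ≠ 0 → μ ∈ KacMoody.negImCone R) ∧
      M 0 = HahnSeries.ofPowerSeries ℤ ℤ (KacMoody.poincare R) := by
  refine ⟨⟨_, KacMoody.isCorrectionSum_iff.2 rfl, fun M hM => KacMoody.isCorrectionSum_iff.1 hM⟩,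
    fun M hM => ?_⟩
  obtain rfl := KacMoody.isCorrectionSum_iff.1 hM
  refine ⟨KacMoody.extend_corrCoeff_mem,
    fun w μ => KacMoody.corrCoeff_isReflInvariant.extend_weyl w.2 μ, fun μ hμ => ?_, ?_⟩
  · obtain ⟨d, rfl, hd⟩ := KacMoody.exists_of_extend_ne_zero hμ
    exact (KacMoody.corrCoeff_isReflInvariant.isStable R hd).negWt_mem_negImCone
  · rw [← KacMoody.negWt_zero (R := R), KacMoody.extend_negWt, KacMoody.corrCoeff,
      KacMoody.corrSeries_zero]
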